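/- Let $N,k\in\mathbb N$, let $\Omega\subset\mathbb R^N$ be open and bounded, $T>0$, and $\Omega_T:=\Omega\times(0,T]$. For $v\in\mathbb R^k$ and $m>0$ write $v^{m}:=|v|^{m-1}v$ (with $0^m:=0$). Let $\nu>0$, $L\in\mathbb R$, and let $A\colon\Omega_T\times\mathbb R^k\times\mathbb R^{kN}\to\mathbb R^{kN}$ be a Carathéodory vector field (measurable in $(x,t)$ for all $(v,\xi)$, continuous in $(v,\xi)$ for a.e. $(x,t)$) such that for a.e. $(x,t)\in\Omega_T$ and all $(v,\xi)\in\mathbb R^k\times\mathbb R^{kN}$, with $\xi=(\xi_1,\dots,\xi_N)$, $\xi_\alpha\in\mathbb R^k$, $$A(x,t,v,\xi)\cdot\xi\ge\nu|\xi|^2,\qquad |A(x,t,v,\xi)|\le L|\xi|,\qquad \sum_{\alpha=1}^N\big(A_\alpha(x,t,v,\xi)\cdot v^{m}\big)\big(\xi_\alpha\cdot v^{m}\big)\ge0 .$$ A *local weak solution* of $\partial_t u-\operatorname{div}A(x,t,u,Du^{m})=\operatorname{div}F$ in $\Omega_T$ is a map $u\in C^0((0,T);L^{1+m}_{\rm loc}(\Omega,\mathbb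 R^k))$ with $u^{m}\in L^2_{\rm loc}(0,T;W^{1,2}_{\rm loc}(\Omega,\mathbb R^k))$ such that $$\iint_{\Omega_T}\big[u\cdot\partial_t\varphi-A(x,t,u,Du^{m})\cdot D\varphi\big]\,dx\,dt=\iint_{\Omega_T}F\cdot D\varphi\,dx\,dt$$ for all $\varphi\in C^\infty(\mathbb R^N\times\mathbb R,\mathbb R^k)$ with compact support in $\Omega\times(0,T)$. For $z_o=(x_o,t_o)$ and $\rho>0$ let $Q_\rho(z_o):=B_\rho(x_o)\times(t_o-\rho^2,t_o]$. A function is in $L^q_{\rm loc}(\Omega_T)$, $1\le q\le\infty$, if it is in $L^q(K)$ for every compact $K\subset\Omega_T$. **Proposition.** Let $0<m\le m_c:=\frac{N-2}{N+2}$ (so $N\ge3$), $p>\frac{N+2}2$, and let $r\ge1$ satisfy $\lambda_r:=N(m-1)+2r>0$. Then every local weak solution $u$, with $F\in L^{2p}_{\rm loc}(\Omega_T,\mathbb R^{kN})$, that satisfies $u\in L^r_{\rm loc}(\Omega_T,\mathbb R^k)$ is locally bounded in $\Omega_T$, i.e. $u\in L^\infty_{\rm loc}(\Omega_T,\mathbb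 R^k)$. Moreover, there is a constant $C>0$ depending only on $N,m,\nu,L,p,r$ such that for every such $\Omega,T,k,A,F,u$ and every cylinder $Q_\rho(z_o)\subset\Omega_T$ $$\operatorname*{ess\,sup}_{Q_{\rho/2}(z_o)}|u|\le C\left[\Big(1+[F]_{2p,Q_\rho(z_o)}^{\frac{2p(N+2)}{2p-(N+2)}}\Big)\frac1{|Q_\rho(z_o)|}\iint_{Q_\rho(z_o)}\big(|u|^r+1\big)\,dx\,dt\right]^{\frac2{\lambda_r}},$$ where $$[F]_{2p,Q_\rho(z_o)}:=\left[\frac{\rho^{2p}}{|Q_\rho(z_o)|}\iint_{Q_\rho(z_o)}|F|^{2p}\,dx\,dt\right]^{\frac1{2p}}$$ (the right-hand side may be $+\infty$ if $Q_\rho(z_o)$ is not compactly contained in $\Omega_T$). -/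

import Mathlib

open MeasureTheory Set Filter Topology
open scoped ENNReal ContDiff

noncomputable section

namespace PorousMedium

/-- Space `ℝ^N` (resp. `ℝ^k`) with the Euclidean norm. -/
abbrev Vec (n : ℕ) : Type := EuclideanSpace ℝ (Fin n)

/-- `ℝ^{kN}` with the Euclidean (Frobenius) norm and inner product; an element `ξ` has the `N`
components `ξ α ∈ ℝ^k`, `α` being the index of the spatial direction. -/
abbrev GradVec (N k : ℕ) : Type := PiLp 2 (fun _ : Fin N => Vec k)

/-- Space-time points `z = (x, t) ∈ ℝ^N × ℝ` (with Lebesgue measure `volume`). -/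
abbrev SpaceTime (N : ℕ) : Type := Vec N × ℝ

/-- `Ω_T = Ω × (0, T]`. -/
def cyl {N : ℕ} (Ω : Set (Vec N)) (T : ℝ) : Set (SpaceTime N) := Ω ×ˢ Ioc 0 T

/-- `Ω × (0, T)`, the interior of `Ω_T` for open `Ω`. -/
def openCyl {N : ℕ} (Ω : Set (Vec N)) (T : ℝ) : Set (SpaceTime N) := Ω ×ˢ Ioo 0 T

/-- The one-sided parabolic cylinder `Q_ρ(x₀, t₀) = B_ρ(x₀) × (t₀ - ρ², t₀]`. -/
def Q {N : ℕ} (z₀ : SpaceTime N) (ρ : ℝ) : Set (SpaceTime N) :=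
  Metric.ball z₀.1 ρ ×ˢ Ioc (z₀.2 - ρ ^ 2) z₀.2

/-- `f ∈ L^q_loc(S)`: `f ∈ L^q(K)` for every compact `K ⊆ S`. For `q = ⊤` this says that `f` is
(essentially) locally bounded in `S`. -/
def MemLpLoc {N : ℕ} {E : Type*} [NormedAddCommGroup E] (f : SpaceTime N → E) (q : ℝ≥0∞)
    (S : Set (SpaceTime N)) : Prop :=
  ∀ K : Set (SpaceTime N), IsCompact K → K ⊆ S → MemLp f q (volume.restrict K)

/-- The power of a vector, `|v|^(a-1) v`; it is `0` for `v = 0`. -/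
def vpow {k : ℕ} (v : Vec k) (a : ℝ) : Vec k := ‖v‖ ^ (a - 1) • v

/-- `f ∈ W^{1,1}_loc(Ω, ℝ^k)` with weak gradient `g`, i.e. `g α` is the weak `α`-th partial
derivative of `f` in the open set `Ω`. -/
structure HasWeakGradient {N k : ℕ} (Ω : Set (Vec N)) (f : Vec N → Vec k)
    (g : Vec N → GradVec N k) : Prop where
  locallyIntegrableOn : LocallyIntegrableOn f Ω
  locallyIntegrableOn_grad : LocallyIntegrableOn g Ω
  integral_eq : ∀ φ : Vec N → ℝ, ContDiff ℝ ∞ φ → HasCompactSupport φ → tsupport φ ⊆ Ω →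
    ∀ α : Fin N, ∫ x in Ω, (fderiv ℝ φ x (EuclideanSpace.single α 1)) • f x
      = - ∫ x in Ω, φ x • g x α

/-- `w ∈ L²_loc(0, T; W^{1,2}_loc(Ω, ℝ^k))` with spatial weak gradient `G = Dw`: for almost every
time `t` the slice `G(·, t)` is the weak gradient of `w(·, t)`, and `w`, `G` are square integrable
on compact subsets of `Ω × (0, T)`. -/
structure HasSpatialWeakGradient {N k : ℕ} (Ω : Set (Vec N)) (T : ℝ) (w : SpaceTime N → Vec k)
    (G : SpaceTime N → GradVec N k) : Prop where
  memLpLoc : MemLpLoc w 2 (openCyl Ω T)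
  memLpLoc_grad : MemLpLoc G 2 (openCyl Ω T)
  slice : ∀ᵐ t ∂(volume.restrict (Ioo 0 T)),
    HasWeakGradient Ω (fun x => w (x, t)) (fun x => G (x, t))

/-- `u ∈ C⁰((0, T); L^q_loc(Ω, ℝ^k))`. -/
structure ContinuousInLpLoc {N k : ℕ} (Ω : Set (Vec N)) (T : ℝ) (q : ℝ≥0∞)
    (u : SpaceTime N → Vec k) : Prop where
  aestronglyMeasurable : AEStronglyMeasurable u (volume.restrict (openCyl Ω T))
  memLp : ∀ K : Set (Vec N), IsCompact K → K ⊆ Ω → ∀ t ∈ Ioo 0 T,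
    MemLp (fun x => u (x, t)) q (volume.restrict K)
  tendsto : ∀ K : Set (Vec N), IsCompact K → K ⊆ Ω → ∀ t ∈ Ioo 0 T,
    Tendsto (fun s => eLpNorm (fun x => u (x, s) - u (x, t)) q (volume.restrict K)) (𝓝 t) (𝓝 0)

/-- `A : Ω_T × ℝ^k × ℝ^{kN} → ℝ^{kN}` is a Carathéodory vector field satisfying the ellipticity,
growth and diagonal structure conditions with the constants `ν`, `L`; here `m` is the exponent of
the porous medium system. -/
structure IsAdmissible {N k : ℕ} (Ω : Set (Vec N)) (T m ν L : ℝ)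
    (A : SpaceTime N → Vec k → GradVec N k → GradVec N k) : Prop where
  measurable : ∀ v ξ, AEStronglyMeasurable (fun z => A z v ξ) (volume.restrict (cyl Ω T))
  continuous : ∀ᵐ z ∂(volume.restrict (cyl Ω T)),
    Continuous (fun y : Vec k × GradVec N k => A z y.1 y.2)
  ellipticity : ∀ᵐ z ∂(volume.restrict (cyl Ω T)), ∀ v ξ, ν * ‖ξ‖ ^ 2 ≤ inner ℝ (A z v ξ) ξ
  growth : ∀ᵐ z ∂(volume.restrict (cyl Ω T)), ∀ v ξ, ‖A z v ξ‖ ≤ L * ‖ξ‖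
  diagonal : ∀ᵐ z ∂(volume.restrict (cyl Ω T)), ∀ v ξ,
    0 ≤ ∑ α : Fin N, inner ℝ (A z v ξ α) (vpow v m) * inner ℝ (ξ α) (vpow v m)

/-- The time derivative `∂_t φ` of a differentiable map. -/
def timeDeriv {N k : ℕ} (φ : SpaceTime N → Vec k) (z : SpaceTime N) : Vec k :=
  fderiv ℝ φ z (0, 1)

/-- The spatial gradient `Dφ` of a differentiable map. -/
def spaceGrad {N k : ℕ} (φ : SpaceTime N → Vec k) (z : SpaceTime N) : GradVec N k :=
  WithLp.toLp 2 (fun α => fderiv ℝ φ z (EuclideanSpace.single α 1, 0))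

/-- `u` is a local weak solution of `∂_t u - div A(x, t, u, D u^m) = div F` in `Ω_T`, where `u^m`
stands for `vpow u m`. The map `G` is the weak gradient `D u^m`; it is unique almost everywhere.
Test maps have compact support in `Ω × (0, T)`. -/
def IsLocalWeakSolution {N k : ℕ} (Ω : Set (Vec N)) (T m : ℝ)
    (A : SpaceTime N → Vec k → GradVec N k → GradVec N k) (F : SpaceTime N → GradVec N k)
    (u : SpaceTime N → Vec k) : Prop :=
  ContinuousInLpLoc Ω T (ENNReal.ofReal (1 + m)) u ∧
  ∃ G : SpaceTime N → GradVec N k,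
    HasSpatialWeakGradient Ω T (fun z => vpow (u z) m) G ∧
    ∀ φ : SpaceTime N → Vec k, ContDiff ℝ ∞ φ → HasCompactSupport φ →
      tsupport φ ⊆ openCyl Ω T →
      ∫ z in cyl Ω T,
          (inner ℝ (u z) (timeDeriv φ z) - inner ℝ (A z (u z) (G z)) (spaceGrad φ z))
        = ∫ z in cyl Ω T, inner ℝ (F z) (spaceGrad φ z)

/-- `[F]_{2p, Q_ρ(z₀)} = (ρ^{2p} ⨍_{Q_ρ(z₀)} |F|^{2p} dx dt)^{1/(2p)}`, with values in `[0, ∞]`. -/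
def scaledNorm {N k : ℕ} (F : SpaceTime N → GradVec N k) (p : ℝ) (z₀ : SpaceTime N) (ρ : ℝ) :
    ℝ≥0∞ :=
  (ENNReal.ofReal ρ ^ (2 * p) * ⨍⁻ z in Q z₀ ρ, ‖F z‖ₑ ^ (2 * p) ∂volume) ^ (1 / (2 * p))

end PorousMedium

end

/-! The proof is a De Giorgi iteration on the tails `∫ |u|^s` over `{|u| > h}`, with rising levels
`h` and shrinking cylinders, where `s = min r p`. Write `λ_s = N(m-1) + 2s`.

Energy estimate. The equation is tested with `ζ² η Φ(u^m)`, where `Φ(v) = (1 - κ/|v|)₊² T(|v|)^c v`,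
`T` is a bounded truncation, `κ = h^m`, and `c ≥ 0` satisfies `s = 1 + m + mc`. In the elliptic
part, differentiating the radial weight produces a rank-one term whose pairing with `A` is a
nonnegative multiple of the sum in the diagonal structure condition, so it can be discarded
(`inner_flux_ge`). In the parabolic part, `Φ(u^m)` is a nonnegative multiple of `u` and `B(σ) = ∫₀^σ
τ^m g(τ^m) dτ`, with `g` the weight, is convex. Hence the increments of `B(|u|)` are bounded by `(u
- u') · Φ(u^m)` (`weightPrim_sub_le_inner`).

Time regularity. The test map has no time derivative. Instead of time averages, the proof uses the
correlation `c(w) = ∫ u(z) · ψ(z + w) dz`. It is continuous, and mollified translates of `ψ` are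
admissible test maps, so the equation becomes an integrated ODE for `c` along the time axis
(`correlation_sub_eq_integral`). Dividing its increments by the time step and letting the step tend
to zero gives the bound on almost every time slice and the bound on the weighted gradient
(`IsCutoffSolution.energy_slice`, `IsCutoffSolution.energy_grad`).

Gain of integrability. Hölder and Sobolev on time slices combine the two bounds
(`IsCutoffSolution.parabolic_sobolev`). Removing the truncation by Fatou then controls the tail of
order `s + λ_s/N` by the power `1 + 2/N` of the tail of order `s` plus a force term
(`IsCutoffSolution.gain`). Since `λ_s ≥ 0`, the order can be lowered back to `s` at the price of a
power of the level (`IsCutoffSolution.level_step`). Hölder puts the tail in the force term to the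
power `θ = 1 - 1/p`, and `θ(1 + 2/N) > 1` because `p > (N+2)/2`. The recursion is therefore
superlinear, and the tails tend to zero once a normalized initial tail is below some `ε`
(`exists_smallness_bound`).

Choice of the level. The normalized tail carries `h^(-λ_s/2)`, and above level `h` the tail of order
`s` is at most `h^(s-r) ∫ |u|^r`. The product of the two powers of `h` is `h^(-λ_r/2)`, so smallness
holds when `h^(λ_r/2)` is a large multiple of the bracket in the claim. This gives the exponent
`2/λ_r` and the bound `|u| ≤ 2h` (`exists_cylinder_bound`). The condition `m ≤ m_c` makes `λ_r > 0`
imply `r > 1 + m`, which provides the integrability needed for the energy estimate. -/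

set_option linter.unusedSectionVars false

noncomputable section

namespace PorousMedium

/-! ### Translations in `L^q` and correlations. -/

section Translation

variable {E : Type*} [NormedAddCommGroup E] [NormedSpace ℝ E] [FiniteDimensional ℝ E]
  [MeasurableSpace E] [BorelSpace E] {μ : Measure E} [μ.IsAddHaarMeasure]

theorem tendsto_eLpNorm_translate_sub {H : Type*} [NormedAddCommGroup H] {q : ℝ≥0∞} (hq1 : 1 ≤ q)
    (hq : q ≠ ⊤) {Y : E → H} (hY : MemLp Y q μ) :
    Tendsto (fun w => eLpNorm (fun z => Y (z + w) - Y z) q μ) (𝓝 0) (𝓝 0) := by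
  have : Fact (1 ≤ q) := ⟨hq1⟩
  -- Currying addition makes the translation depend continuously on `w` in the compact-open
  -- topology, as required for continuity of composition in `Lp`.
  let g : C(E, C(E, E)) := (ContinuousMap.mk (fun a : E × E => a.2 + a.1) (by fun_prop)).curry
  have hg : ∀ w, MeasurePreserving (g w) μ μ := fun w => measurePreserving_add_right μ w
  have h1 : Continuous (fun w => Lp.compMeasurePreserving (g w) (hg w) (hY.toLp Y)) :=
    continuous_const.compMeasurePreservingLp g.continuous hg hq
  have h2 := ((h1.sub (continuous_const (y := hY.toLp Y))).enorm).tendsto 0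
  have h0 : ∀ w, ‖Lp.compMeasurePreserving (g w) (hg w) (hY.toLp Y) - hY.toLp Y‖ₑ
      = eLpNorm (fun z => Y (z + w) - Y z) q μ := by
    intro w
    rw [Lp.enorm_def]
    refine eLpNorm_congr_ae ?_
    have e1 := Lp.coeFn_compMeasurePreserving (hY.toLp Y) (hg w)
    have e2 := (hg w).quasiMeasurePreserving.ae_eq_comp hY.coeFn_toLp
    filter_upwards [Lp.coeFn_sub (Lp.compMeasurePreserving (g w) (hg w) (hY.toLp Y)) (hY.toLp Y),
      e1, e2, hY.coeFn_toLp] with z h1 h2 h3 h4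
    rw [h1, Pi.sub_apply, h2, h3, h4]
    rfl
  have h3 := h2.congr h0
  have h4 := h0 0
  simp only [add_zero, sub_self, eLpNorm_zero'] at h4
  rw [← h4]
  exact h3

theorem enorm_integral_inner_le {α : Type*} [MeasurableSpace α] {μ : Measure α} {H : Type*}
    [NormedAddCommGroup H] [InnerProductSpace ℝ H] {p q : ℝ≥0∞} [p.HolderConjugate q]
    {X Y : α → H} (hX : AEStronglyMeasurable X μ) (hY : AEStronglyMeasurable Y μ) :
    ‖∫ z, inner ℝ (X z) (Y z) ∂μ‖ₑ ≤ eLpNorm X p μ * eLpNorm Y q μ := by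
  refine (enorm_integral_le_lintegral_enorm _).trans ?_
  rw [← eLpNorm_one_eq_lintegral_enorm]
  have := eLpNorm_le_eLpNorm_mul_eLpNorm'_of_norm (p := p) (q := q) (r := 1) hX hY
    (fun a b => inner ℝ a b) 1 (.of_forall fun x => by
      simpa using norm_inner_le_norm (𝕜 := ℝ) (X x) (Y x))
  simpa using this

theorem integrable_inner_of_memLp {α : Type*} [MeasurableSpace α] {μ : Measure α} {H : Type*}
    [NormedAddCommGroup H] [InnerProductSpace ℝ H] {p q : ℝ≥0∞} [p.HolderConjugate q]
    {X Y : α → H} (hX : MemLp X p μ) (hY : MemLp Y q μ) :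
    Integrable (fun z => inner ℝ (X z) (Y z)) μ := by
  rw [← memLp_one_iff_integrable]
  refine ⟨hX.1.inner hY.1, ?_⟩
  have := eLpNorm_le_eLpNorm_mul_eLpNorm'_of_norm (p := p) (q := q) (r := 1) hX.1 hY.1
    (fun a b => inner ℝ a b) 1 (.of_forall fun x => by
      simpa using norm_inner_le_norm (𝕜 := ℝ) (X x) (Y x))
  refine this.trans_lt ?_
  have := ENNReal.mul_lt_top hX.2 hY.2
  simpa using this

theorem memLp_translate {H : Type*} [NormedAddCommGroup H] {q : ℝ≥0∞} {Y : E → H}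
    (hY : MemLp Y q μ) (w : E) : MemLp (fun z => Y (z + w)) q μ :=
  hY.comp_measurePreserving (measurePreserving_add_right μ w)

theorem eLpNorm_translate {H : Type*} [NormedAddCommGroup H] {q : ℝ≥0∞} {Y : E → H}
    (hY : AEStronglyMeasurable Y μ) (w : E) :
    eLpNorm (fun z => Y (z + w)) q μ = eLpNorm Y q μ :=
  eLpNorm_comp_measurePreserving hY (measurePreserving_add_right μ w)

/-- The correlation `w ↦ ∫ X(z) · Y(z + w) dz`. -/
def correlation {H : Type*} [NormedAddCommGroup H] [InnerProductSpace ℝ H] (μ : Measure E)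
    (X Y : E → H) (w : E) : ℝ := ∫ z, inner ℝ (X z) (Y (z + w)) ∂μ

variable {H : Type*} [NormedAddCommGroup H] [InnerProductSpace ℝ H]

/-- By Hölder, the modulus of continuity is inherited from translations of `Y`, so only the exponent
of the translated factor has to be finite. -/
theorem continuous_correlation {p q : ℝ≥0∞} [hpq : p.HolderConjugate q] (hq1 : 1 ≤ q) (hq : q ≠ ⊤)
    {X Y : E → H} (hX : MemLp X p μ) (hY : MemLp Y q μ) : Continuous (correlation μ X Y) := by
  rw [continuous_iff_continuousAt]
  intro w₀
  rw [ContinuousAt, tendsto_iff_edist_tendsto_0]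
  have h1 := tendsto_eLpNorm_translate_sub hq1 hq (memLp_translate hY w₀)
  have h2 : Tendsto (fun w => eLpNorm (fun z => Y (z + w) - Y (z + w₀)) q μ) (𝓝 w₀) (𝓝 0) := by
    have : Tendsto (fun w => w - w₀) (𝓝 w₀) (𝓝 0) := by
      have : Continuous fun w : E => w - w₀ := by fun_prop
      simpa using this.tendsto w₀
    refine (h1.comp this).congr fun w => ?_
    simp only [Function.comp]
    congr 1
    ext z
    congr 2
    abel
  have h3 : Tendsto (fun w => eLpNorm X p μ * eLpNorm (fun z => Y (z + w) - Y (z + w₀)) q μ)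
      (𝓝 w₀) (𝓝 0) := by
    have := ENNReal.Tendsto.const_mul h2 (Or.inr hX.2.ne)
    simpa using this
  refine tendsto_of_tendsto_of_tendsto_of_le_of_le tendsto_const_nhds h3 (fun _ => zero_le) ?_
  intro w
  have i1 := integrable_inner_of_memLp hX (memLp_translate hY w)
  have i2 := integrable_inner_of_memLp hX (memLp_translate hY w₀)
  simp only [correlation, edist_eq_enorm_sub]
  rw [← integral_sub i1 i2]
  simp only [← inner_sub_right]
  exact enorm_integral_inner_le hX.1 ((memLp_translate hY w).1.sub (memLp_translate hY w₀).1)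

/-- The bound is uniform in the shift and serves as the dominating constant when mollified
correlations are passed to the limit. -/
theorem abs_correlation_le {p q : ℝ≥0∞} [hpq : p.HolderConjugate q]
    {X Y : E → H} (hX : MemLp X p μ) (hY : MemLp Y q μ) (w : E) :
    |correlation μ X Y w| ≤ (eLpNorm X p μ * eLpNorm Y q μ).toReal := by
  have h := enorm_integral_inner_le (p := p) (q := q) hX.1 (memLp_translate hY w).1
  rw [eLpNorm_translate hY.1] at h
  rw [← Real.norm_eq_abs, ← toReal_enorm]
  exact ENNReal.toReal_mono (ENNReal.mul_ne_top hX.2.ne hY.2.ne) h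

end Translation

/-! ### Mollification on a finite-dimensional space. -/

section Mollification

open ContinuousLinearMap
open scoped Convolution

variable {E : Type*} [NormedAddCommGroup E] [NormedSpace ℝ E] [FiniteDimensional ℝ E]

/-- A sequence of bump functions at the origin with shrinking supports. -/
def bumpSeq (E : Type*) [NormedAddCommGroup E] (n : ℕ) : ContDiffBump (0 : E) where
  rIn := 1 / (2 * (n + 1))
  rOut := 1 / (n + 1)
  rIn_pos := by positivity
  rIn_lt_rOut := by
    refine one_div_lt_one_div_of_lt (by positivity) ?_
    have : (0 : ℝ) ≤ n := n.cast_nonneg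
    linarith

theorem tendsto_bumpSeq_rOut : Tendsto (fun n => (bumpSeq E n).rOut) atTop (𝓝 0) :=
  tendsto_one_div_add_atTop_nhds_zero_nat

/-- A bounded ratio of the two radii is needed for almost everywhere convergence of the
mollifications. -/
theorem bumpSeq_rOut_le (n : ℕ) : (bumpSeq E n).rOut ≤ 2 * (bumpSeq E n).rIn := by
  simp only [bumpSeq]
  have : (n : ℝ) + 1 ≠ 0 := by positivity
  field_simp
  norm_num

variable [MeasurableSpace E] [BorelSpace E] (μ : Measure E) [μ.IsAddHaarMeasure]
variable {H : Type*} [NormedAddCommGroup H] [NormedSpace ℝ H] [CompleteSpace H]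

/-- Mollification of `f` at scale `1 / (n + 1)`. -/
def mollify (n : ℕ) (f : E → H) : E → H := (bumpSeq E n).normed μ ⋆[lsmul ℝ ℝ, μ] f

variable {μ}

theorem mollify_apply (n : ℕ) (f : E → H) (x : E) :
    mollify μ n f x = ∫ y, (bumpSeq E n).normed μ y • f (x - y) ∂μ := rfl

theorem mollify_apply_swap (n : ℕ) (f : E → H) (x : E) :
    mollify μ n f x = ∫ y, (bumpSeq E n).normed μ (x - y) • f y ∂μ := by
  rw [mollify, convolution_lsmul_swap]

theorem contDiff_mollify (n : ℕ) {f : E → H} (hf : LocallyIntegrable f μ) :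
    ContDiff ℝ ∞ (mollify μ n f) :=
  (bumpSeq E n).hasCompactSupport_normed.contDiff_convolution_left _
    (bumpSeq E n).contDiff_normed hf

theorem fderiv_mollify (n : ℕ) {f : E → H} (hf : LocallyIntegrable f μ) (x v : E) :
    fderiv ℝ (mollify μ n f) x v = ∫ y, fderiv ℝ ((bumpSeq E n).normed μ) (x - y) v • f y ∂μ := by
  have h := ((bumpSeq E n).hasCompactSupport_normed (μ := μ)).hasFDerivAt_convolution_left
    (lsmul ℝ ℝ) (bumpSeq E n).contDiff_normed hf x
  rw [mollify, h.fderiv, convolution_eq_swap]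
  have hint : Integrable (fun t => ((lsmul ℝ ℝ : ℝ →L[ℝ] H →L[ℝ] H).precompL E)
      (fderiv ℝ ((bumpSeq E n).normed μ) (x - t)) (f t)) μ := by
    have hc : HasCompactSupport (fderiv ℝ ((bumpSeq E n).normed μ)) :=
      (bumpSeq E n).hasCompactSupport_normed.fderiv ℝ
    have := hc.convolutionExists_left ((lsmul ℝ ℝ : ℝ →L[ℝ] H →L[ℝ] H).precompL E)
      ((bumpSeq E n).contDiff_normed.continuous_fderiv (n := 1) one_ne_zero) hf x
    exact (this.integrable_swap)
  rw [ContinuousLinearMap.integral_apply hint]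
  rfl

theorem support_mollify_subset (n : ℕ) {f : E → H} {K : Set E} (hK : ∀ x, x ∉ K → f x = 0) :
    Function.support (mollify μ n f) ⊆ Metric.cthickening (1 / (n + 1)) K := by
  intro x hx
  by_contra hcon
  apply hx
  rw [mollify_apply]
  have : ∀ y, (bumpSeq E n).normed μ y • f (x - y) = 0 := by
    intro y
    by_cases hy : y ∈ Metric.ball (0 : E) (bumpSeq E n).rOut
    · rw [hK, smul_zero]
      intro hxy
      apply hcon
      refine Metric.mem_cthickening_of_dist_le x (x - y) _ _ hxy ?_
      rw [dist_eq_norm]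
      simp only [mem_ball_zero_iff, bumpSeq] at hy
      simpa using hy.le
    · rw [← (bumpSeq E n).support_normed_eq (μ := μ), Function.notMem_support] at hy
      rw [hy, zero_smul]
  simp [this]

theorem ae_tendsto_mollify {f : E → H} (hf : LocallyIntegrable f μ) :
    ∀ᵐ x ∂μ, Tendsto (fun n => mollify μ n f x) atTop (𝓝 (f x)) :=
  ContDiffBump.ae_convolution_tendsto_right_of_locallyIntegrable tendsto_bumpSeq_rOut
    (.of_forall fun n => bumpSeq_rOut_le n) hf

theorem tendsto_mollify_of_continuous {f : E → H} (hf : Continuous f) (x : E) :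
    Tendsto (fun n => mollify μ n f x) atTop (𝓝 (f x)) :=
  ContDiffBump.convolution_tendsto_right_of_continuous tendsto_bumpSeq_rOut hf x

theorem lintegral_enorm_bumpSeq (n : ℕ) : ∫⁻ y, ‖(bumpSeq E n).normed μ y‖ₑ ∂μ = 1 := by
  have h1 := (bumpSeq E n).integral_normed (μ := μ)
  have h2 : ∀ y, ‖(bumpSeq E n).normed μ y‖ₑ = ENNReal.ofReal ((bumpSeq E n).normed μ y) := by
    intro y
    rw [Real.enorm_of_nonneg ((bumpSeq E n).nonneg_normed y)]
  simp only [h2]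
  rw [← ofReal_integral_eq_lintegral_ofReal (bumpSeq E n).integrable_normed
    (.of_forall (bumpSeq E n).nonneg_normed), h1, ENNReal.ofReal_one]

theorem norm_mollify_le (n : ℕ) {f : E → H} {M : ℝ} (hM : ∀ x, ‖f x‖ ≤ M) (x : E) :
    ‖mollify μ n f x‖ ≤ M := by
  rw [mollify_apply]
  calc ‖∫ y, (bumpSeq E n).normed μ y • f (x - y) ∂μ‖
      ≤ ∫ y, (bumpSeq E n).normed μ y * M ∂μ := by
        refine norm_integral_le_of_norm_le ((bumpSeq E n).integrable_normed.mul_const M)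
          (.of_forall fun y => ?_)
        rw [norm_smul, Real.norm_of_nonneg ((bumpSeq E n).nonneg_normed y)]
        exact mul_le_mul_of_nonneg_left (hM _) ((bumpSeq E n).nonneg_normed y)
    _ = M := by rw [integral_mul_const, (bumpSeq E n).integral_normed, one_mul]

theorem aestronglyMeasurable_sub_snd {f : E → H} (hf : AEStronglyMeasurable f μ) :
    AEStronglyMeasurable (fun z : E × E => f (z.1 - z.2)) (μ.prod μ) := by
  have h := hf.comp_quasiMeasurePreserving
    (quasiMeasurePreserving_sub_of_right_invariant μ μ)
  exact h

/-- Splitting the kernel as a product of two square roots, Cauchy–Schwarz bounds the squared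
mollification by the kernel average of `|f|²`, since the kernel has mass one. Tonelli and
translation invariance do the rest. -/
theorem eLpNorm_mollify_le (n : ℕ) {f : E → H} (hf : AEStronglyMeasurable f μ) :
    eLpNorm (mollify μ n f) 2 μ ≤ eLpNorm f 2 μ := by
  have key : ∀ x, ‖mollify μ n f x‖ₑ ^ (2 : ℝ) ≤
      ∫⁻ y, ‖(bumpSeq E n).normed μ y‖ₑ * ‖f (x - y)‖ₑ ^ (2 : ℝ) ∂μ := by
    intro x
    have hm : AEMeasurable (fun y => ‖f (x - y)‖ₑ) μ :=
      (hf.comp_quasiMeasurePreserving (quasiMeasurePreserving_sub_left μ x)).enorm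
    have hr : AEMeasurable (fun y => ‖(bumpSeq E n).normed μ y‖ₑ) μ :=
      (bumpSeq E n).continuous_normed.aestronglyMeasurable.enorm
    have h1 : ‖mollify μ n f x‖ₑ ≤ ∫⁻ y, (‖(bumpSeq E n).normed μ y‖ₑ ^ (1 / 2 : ℝ)) *
        (‖(bumpSeq E n).normed μ y‖ₑ ^ (1 / 2 : ℝ) * ‖f (x - y)‖ₑ) ∂μ := by
      rw [mollify_apply]
      refine (enorm_integral_le_lintegral_enorm _).trans_eq ?_
      congr 1
      ext y
      rw [enorm_smul, ← mul_assoc, ← ENNReal.rpow_add_of_nonneg _ _ (by norm_num) (by norm_num)]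
      norm_num
    have h2 := ENNReal.lintegral_mul_le_Lp_mul_Lq μ (p := 2) (q := 2)
      (by constructor <;> norm_num) (hr.pow_const (1 / 2 : ℝ)) ((hr.pow_const (1 / 2 : ℝ)).mul hm)
    have h3 : (∫⁻ y, (‖(bumpSeq E n).normed μ y‖ₑ ^ (1 / 2 : ℝ)) ^ (2 : ℝ) ∂μ) = 1 := by
      rw [← lintegral_enorm_bumpSeq (μ := μ) n]
      congr 1; ext y
      rw [← ENNReal.rpow_mul]; norm_num
    rw [h3, ENNReal.one_rpow, one_mul] at h2
    have h4 := ENNReal.rpow_le_rpow (h1.trans h2) (z := 2) (by norm_num)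
    rw [← ENNReal.rpow_mul] at h4
    refine h4.trans_eq ?_
    rw [show (1 / 2 : ℝ) * 2 = 1 by norm_num, ENNReal.rpow_one]
    congr 1; ext y
    simp only [Pi.mul_apply]
    rw [ENNReal.mul_rpow_of_nonneg _ _ (by norm_num), ← ENNReal.rpow_mul]
    norm_num
  have hkey : ∫⁻ x, ‖mollify μ n f x‖ₑ ^ (2 : ℝ) ∂μ ≤ ∫⁻ x, ‖f x‖ₑ ^ (2 : ℝ) ∂μ := by
    calc ∫⁻ x, ‖mollify μ n f x‖ₑ ^ (2 : ℝ) ∂μ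
        ≤ ∫⁻ x, ∫⁻ y, ‖(bumpSeq E n).normed μ y‖ₑ * ‖f (x - y)‖ₑ ^ (2 : ℝ) ∂μ ∂μ :=
          lintegral_mono key
      _ = ∫⁻ y, ∫⁻ x, ‖(bumpSeq E n).normed μ y‖ₑ * ‖f (x - y)‖ₑ ^ (2 : ℝ) ∂μ ∂μ := by
          refine lintegral_lintegral_swap ?_
          exact ((bumpSeq E n).continuous_normed.aestronglyMeasurable (μ := μ)).enorm.comp_snd.mul
            ((aestronglyMeasurable_sub_snd hf).enorm.pow_const _)
      _ = ∫⁻ y, ‖(bumpSeq E n).normed μ y‖ₑ * ∫⁻ x, ‖f x‖ₑ ^ (2 : ℝ) ∂μ ∂μ := by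
          congr 1; ext y
          rw [lintegral_const_mul' _ _ (by finiteness),
            lintegral_sub_right_eq_self (fun x => ‖f x‖ₑ ^ (2 : ℝ)) y]
      _ = ∫⁻ x, ‖f x‖ₑ ^ (2 : ℝ) ∂μ := by
          rw [lintegral_mul_const _ (by
            exact (bumpSeq E n).continuous_normed.measurable.enorm), lintegral_enorm_bumpSeq,
            one_mul]
  rw [eLpNorm_eq_lintegral_rpow_enorm_toReal (by norm_num) (by norm_num),
    eLpNorm_eq_lintegral_rpow_enorm_toReal (by norm_num) (by norm_num)]
  exact ENNReal.rpow_le_rpow (by simpa using hkey) (by norm_num)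

/-- The difference is a kernel average of `f(x - y) - f(x)`. After Tonelli only shifts `|y| < rOut`
matter, and these are small by continuity of translation in `L¹`. -/
theorem tendsto_lintegral_mollify_sub {f : E → H} (hf : Integrable f μ) :
    Tendsto (fun n => ∫⁻ x, ‖mollify μ n f x - f x‖ₑ ∂μ) atTop (𝓝 0) := by
  have h1 := tendsto_eLpNorm_translate_sub le_rfl ENNReal.one_ne_top (memLp_one_iff_integrable.2 hf)
  rw [ENNReal.tendsto_nhds_zero] at h1 ⊢
  intro ε hε
  obtain ⟨δ, hδ, hball⟩ := Metric.eventually_nhds_iff_ball.1 (h1 ε hε)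
  have h2 : ∀ᶠ n in atTop, (bumpSeq E n).rOut < δ := tendsto_bumpSeq_rOut.eventually_lt_const hδ
  filter_upwards [h2] with n hn
  have key : ∀ x, ‖mollify μ n f x - f x‖ₑ ≤
      ∫⁻ y, ‖(bumpSeq E n).normed μ y‖ₑ * ‖f (x - y) - f x‖ₑ ∂μ := by
    intro x
    have e1 : f x = ∫ y, (bumpSeq E n).normed μ y • f x ∂μ := by
      rw [integral_smul_const, (bumpSeq E n).integral_normed, one_smul]
    have i1 : Integrable (fun y => (bumpSeq E n).normed μ y • f (x - y)) μ :=
      (bumpSeq E n).hasCompactSupport_normed.convolutionExists_left (lsmul ℝ ℝ)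
        (bumpSeq E n).continuous_normed hf.locallyIntegrable x
    have i2 : Integrable (fun y => (bumpSeq E n).normed μ y • f x) μ :=
      (bumpSeq E n).integrable_normed.smul_const _
    conv_lhs => rw [mollify_apply, e1]
    rw [← integral_sub i1 i2]
    refine (enorm_integral_le_lintegral_enorm _).trans_eq ?_
    simp only [← smul_sub, enorm_smul]
  calc ∫⁻ x, ‖mollify μ n f x - f x‖ₑ ∂μ
      ≤ ∫⁻ x, ∫⁻ y, ‖(bumpSeq E n).normed μ y‖ₑ * ‖f (x - y) - f x‖ₑ ∂μ ∂μ := lintegral_mono key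
    _ = ∫⁻ y, ∫⁻ x, ‖(bumpSeq E n).normed μ y‖ₑ * ‖f (x - y) - f x‖ₑ ∂μ ∂μ := by
        refine lintegral_lintegral_swap ?_
        exact ((bumpSeq E n).continuous_normed.aestronglyMeasurable (μ := μ)).enorm.comp_snd.mul
          ((aestronglyMeasurable_sub_snd hf.1).sub hf.1.comp_fst).enorm
    _ ≤ ∫⁻ y, ‖(bumpSeq E n).normed μ y‖ₑ * ε ∂μ := by
        refine lintegral_mono fun y => ?_
        rw [lintegral_const_mul' _ _ (by finiteness)]
        by_cases hy : y ∈ Metric.ball (0 : E) (bumpSeq E n).rOut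
        · refine mul_le_mul_right ?_ _
          have := hball (-y) (by
            simp only [mem_ball_zero_iff, norm_neg] at hy ⊢
            exact hy.trans hn)
          rw [eLpNorm_one_eq_lintegral_enorm] at this
          simpa [sub_eq_add_neg] using this
        · rw [← (bumpSeq E n).support_normed_eq (μ := μ), Function.notMem_support] at hy
          simp [hy]
    _ = ε := by
        rw [lintegral_mul_const _ (by
          exact (bumpSeq E n).continuous_normed.measurable.enorm), lintegral_enorm_bumpSeq, one_mul]

end Mollification

end PorousMedium

end

/-! ### Weak gradients: product rule, chain rule and Sobolev inequality. -/

noncomputable section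

namespace PorousMedium

variable {N k : ℕ}

/-- The gradient whose `α`-th component is `h α`. -/
abbrev mkGrad (h : Fin N → Vec k) : GradVec N k := WithLp.toLp 2 h

theorem integrable_smul_of_locallyIntegrableOn {H : Type*} [NormedAddCommGroup H] [NormedSpace ℝ H]
    {Ω : Set (Vec N)} {φ : Vec N → ℝ} (hφ : Continuous φ) (hc : HasCompactSupport φ)
    (hs : tsupport φ ⊆ Ω) {f : Vec N → H} (hf : LocallyIntegrableOn f Ω) :
    Integrable (fun x => φ x • f x) := by
  have h1 : IntegrableOn f (tsupport φ) := hf.integrableOn_compact_subset hs hc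
  have h2 := h1.continuousOn_smul hφ.continuousOn hc
  rwa [integrableOn_iff_integrable_of_support_subset] at h2
  intro x hx
  by_contra hcon
  exact hx (by simp [image_eq_zero_of_notMem_tsupport hcon])

theorem integrable_comp_gradVec {μ : Measure (Vec N)} {g : Vec N → GradVec N k}
    (hg : Integrable g μ) (α : Fin N) : Integrable (fun x => g x α) μ :=
  (PiLp.proj (𝕜 := ℝ) 2 (fun _ : Fin N => Vec k) α).integrable_comp hg

theorem integrable_mkGrad {α : Type*} [MeasurableSpace α] {μ : Measure α} {h : α → Fin N → Vec k}
    (hh : ∀ i, Integrable (fun x => h x i) μ) : Integrable (fun x => mkGrad (h x)) μ := by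
  have h1 : Integrable h μ := Integrable.of_eval hh
  exact (PiLp.continuousLinearEquiv 2 ℝ (fun _ : Fin N => Vec k)).symm.toContinuousLinearMap.integrable_comp h1

theorem LocallyIntegrableOn.comp_gradVec {Ω : Set (Vec N)} {g : Vec N → GradVec N k}
    (hg : LocallyIntegrableOn g Ω) (α : Fin N) : LocallyIntegrableOn (fun x => g x α) Ω := by
  intro x hx
  obtain ⟨s, hs, h⟩ := hg x hx
  exact ⟨s, hs, integrable_comp_gradVec h α⟩

/-- The reflected kernel `y ↦ ρ(x - y)` is an admissible test function, and the sign of the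
reflection cancels the sign in the definition of the weak gradient. -/
theorem HasWeakGradient.fderiv_mollify {f : Vec N → Vec k} {g : Vec N → GradVec N k}
    (h : HasWeakGradient univ f g) (n : ℕ) (x : Vec N) (α : Fin N) :
    fderiv ℝ (mollify volume n f) x (EuclideanSpace.single α 1)
      = mollify volume n (fun y => g y α) x := by
  rw [PorousMedium.fderiv_mollify n (locallyIntegrableOn_univ.1 h.locallyIntegrableOn),
    mollify_apply_swap]
  set ρ : Vec N → ℝ := (bumpSeq (Vec N) n).normed volume with hρ
  have hρd : ContDiff ℝ ∞ ρ := (bumpSeq (Vec N) n).contDiff_normed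
  have hd : Differentiable ℝ ρ := hρd.differentiable (by simp)
  have hcs : HasCompactSupport ρ := (bumpSeq (Vec N) n).hasCompactSupport_normed
  have h1 := h.integral_eq (fun y => ρ (x - y)) (hρd.comp (contDiff_const.sub contDiff_id))
    (hcs.comp_homeomorph (Homeomorph.subLeft x)) (subset_univ _) α
  have h2 : ∀ y, fderiv ℝ (fun y => ρ (x - y)) y (EuclideanSpace.single α 1)
      = - fderiv ℝ ρ (x - y) (EuclideanSpace.single α 1) := by
    intro y
    have h3 : HasFDerivAt (fun y => ρ (x - y)) _ y := (hd (x - y)).hasFDerivAt.comp y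
      ((hasFDerivAt_const x y).sub (hasFDerivAt_id y))
    rw [h3.fderiv]
    simp
  simp only [h2, Measure.restrict_univ, neg_smul, integral_neg, neg_inj] at h1
  exact h1

/-- Testing with `φ ζ` gives the product rule. The cutoff turns local data on `Ω` into integrable
data on the whole space, where mollification is available. -/
theorem HasWeakGradient.smul {Ω : Set (Vec N)} {f : Vec N → Vec k} {g : Vec N → GradVec N k}
    (h : HasWeakGradient Ω f g) {ζ : Vec N → ℝ} (hζ : ContDiff ℝ ∞ ζ)
    (hc : HasCompactSupport ζ) (hs : tsupport ζ ⊆ Ω) :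
    HasWeakGradient univ (fun x => ζ x • f x)
      (fun x => mkGrad fun α => ζ x • g x α + (fderiv ℝ ζ x (EuclideanSpace.single α 1)) • f x) ∧
    Integrable (fun x => ζ x • f x) ∧
    Integrable (fun x => mkGrad fun α =>
      ζ x • g x α + (fderiv ℝ ζ x (EuclideanSpace.single α 1)) • f x) := by
  have hdc : ∀ {φ : Vec N → ℝ} (_ : ContDiff ℝ ∞ φ) (α : Fin N),
      Continuous fun x => fderiv ℝ φ x (EuclideanSpace.single α 1) := fun hφ α =>
    (hφ.continuous_fderiv (by simp)).clm_apply continuous_const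
  have hds : ∀ (φ : Vec N → ℝ) (α : Fin N),
      tsupport (fun x => fderiv ℝ φ x (EuclideanSpace.single α 1)) ⊆ tsupport φ := fun φ α =>
    (tsupport_fderiv_apply_subset ℝ _)
  have i1 : Integrable (fun x => ζ x • f x) :=
    integrable_smul_of_locallyIntegrableOn hζ.continuous hc hs h.locallyIntegrableOn
  have i2 : Integrable (fun x => mkGrad fun α =>
      ζ x • g x α + (fderiv ℝ ζ x (EuclideanSpace.single α 1)) • f x) := by
    refine integrable_mkGrad fun α => ?_
    refine (integrable_smul_of_locallyIntegrableOn hζ.continuous hc hs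
      (LocallyIntegrableOn.comp_gradVec h.locallyIntegrableOn_grad α)).add ?_
    exact integrable_smul_of_locallyIntegrableOn (hdc hζ α)
      (hc.of_isClosed_subset (isClosed_tsupport _) (hds ζ α))
      ((hds ζ α).trans hs) h.locallyIntegrableOn
  refine ⟨⟨i1.locallyIntegrable.locallyIntegrableOn _, i2.locallyIntegrable.locallyIntegrableOn _,
    ?_⟩, i1, i2⟩
  intro φ hφ hφc _ α
  have hprod : ContDiff ℝ ∞ (fun x => φ x * ζ x) := hφ.mul hζ
  have hsub : tsupport (fun x => φ x * ζ x) ⊆ tsupport ζ := tsupport_mul_subset_right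
  have h1 := h.integral_eq (fun x => φ x * ζ x) hprod hc.mul_left (hsub.trans hs) α
  have h2 : ∀ x, fderiv ℝ (fun x => φ x * ζ x) x (EuclideanSpace.single α 1)
      = φ x * fderiv ℝ ζ x (EuclideanSpace.single α 1)
        + ζ x * fderiv ℝ φ x (EuclideanSpace.single α 1) := by
    intro x
    rw [fderiv_fun_mul (hφ.differentiable (by simp) x) (hζ.differentiable (by simp) x)]
    simp
  have hz : ∀ x, x ∉ tsupport ζ → ζ x = 0 := fun x hx => image_eq_zero_of_notMem_tsupport hx
  have hz' : ∀ x, x ∉ tsupport ζ → fderiv ℝ ζ x (EuclideanSpace.single α 1) = 0 :=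
    fun x hx => image_eq_zero_of_notMem_tsupport
      (f := fun x => fderiv ℝ ζ x (EuclideanSpace.single α 1)) (fun hx' => hx (hds ζ α hx'))
  rw [setIntegral_eq_integral_of_forall_compl_eq_zero, setIntegral_eq_integral_of_forall_compl_eq_zero]
    at h1
  · have j1 : Integrable (fun x => fderiv ℝ φ x (EuclideanSpace.single α 1) • (ζ x • f x)) :=
      integrable_smul_of_locallyIntegrableOn (hdc hφ α)
        (hφc.of_isClosed_subset (isClosed_tsupport _) (hds φ α))
        (subset_univ _) (i1.locallyIntegrable.locallyIntegrableOn _)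
    have j2 : Integrable (fun x => φ x • (fderiv ℝ ζ x (EuclideanSpace.single α 1) • f x)) := by
      have := integrable_smul_of_locallyIntegrableOn (hdc hζ α)
        (hc.of_isClosed_subset (isClosed_tsupport _) (hds ζ α))
        ((hds ζ α).trans hs) h.locallyIntegrableOn
      exact integrable_smul_of_locallyIntegrableOn hφ.continuous hφc
        (subset_univ _) (this.locallyIntegrable.locallyIntegrableOn _)
    have j3 : Integrable (fun x => φ x • (ζ x • g x α)) := by
      have := integrable_smul_of_locallyIntegrableOn hζ.continuous hc hs
        (LocallyIntegrableOn.comp_gradVec h.locallyIntegrableOn_grad α)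
      exact integrable_smul_of_locallyIntegrableOn hφ.continuous hφc
        (subset_univ _) (this.locallyIntegrable.locallyIntegrableOn _)
    have e1 : ∫ x, fderiv ℝ (fun x => φ x * ζ x) x (EuclideanSpace.single α 1) • f x
        = (∫ x, φ x • (fderiv ℝ ζ x (EuclideanSpace.single α 1) • f x)) +
          ∫ x, fderiv ℝ φ x (EuclideanSpace.single α 1) • (ζ x • f x) := by
      rw [← integral_add j2 j1]
      refine integral_congr_ae (.of_forall fun x => ?_)
      simp only [h2, add_smul, smul_smul]
      congr 2
      ring
    rw [e1] at h1
    simp only [Measure.restrict_univ]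
    have e2 : ∫ x, φ x • (ζ x • g x α + fderiv ℝ ζ x (EuclideanSpace.single α 1) • f x)
        = (∫ x, φ x • (ζ x • g x α)) +
          ∫ x, φ x • (fderiv ℝ ζ x (EuclideanSpace.single α 1) • f x) := by
      rw [← integral_add j3 j2]
      simp only [smul_add]
    rw [e2]
    simp only [smul_smul] at h1 ⊢
    rw [neg_add, ← h1]
    abel
  · intro x hx
    simp [hz x (fun hx' => hx (hs hx'))]
  · intro x hx
    rw [h2, hz x (fun hx' => hx (hs hx')), hz' x (fun hx' => hx (hs hx'))]
    simp

theorem tendsto_integral_of_tendsto_lintegral {α H : Type*} [MeasurableSpace α] {μ : Measure α}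
    [NormedAddCommGroup H] [NormedSpace ℝ H] {F : ℕ → α → H} {f : α → H}
    (hF : ∀ n, Integrable (F n) μ) (hf : Integrable f μ)
    (h : Tendsto (fun n => ∫⁻ x, ‖F n x - f x‖ₑ ∂μ) atTop (𝓝 0)) :
    Tendsto (fun n => ∫ x, F n x ∂μ) atTop (𝓝 (∫ x, f x ∂μ)) :=
  tendsto_integral_of_L1 f hf.1 (.of_forall hF) h

/-- Chain rule for weak gradients. -/
theorem HasWeakGradient.comp {f : Vec N → Vec k} {g : Vec N → GradVec N k}
    (h : HasWeakGradient univ f g) (hf : Integrable f) (hg : Integrable g)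
    {Φ : Vec k → Vec k} (hΦ : ContDiff ℝ 1 Φ) {M : ℝ} (hM : ∀ v, ‖fderiv ℝ Φ v‖ ≤ M)
    (h0 : Φ 0 = 0) :
    HasWeakGradient univ (fun x => Φ (f x)) (fun x => mkGrad fun α => fderiv ℝ Φ (f x) (g x α)) := by
  have hM0 : 0 ≤ M := (norm_nonneg _).trans (hM 0)
  have hlip : ∀ v w, ‖Φ v - Φ w‖ ≤ M * ‖v - w‖ := fun v w =>
    convex_univ.norm_image_sub_le_of_norm_fderiv_le (fun x _ => hΦ.differentiable (by simp) x)
      (fun x _ => hM x) (mem_univ _) (mem_univ _)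
  have hDc : Continuous (fderiv ℝ Φ) := hΦ.continuous_fderiv (by simp)
  have hcompint : ∀ {f' : Vec N → Vec k}, Integrable f' → Integrable (fun x => Φ (f' x)) := by
    intro f' hf'
    refine (hf'.norm.const_mul M).mono' (hΦ.continuous.comp_aestronglyMeasurable hf'.1)
      (.of_forall fun x => ?_)
    have := hlip (f' x) 0
    simpa [h0] using this
  have hgradint : ∀ {f' g' : Vec N → Vec k}, Integrable f' → Integrable g' →
      Integrable (fun x => fderiv ℝ Φ (f' x) (g' x)) := by
    intro f' g' hf' hg'
    refine (hg'.norm.const_mul M).mono' ?_ (.of_forall fun x => ?_)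
    · exact (isBoundedBilinearMap_apply.continuous).comp_aestronglyMeasurable
        ((hDc.comp_aestronglyMeasurable hf'.1).prodMk hg'.1)
    · exact ContinuousLinearMap.le_of_opNorm_le _ (hM _) _
  have hga := fun α => integrable_comp_gradVec hg α
  refine ⟨(hcompint hf).locallyIntegrable.locallyIntegrableOn _,
    (integrable_mkGrad fun α => hgradint hf (hga α)).locallyIntegrable.locallyIntegrableOn _, ?_⟩
  intro φ hφ hφc _ α
  simp only [Measure.restrict_univ]
  set fn := fun n => mollify volume n f with hfn
  set gn := fun n => mollify volume n (fun x => g x α) with hgn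
  have hsm : ∀ n, ContDiff ℝ ∞ (fn n) := fun n => contDiff_mollify n hf.locallyIntegrable
  have hmolint : ∀ {f' : Vec N → Vec k}, Integrable f' → ∀ n, Integrable (mollify volume n f') :=
    fun hf' n => (bumpSeq (Vec N) n).integrable_normed.integrable_convolution _ hf'
  have hfi : ∀ n, Integrable (fn n) := hmolint hf
  have hgi : ∀ n, Integrable (gn n) := hmolint (hga α)
  have hder : ∀ n x, fderiv ℝ (fun x => Φ (fn n x)) x (EuclideanSpace.single α 1)
      = fderiv ℝ Φ (fn n x) (gn n x) := by
    intro n x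
    have h3 : HasFDerivAt (fun x => Φ (fn n x)) _ x :=
      ((hΦ.differentiable (by simp)) (fn n x)).hasFDerivAt.comp x
        ((hsm n).differentiable (by simp) x).hasFDerivAt
    rw [h3.fderiv, ContinuousLinearMap.comp_apply, h.fderiv_mollify n x α]
  obtain ⟨C1, hC1⟩ := hφc.exists_bound_of_continuous hφ.continuous
  have hφ'c : Continuous fun x => fderiv ℝ φ x (EuclideanSpace.single α 1) :=
    (hφ.continuous_fderiv (by simp)).clm_apply continuous_const
  have hφ's : HasCompactSupport fun x => fderiv ℝ φ x (EuclideanSpace.single α 1) :=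
    hφc.of_isClosed_subset (isClosed_tsupport _) (tsupport_fderiv_apply_subset ℝ _)
  obtain ⟨C2, hC2⟩ := hφ's.exists_bound_of_continuous hφ'c
  have hmul : ∀ {ψ : Vec N → ℝ} {C : ℝ} {H : Vec N → Vec k}, Continuous ψ → (∀ x, ‖ψ x‖ ≤ C) →
      Integrable H → Integrable (fun x => ψ x • H x) := fun hψ hC hH =>
    hH.bdd_smul _ hψ.aestronglyMeasurable (.of_forall hC)
  -- For the mollified function the chain rule and the integration by parts are classical; what
  -- remains is the limit on both sides.
  have hibp : ∀ n, ∫ x, fderiv ℝ φ x (EuclideanSpace.single α 1) • Φ (fn n x)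
      = - ∫ x, φ x • fderiv ℝ Φ (fn n x) (gn n x) := by
    intro n
    have := integral_smul_fderiv_eq_neg_fderiv_smul_of_integrable (μ := volume) (f := φ)
      (g := fun x => Φ (fn n x)) (v := EuclideanSpace.single α 1)
      (hmul hφ'c hC2 (hcompint (hfi n)))
      (by simp only [hder]; exact hmul hφ.continuous hC1 (hgradint (hfi n) (hgi n)))
      (hmul hφ.continuous hC1 (hcompint (hfi n)))
      (fun x _ => hφ.differentiable (by simp) x)
      (fun x _ => ((hΦ.comp ((hsm n).of_le (by simp))).differentiable (by simp)) x)
    simp only [hder] at this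
    rw [this, neg_neg]
  have hC1' : 0 ≤ C1 := (norm_nonneg _).trans (hC1 0)
  have hC2' : 0 ≤ C2 := (norm_nonneg _).trans (hC2 0)
  have lim1 : Tendsto (fun n => ∫ x, fderiv ℝ φ x (EuclideanSpace.single α 1) • Φ (fn n x)) atTop
      (𝓝 (∫ x, fderiv ℝ φ x (EuclideanSpace.single α 1) • Φ (f x))) := by
    refine tendsto_integral_of_tendsto_lintegral (fun n => hmul hφ'c hC2 (hcompint (hfi n)))
      (hmul hφ'c hC2 (hcompint hf)) ?_
    have hle : ∀ n, ∫⁻ x, ‖fderiv ℝ φ x (EuclideanSpace.single α 1) • Φ (fn n x)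
        - fderiv ℝ φ x (EuclideanSpace.single α 1) • Φ (f x)‖ₑ ≤
        ENNReal.ofReal (C2 * M) * ∫⁻ x, ‖fn n x - f x‖ₑ := by
      intro n
      rw [← lintegral_const_mul' _ _ ENNReal.ofReal_ne_top]
      refine lintegral_mono fun x => ?_
      rw [← ofReal_norm, ← ofReal_norm, ← ENNReal.ofReal_mul (by positivity), ← smul_sub, norm_smul]
      refine ENNReal.ofReal_le_ofReal ?_
      calc _ ≤ C2 * (M * ‖fn n x - f x‖) :=
            mul_le_mul (hC2 x) (hlip _ _) (norm_nonneg _) hC2'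
        _ = _ := by ring
    have h0' := ENNReal.Tendsto.const_mul (tendsto_lintegral_mollify_sub hf)
      (Or.inr (ENNReal.ofReal_ne_top (r := C2 * M)))
    rw [mul_zero] at h0'
    exact tendsto_of_tendsto_of_tendsto_of_le_of_le tendsto_const_nhds h0' (fun _ => zero_le) hle
  have lim2 : Tendsto (fun n => ∫ x, φ x • fderiv ℝ Φ (fn n x) (gn n x)) atTop
      (𝓝 (∫ x, φ x • fderiv ℝ Φ (f x) (g x α))) := by
    refine tendsto_integral_of_tendsto_lintegral
      (fun n => hmul hφ.continuous hC1 (hgradint (hfi n) (hgi n)))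
      (hmul hφ.continuous hC1 (hgradint hf (hga α))) ?_
    have hle : ∀ n, ∫⁻ x, ‖φ x • fderiv ℝ Φ (fn n x) (gn n x)
        - φ x • fderiv ℝ Φ (f x) (g x α)‖ₑ ≤
        ENNReal.ofReal (C1 * M) * (∫⁻ x, ‖gn n x - g x α‖ₑ) +
        ENNReal.ofReal C1 * ∫⁻ x, ‖fderiv ℝ Φ (fn n x) (g x α) - fderiv ℝ Φ (f x) (g x α)‖ₑ := by
      intro n
      rw [← lintegral_const_mul' _ _ ENNReal.ofReal_ne_top,
        ← lintegral_const_mul' _ _ ENNReal.ofReal_ne_top, ← lintegral_add_left' (by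
          exact (((hgi n).1.sub (hga α).1).enorm.const_mul _))]
      refine lintegral_mono fun x => ?_
      rw [← ofReal_norm, ← ofReal_norm, ← ofReal_norm, ← ENNReal.ofReal_mul (by positivity),
        ← ENNReal.ofReal_mul (by positivity),
        ← ENNReal.ofReal_add (by positivity) (by positivity), ← smul_sub, norm_smul]
      refine ENNReal.ofReal_le_ofReal ?_
      -- The gradient error is split in two: one part is controlled by the bound on `DΦ` and `L¹`
      -- convergence of the gradients, the other by dominated convergence, with majorant `2M|g|`.
      have e : fderiv ℝ Φ (fn n x) (gn n x) - fderiv ℝ Φ (f x) (g x α)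
          = fderiv ℝ Φ (fn n x) (gn n x - g x α) +
            (fderiv ℝ Φ (fn n x) (g x α) - fderiv ℝ Φ (f x) (g x α)) := by
        rw [map_sub]; abel
      have e1 : ‖fderiv ℝ Φ (fn n x) (gn n x - g x α)‖ ≤ M * ‖gn n x - g x α‖ :=
        ContinuousLinearMap.le_of_opNorm_le _ (hM _) _
      calc _ ≤ C1 * (M * ‖gn n x - g x α‖ +
              ‖fderiv ℝ Φ (fn n x) (g x α) - fderiv ℝ Φ (f x) (g x α)‖) := by
            refine mul_le_mul (hC1 x) ?_ (norm_nonneg _) hC1'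
            rw [e]
            exact (norm_add_le _ _).trans (by gcongr)
        _ = _ := by ring
    have t1 := ENNReal.Tendsto.const_mul (tendsto_lintegral_mollify_sub (hga α))
      (Or.inr (ENNReal.ofReal_ne_top (r := C1 * M)))
    have t2 : Tendsto (fun n =>
        ∫⁻ x, ‖fderiv ℝ Φ (fn n x) (g x α) - fderiv ℝ Φ (f x) (g x α)‖ₑ) atTop (𝓝 0) := by
      have hb : ∫⁻ x, ENNReal.ofReal (2 * M) * ‖g x α‖ₑ ≠ ⊤ := by
        rw [lintegral_const_mul' _ _ ENNReal.ofReal_ne_top]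
        exact ENNReal.mul_ne_top ENNReal.ofReal_ne_top (hga α).2.ne
      have := tendsto_lintegral_of_dominated_convergence' (μ := volume)
        (F := fun n x => ‖fderiv ℝ Φ (fn n x) (g x α) - fderiv ℝ Φ (f x) (g x α)‖ₑ)
        (f := fun _ => 0) (fun x => ENNReal.ofReal (2 * M) * ‖g x α‖ₑ)
        (fun n => ((hgradint (hfi n) (hga α)).1.sub (hgradint hf (hga α)).1).enorm)
        (fun n => .of_forall fun x => ?_) hb ?_
      · simpa using this
      · dsimp only
        rw [← ofReal_norm, ← ofReal_norm, ← ENNReal.ofReal_mul (by positivity)]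
        refine ENNReal.ofReal_le_ofReal ((norm_sub_le _ _).trans ?_)
        have e1 : ‖fderiv ℝ Φ (fn n x) (g x α)‖ ≤ M * ‖g x α‖ :=
          ContinuousLinearMap.le_of_opNorm_le _ (hM _) _
        have e2 : ‖fderiv ℝ Φ (f x) (g x α)‖ ≤ M * ‖g x α‖ :=
          ContinuousLinearMap.le_of_opNorm_le _ (hM _) _
        linarith
      · filter_upwards [ae_tendsto_mollify hf.locallyIntegrable] with x hx
        have hcont : Continuous fun v => ‖fderiv ℝ Φ v (g x α) - fderiv ℝ Φ (f x) (g x α)‖ₑ :=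
          ((hDc.clm_apply continuous_const).sub continuous_const).enorm
        have := (hcont.tendsto (f x)).comp hx
        simpa [Function.comp_def] using this
    have t2' := ENNReal.Tendsto.const_mul t2 (Or.inr (ENNReal.ofReal_ne_top (r := C1)))
    have t3 := t1.add t2'
    rw [mul_zero, mul_zero, add_zero] at t3
    exact tendsto_of_tendsto_of_tendsto_of_le_of_le tendsto_const_nhds t3 (fun _ => zero_le) hle
  refine tendsto_nhds_unique lim1 ?_
  simp only [hibp]
  exact lim2.neg

/-- The chain rule is global, so `f` is first multiplied by an auxiliary cutoff `θ` that equals one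
near the support of `ζ`. After multiplication by `ζ` no trace of `θ` is left. -/
theorem HasWeakGradient.smul_comp {Ω : Set (Vec N)} (hΩ : IsOpen Ω) {f : Vec N → Vec k}
    {g : Vec N → GradVec N k} (h : HasWeakGradient Ω f g) {ζ : Vec N → ℝ} (hζ : ContDiff ℝ ∞ ζ)
    (hc : HasCompactSupport ζ) (hs : tsupport ζ ⊆ Ω)
    {Φ : Vec k → Vec k} (hΦ : ContDiff ℝ 1 Φ) {M : ℝ} (hM : ∀ v, ‖fderiv ℝ Φ v‖ ≤ M)
    (h0 : Φ 0 = 0) :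
    HasWeakGradient univ (fun x => ζ x • Φ (f x)) (fun x => mkGrad fun α =>
      ζ x • fderiv ℝ Φ (f x) (g x α) + (fderiv ℝ ζ x (EuclideanSpace.single α 1)) • Φ (f x)) ∧
    Integrable (fun x => ζ x • Φ (f x)) ∧
    Integrable (fun x => mkGrad fun α =>
      ζ x • fderiv ℝ Φ (f x) (g x α) + (fderiv ℝ ζ x (EuclideanSpace.single α 1)) • Φ (f x)) := by
  obtain ⟨L, hLc, hζL, hLΩ⟩ := exists_compact_between hc hΩ hs
  obtain ⟨θ, hθ1, hθ0, -⟩ := exists_contMDiffMap_one_nhds_of_subset_interior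
    (modelWithCornersSelf ℝ (Vec N)) (n := (⊤ : ℕ∞)) (isClosed_tsupport ζ) hζL
  have hθ : ContDiff ℝ ∞ θ := θ.contMDiff.contDiff
  have hθs : tsupport θ ⊆ L := closure_minimal (fun x hx => by
    by_contra hxL; exact hx (hθ0 x hxL)) hLc.isClosed
  have hθc : HasCompactSupport θ := hLc.of_isClosed_subset (isClosed_tsupport _) hθs
  obtain ⟨w1, j1, j2⟩ := h.smul hθ hθc (hθs.trans hLΩ)
  obtain ⟨w3, j3, j4⟩ := (w1.comp j1 j2 hΦ hM h0).smul hζ hc (subset_univ _)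
  have hz : ∀ x, x ∉ tsupport ζ → ζ x = 0 ∧ fderiv ℝ ζ x = 0 := fun x hx =>
    ⟨image_eq_zero_of_notMem_tsupport hx, image_eq_zero_of_notMem_tsupport
      (fun hx' => hx (tsupport_fderiv_subset ℝ hx'))⟩
  have ho : ∀ x, x ∈ tsupport ζ → θ x = 1 ∧ fderiv ℝ θ x = 0 := by
    intro x hx
    have h1 : ∀ᶠ y in 𝓝 x, θ y = 1 := hθ1.filter_mono (nhds_le_nhdsSet hx)
    refine ⟨h1.self_of_nhds, ?_⟩
    have : (θ : Vec N → ℝ) =ᶠ[𝓝 x] fun _ => 1 := h1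
    rw [this.fderiv_eq]
    simp
  have e1 : (fun x => ζ x • Φ (θ x • f x)) = fun x => ζ x • Φ (f x) := by
    ext1 x
    by_cases hx : x ∈ tsupport ζ
    · simp [(ho x hx).1]
    · simp [(hz x hx).1]
  have e2 : (fun x => mkGrad fun α => ζ x • fderiv ℝ Φ (θ x • f x)
      (θ x • g x α + (fderiv ℝ θ x (EuclideanSpace.single α 1)) • f x) +
      (fderiv ℝ ζ x (EuclideanSpace.single α 1)) • Φ (θ x • f x)) = fun x => mkGrad fun α =>
      ζ x • fderiv ℝ Φ (f x) (g x α) +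
        (fderiv ℝ ζ x (EuclideanSpace.single α 1)) • Φ (f x) := by
    ext1 x
    by_cases hx : x ∈ tsupport ζ
    · simp [(ho x hx).1, (ho x hx).2]
    · simp [(hz x hx).1, (hz x hx).2]
  simp only [e1, e2] at w3 j3 j4
  exact ⟨w3, j3, j4⟩

/-- By Cauchy–Schwarz the operator norm is at most the Frobenius norm. This passes from the operator
norm in the smooth Sobolev inequality to the norm of the weak gradient. -/
theorem norm_clm_le_of_basis (T : Vec N →L[ℝ] Vec k) (w : GradVec N k)
    (h : ∀ α, T (EuclideanSpace.single α 1) = w α) : ‖T‖ ≤ ‖w‖ := by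
  refine T.opNorm_le_bound (norm_nonneg _) fun v => ?_
  have hv : v = ∑ α, v α • (EuclideanSpace.single α (1 : ℝ) : Vec N) := by
    have := (EuclideanSpace.basisFun (Fin N) ℝ).sum_repr v
    simpa using this.symm
  have e : T v = ∑ α, v α • w α := by
    conv_lhs => rw [hv]
    simp only [map_sum, map_smul, h]
  rw [e]
  calc ‖∑ α, v α • w α‖ ≤ ∑ α, ‖v α‖ * ‖w α‖ := by
        refine (norm_sum_le _ _).trans_eq ?_
        simp [norm_smul]
    _ ≤ √(∑ α, ‖v α‖ ^ 2) * √(∑ α, ‖w α‖ ^ 2) := Real.sum_mul_le_sqrt_mul_sqrt _ _ _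
    _ = ‖w‖ * ‖v‖ := by
        rw [PiLp.norm_eq_of_L2, EuclideanSpace.norm_eq v, mul_comm]

theorem mollify_gradVec_apply {E : Type*} [NormedAddCommGroup E] [NormedSpace ℝ E]
    [FiniteDimensional ℝ E] [MeasurableSpace E] [BorelSpace E] {μ : Measure E} [μ.IsAddHaarMeasure]
    (n : ℕ) {g : E → GradVec N k} (hg : Integrable g μ) (x : E)
    (α : Fin N) : mollify μ n g x α = mollify μ n (fun y => g y α) x := by
  rw [mollify_apply, mollify_apply]
  have hint : Integrable (fun y => (bumpSeq E n).normed μ y • g (x - y)) μ :=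
    (bumpSeq E n).hasCompactSupport_normed.convolutionExists_left
      (ContinuousLinearMap.lsmul ℝ ℝ)
      (bumpSeq E n).continuous_normed hg.locallyIntegrable x
  exact ((PiLp.proj (𝕜 := ℝ) 2 (fun _ : Fin N => Vec k) α).integral_comp_comm hint).symm

/-- Sobolev inequality for compactly supported functions with a weak gradient; the constant depends
only on the dimension of the domain. -/
theorem HasWeakGradient.eLpNorm_le (hN : 3 ≤ N) {f : Vec N → Vec k} {g : Vec N → GradVec N k}
    (h : HasWeakGradient univ f g) (hf : Integrable f) (hg : Integrable g) {K : Set (Vec N)}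
    (hK : Bornology.IsBounded K) (hfK : ∀ x, x ∉ K → f x = 0) :
    eLpNorm f (ENNReal.ofReal (2 * N / (N - 2))) volume ≤
      (eLpNormLESNormFDerivOfEqInnerConst (volume : Measure (Vec N)) 2) * eLpNorm g 2 volume := by
  have hN' : (3 : ℝ) ≤ N := by exact_mod_cast hN
  have hpos : (0 : ℝ) < 2 * N / (N - 2) := by
    have : (0 : ℝ) < N - 2 := by linarith
    positivity
  set p' : NNReal := (2 * N / (N - 2) : ℝ).toNNReal with hp'
  have hp'c : (p' : ℝ) = 2 * N / (N - 2) := Real.coe_toNNReal _ hpos.le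
  have hstep : ∀ n, eLpNorm (mollify volume n f) p' volume ≤
      (eLpNormLESNormFDerivOfEqInnerConst (volume : Measure (Vec N)) 2) * eLpNorm g 2 volume := by
    intro n
    have hsm : ContDiff ℝ 1 (mollify volume n f) :=
      (contDiff_mollify n hf.locallyIntegrable).of_le (by simp)
    have hcs : HasCompactSupport (mollify volume n f) := by
      have hb : Bornology.IsBounded (Metric.cthickening (1 / ((n : ℝ) + 1)) K) := hK.cthickening
      have hb' : IsCompact (Metric.cthickening (1 / ((n : ℝ) + 1)) K) :=
        Metric.isCompact_of_isClosed_isBounded Metric.isClosed_cthickening hb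
      exact hb'.of_isClosed_subset (isClosed_tsupport _)
        (closure_minimal (support_mollify_subset n hfK) Metric.isClosed_cthickening)
    -- The inner product version of the Sobolev inequality has a constant that does not see the
    -- target space; this keeps the final constant independent of `k`.
    have h1 := eLpNorm_le_eLpNorm_fderiv_of_eq_inner (volume : Measure (Vec N)) hsm hcs (p := 2)
      (p' := p') (by norm_num) (by simp; omega) (by
        rw [hp'c]
        have : (N : ℝ) - 2 ≠ 0 := by linarith
        have h2 : (N : ℝ) ≠ 0 := by linarith
        simp only [finrank_euclideanSpace, Fintype.card_fin]
        push_cast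
        field_simp)
    refine h1.trans ?_
    have h2 : eLpNorm (fderiv ℝ (mollify volume n f)) 2 volume ≤ eLpNorm g 2 volume := by
      refine (eLpNorm_mono fun x => ?_).trans (eLpNorm_mollify_le n hg.1)
      refine norm_clm_le_of_basis _ _ fun α => ?_
      rw [h.fderiv_mollify, mollify_gradVec_apply n hg]
    exact_mod_cast mul_le_mul_right h2 _
  have hlim := ae_tendsto_mollify hf.locallyIntegrable
  -- Fatou suffices: the Sobolev bounds of the mollifications are uniform in `n`, because
  -- mollification does not increase the `L²` norm of the gradient.
  have := Lp.eLpNorm_lim_le_liminf_eLpNorm (p := (p' : ℝ≥0∞)) (μ := (volume : Measure (Vec N)))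
    (f := fun n => mollify volume n f)
    (fun n => (contDiff_mollify n hf.locallyIntegrable).continuous.aestronglyMeasurable) f hlim
  refine this.trans ?_
  refine liminf_le_of_le (by isBoundedDefault) fun b hb => ?_
  obtain ⟨n, hn⟩ := hb.exists
  exact hn.trans (hstep n)

end PorousMedium

end

/-! ### Testing the weak equation through correlations. -/

noncomputable section

namespace PorousMedium

section Correlation

variable {E : Type*} [NormedAddCommGroup E] [NormedSpace ℝ E] [FiniteDimensional ℝ E]
  [MeasurableSpace E] [BorelSpace E] {μ : Measure E} [μ.IsAddHaarMeasure]
  {H : Type*} [NormedAddCommGroup H] [InnerProductSpace ℝ H] [CompleteSpace H]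

theorem lintegral_enorm_inner_le {α : Type*} [MeasurableSpace α] {μ : Measure α} {H : Type*}
    [NormedAddCommGroup H] [InnerProductSpace ℝ H] {p q : ℝ≥0∞} [p.HolderConjugate q]
    {X Y : α → H} (hX : AEStronglyMeasurable X μ) (hY : AEStronglyMeasurable Y μ) :
    ∫⁻ z, ‖(inner ℝ (X z) (Y z) : ℝ)‖ₑ ∂μ ≤ eLpNorm X p μ * eLpNorm Y q μ := by
  rw [← eLpNorm_one_eq_lintegral_enorm]
  have := eLpNorm_le_eLpNorm_mul_eLpNorm'_of_norm (p := p) (q := q) (r := 1) hX hY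
    (fun a b => inner ℝ a b) 1 (.of_forall fun x => by
      simpa using norm_inner_le_norm (𝕜 := ℝ) (X x) (Y x))
  simpa using this

/-- Convolving one factor convolves the correlation. Fubini applies because Hölder bounds the inner
integral uniformly in the shift and the kernel is integrable. -/
theorem integral_inner_convolution {p q : ℝ≥0∞} [p.HolderConjugate q] {X Y : E → H}
    (hX : MemLp X p μ) (hY : MemLp Y q μ) (hYl : LocallyIntegrable Y μ) {κ : E → ℝ}
    (hκ : Continuous κ) (hκc : HasCompactSupport κ) (w : E) :
    ∫ z, inner ℝ (X z) (∫ y, κ y • Y (z + w - y) ∂μ) ∂μ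
      = ∫ y, κ y • correlation μ X Y (w - y) ∂μ := by
  have hsec : ∀ z, Integrable (fun y => κ y • Y (z + w - y)) μ := fun z =>
    hκc.convolutionExists_left (ContinuousLinearMap.lsmul ℝ ℝ) hκ hYl (z + w)
  have e1 : ∀ z, inner ℝ (X z) (∫ y, κ y • Y (z + w - y) ∂μ)
      = ∫ y, κ y * inner ℝ (X z) (Y (z + w - y)) ∂μ := by
    intro z
    rw [← integral_inner (hsec z)]
    simp only [inner_smul_right]
  simp only [e1]
  have hYw := memLp_translate hY w
  have hm : AEStronglyMeasurable (fun z : E × E => Y (z.1 - z.2 + w)) (μ.prod μ) :=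
    aestronglyMeasurable_sub_snd (f := fun z => Y (z + w)) hYw.1
  have hm' : AEStronglyMeasurable (fun z : E × E => Y (z.1 + w - z.2)) (μ.prod μ) := by
    refine hm.congr (.of_forall fun z => ?_)
    dsimp only
    congr 1
    abel
  have hint : Integrable (fun z : E × E => κ z.2 * inner ℝ (X z.1) (Y (z.1 + w - z.2)))
      (μ.prod μ) := by
    have hmeas : AEStronglyMeasurable (fun z : E × E => κ z.2 * inner ℝ (X z.1) (Y (z.1 + w - z.2)))
        (μ.prod μ) := (hκ.aestronglyMeasurable.comp_snd).mul (hX.1.comp_fst.inner hm')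
    refine ⟨hmeas, ?_⟩
    rw [HasFiniteIntegral, lintegral_prod_symm _ hmeas.enorm]
    calc ∫⁻ y, ∫⁻ z, ‖κ y * inner ℝ (X z) (Y (z + w - y))‖ₑ ∂μ ∂μ
        ≤ ∫⁻ y, ‖κ y‖ₑ * (eLpNorm X p μ * eLpNorm Y q μ) ∂μ := by
          refine lintegral_mono fun y => ?_
          simp only [enorm_mul]
          rw [lintegral_const_mul' _ _ (by finiteness)]
          refine mul_le_mul_right ?_ _
          have h1 := memLp_translate hY (w - y)
          have h2 := lintegral_enorm_inner_le (p := p) (q := q) hX.1 h1.1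
          rw [eLpNorm_translate hY.1] at h2
          simpa only [add_sub_assoc] using h2
      _ < ⊤ := by
          rw [lintegral_mul_const _ hκ.measurable.enorm]
          refine ENNReal.mul_lt_top ?_ (ENNReal.mul_lt_top hX.2 hY.2)
          exact (hκ.integrable_of_hasCompactSupport hκc).2
  rw [integral_integral_swap hint]
  refine integral_congr_ae (.of_forall fun y => ?_)
  simp only [correlation, smul_eq_mul, ← integral_const_mul, add_sub_assoc]

theorem integral_inner_mollify {p q : ℝ≥0∞} [p.HolderConjugate q] {X Y : E → H}
    (hX : MemLp X p μ) (hY : MemLp Y q μ) (hYl : LocallyIntegrable Y μ) (n : ℕ) (w : E) :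
    ∫ z, inner ℝ (X z) (mollify μ n Y (z + w)) ∂μ = mollify μ n (correlation μ X Y) w :=
  integral_inner_convolution hX hY hYl (bumpSeq E n).continuous_normed
    (bumpSeq E n).hasCompactSupport_normed w

theorem integral_smul_sub_left_comm {H : Type*} [NormedAddCommGroup H] [NormedSpace ℝ H]
    (κ : E → ℝ) (f : E → H) (x : E) :
    ∫ y, κ (x - y) • f y ∂μ = ∫ y, κ y • f (x - y) ∂μ := by
  rw [← integral_sub_left_eq_self (fun y => κ y • f (x - y)) μ x]
  simp

/-- A derivative of a mollification is a convolution with the differentiated kernel, so the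
commutation of convolution and correlation applies to it as well. -/
theorem integral_inner_fderiv_mollify {p q : ℝ≥0∞} [p.HolderConjugate q] (hq1 : 1 ≤ q) (hq : q ≠ ⊤)
    {X Y : E → H} (hX : MemLp X p μ) (hY : MemLp Y q μ) (hYl : LocallyIntegrable Y μ) (n : ℕ)
    (w v : E) :
    ∫ z, inner ℝ (X z) (fderiv ℝ (mollify μ n Y) (z + w) v) ∂μ
      = fderiv ℝ (mollify μ n (correlation μ X Y)) w v := by
  set ρ : E → ℝ := (bumpSeq E n).normed μ with hρ
  have hκ : Continuous fun y => fderiv ℝ ρ y v :=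
    ((bumpSeq E n).contDiff_normed.continuous_fderiv (n := 1) one_ne_zero).clm_apply
      continuous_const
  have hκc : HasCompactSupport fun y => fderiv ℝ ρ y v :=
    ((bumpSeq E n).hasCompactSupport_normed (μ := μ)).of_isClosed_subset (isClosed_tsupport _)
      (tsupport_fderiv_apply_subset ℝ _)
  rw [fderiv_mollify n (continuous_correlation hq1 hq hX hY).locallyIntegrable, ← hρ,
    integral_smul_sub_left_comm (fun y => fderiv ℝ ρ y v),
    ← integral_inner_convolution hX hY hYl hκ hκc w]
  refine integral_congr_ae (.of_forall fun z => ?_)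
  simp only
  rw [fderiv_mollify n hYl, ← hρ, integral_smul_sub_left_comm (fun y => fderiv ℝ ρ y v)]

end Correlation

variable {N k : ℕ}

instance : (volume : Measure (SpaceTime N)).IsAddHaarMeasure :=
  inferInstanceAs ((volume : Measure (Vec N)).prod (volume : Measure ℝ)).IsAddHaarMeasure

/-- Fubini reduces the claim to time slices, on each of which the reflected space-time kernel with
frozen time is a test function. No regularity of `ψ` in time is used. -/
theorem fderiv_mollify_spatial {ψ : SpaceTime N → Vec k} {Z : SpaceTime N → GradVec N k}
    (hψ : Integrable ψ) (hZ : Integrable Z)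
    (hw : ∀ᵐ t : ℝ, HasWeakGradient univ (fun x => ψ (x, t)) (fun x => Z (x, t)))
    (n : ℕ) (z : SpaceTime N) (α : Fin N) :
    fderiv ℝ (mollify volume n ψ) z (EuclideanSpace.single α 1, 0)
      = mollify volume n (fun y => Z y α) z := by
  rw [fderiv_mollify n hψ.locallyIntegrable, mollify_apply_swap]
  set ρ : SpaceTime N → ℝ := (bumpSeq (SpaceTime N) n).normed volume with hρ
  have hρd : ContDiff ℝ ∞ ρ := (bumpSeq (SpaceTime N) n).contDiff_normed
  have hd : Differentiable ℝ ρ := hρd.differentiable (by simp)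
  have hcs : HasCompactSupport ρ := (bumpSeq (SpaceTime N) n).hasCompactSupport_normed
  have hZα : Integrable (fun y => Z y α) :=
    (PiLp.proj (𝕜 := ℝ) 2 (fun _ : Fin N => Vec k) α).integrable_comp hZ
  have hbd : ∀ {κ : SpaceTime N → ℝ}, Continuous κ → HasCompactSupport κ →
      ∀ {f : SpaceTime N → Vec k}, Integrable f → Integrable (fun y => κ (z - y) • f y) := by
    intro κ hκ hκc f hf
    obtain ⟨C, hC⟩ := hκc.exists_bound_of_continuous hκ
    exact hf.bdd_smul _ (hκ.comp (continuous_const.sub continuous_id)).aestronglyMeasurable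
      (.of_forall fun y => hC (z - y))
  have i1 := hbd (κ := fun y => fderiv ℝ ρ y (EuclideanSpace.single α 1, 0))
    ((hρd.continuous_fderiv (by simp)).clm_apply continuous_const)
    (hcs.of_isClosed_subset (isClosed_tsupport _) (tsupport_fderiv_apply_subset ℝ _)) hψ
  have i2 := hbd hρd.continuous hcs hZα
  rw [Measure.volume_eq_prod] at i1 i2 ⊢
  rw [integral_prod_symm _ i1, integral_prod_symm _ i2]
  refine integral_congr_ae ?_
  filter_upwards [hw] with t ht
  have hinj : Topology.IsClosedEmbedding (fun x : Vec N => (z.1 - x, z.2 - t)) :=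
    Function.LeftInverse.isClosedEmbedding (f := fun y : Vec N × ℝ => z.1 - y.1)
      (fun x => by simp) (by fun_prop) (by fun_prop)
  have h1 := ht.integral_eq (fun x => ρ (z.1 - x, z.2 - t))
    (hρd.comp ((contDiff_const.sub contDiff_id).prodMk contDiff_const))
    (hcs.comp_isClosedEmbedding hinj) (subset_univ _) α
  have h2 : ∀ x, fderiv ℝ (fun x => ρ (z.1 - x, z.2 - t)) x (EuclideanSpace.single α 1)
      = - fderiv ℝ ρ (z - (x, t)) (EuclideanSpace.single α 1, 0) := by
    intro x
    have h4 : HasFDerivAt (fun x : Vec N => (z.1 - x, z.2 - t)) _ x :=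
      ((hasFDerivAt_id (𝕜 := ℝ) x).const_sub z.1).prodMk (hasFDerivAt_const (z.2 - t) x)
    have h3 := (hd (z.1 - x, z.2 - t)).hasFDerivAt.comp x h4
    simp only [Function.comp_def] at h3
    rw [h3.fderiv]
    have : z - (x, t) = (z.1 - x, z.2 - t) := rfl
    rw [this, ← map_neg]
    simp
  simp only [h2, Measure.restrict_univ, neg_smul, integral_neg, neg_inj] at h1
  exact h1

/-- A weak solution of `∂_t U = div X` correlated with a test function that has only a weak spatial
gradient. -/
theorem correlation_sub_eq_integral {p q : ℝ≥0∞} [p.HolderConjugate q] (hq1 : 1 ≤ q) (hq : q ≠ ⊤)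
    {U ψ : SpaceTime N → Vec k} {X Z : SpaceTime N → GradVec N k} {S K : Set (SpaceTime N)}
    {d h : ℝ} (hU : MemLp U p) (hX : MemLp X 2) (hψ : MemLp ψ q) (hZ : MemLp Z 2)
    (hψi : Integrable ψ) (hZi : Integrable Z)
    (hw : ∀ᵐ t : ℝ, HasWeakGradient univ (fun x => ψ (x, t)) (fun x => Z (x, t)))
    (hK : IsCompact K) (hψK : ∀ z, z ∉ K → ψ z = 0) (hKS : Metric.cthickening d K ⊆ S)
    (hweak : ∀ φ : SpaceTime N → Vec k, ContDiff ℝ ∞ φ → HasCompactSupport φ → tsupport φ ⊆ S →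
      ∫ z, inner ℝ (U z) (timeDeriv φ z) = ∫ z, inner ℝ (X z) (spaceGrad φ z))
    (h0 : 0 ≤ h) (hd : h < d) :
    correlation volume U ψ (0, h) - correlation volume U ψ 0
      = ∫ s in (0 : ℝ)..h, correlation volume X Z (0, s) := by
  set c := correlation volume U ψ with hc
  set C := correlation volume X Z with hC
  have hcc : Continuous c := continuous_correlation hq1 hq hU hψ
  have hCc : Continuous C := continuous_correlation (p := 2) (q := 2) (by norm_num) (by norm_num)
    hX hZ
  -- A shift by `s ≤ h` and a mollification radius below `d - h` keep the support inside the
  -- `d`-thickening of `K`, so the shifted mollification of `ψ` is an admissible test map. Tested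
  -- with it, the equation is an ODE for the mollified correlation.
  have hode : ∀ n : ℕ, 1 / ((n : ℝ) + 1) < d - h → ∀ s ∈ Icc 0 h,
      fderiv ℝ (mollify volume n c) (0, s) (0, 1) = mollify volume n C (0, s) := by
    intro n hn s hs
    have hsm := contDiff_mollify n (hψi.locallyIntegrable)
    set w : SpaceTime N := (0, s) with hwdef
    have hwn : ‖w‖ ≤ h := by
      rw [hwdef, Prod.norm_mk, norm_zero, Real.norm_of_nonneg hs.1]
      exact max_le h0 hs.2
    have hsub : tsupport (fun z => mollify volume n ψ (z + w)) ⊆ Metric.cthickening d K := by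
      refine closure_minimal ?_ Metric.isClosed_cthickening
      intro z hz
      have h1 := support_mollify_subset n hψK hz
      have h2 : z + w ∈ Metric.cthickening (1 / ((n : ℝ) + 1)) K := h1
      have h3 : z ∈ Metric.cthickening h (Metric.cthickening (1 / ((n : ℝ) + 1)) K) := by
        refine Metric.mem_cthickening_of_dist_le z (z + w) _ _ h2 ?_
        simpa [dist_eq_norm] using hwn
      have h4 := Metric.cthickening_cthickening_subset h0 (by positivity) K h3
      exact Metric.cthickening_mono (by linarith) K h4
    have hcomp : HasCompactSupport (fun z => mollify volume n ψ (z + w)) :=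
      hK.cthickening.of_isClosed_subset (isClosed_tsupport _) hsub
    have h1 := hweak (fun z => mollify volume n ψ (z + w)) (hsm.comp (contDiff_id.add contDiff_const))
      hcomp (hsub.trans hKS)
    have e1 : ∀ z, timeDeriv (fun z => mollify volume n ψ (z + w)) z
        = fderiv ℝ (mollify volume n ψ) (z + w) (0, 1) := by
      intro z
      rw [timeDeriv, fderiv_comp_add_right]
    have e2 : ∀ z, spaceGrad (fun z => mollify volume n ψ (z + w)) z
        = mollify volume n Z (z + w) := by
      intro z
      ext α
      rw [mollify_gradVec_apply n hZi, ← fderiv_mollify_spatial hψi hZi hw]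
      simp only [spaceGrad, fderiv_comp_add_right]
    simp only [e1, e2] at h1
    rw [integral_inner_fderiv_mollify hq1 hq hU hψ hψi.locallyIntegrable,
      integral_inner_mollify (p := 2) (q := 2) hX hZ hZi.locallyIntegrable] at h1
    exact h1
  have hftc : ∀ n : ℕ, 1 / ((n : ℝ) + 1) < d - h →
      mollify volume n c (0, h) - mollify volume n c (0, 0)
        = ∫ s in (0 : ℝ)..h, mollify volume n C (0, s) := by
    intro n hn
    have hsm : ContDiff ℝ ∞ (mollify volume n c) := contDiff_mollify n hcc.locallyIntegrable
    have hsmC : ContDiff ℝ ∞ (mollify volume n C) := contDiff_mollify n hCc.locallyIntegrable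
    symm
    refine intervalIntegral.integral_eq_sub_of_hasDerivAt (f := fun s => mollify volume n c (0, s))
      (fun s hs => ?_) ?_
    · rw [uIcc_of_le h0] at hs
      have h3 : HasFDerivAt (mollify volume n c) _ ((0 : Vec N), s) :=
        (hsm.differentiable (by simp) (0, s)).hasFDerivAt
      have h4 := h3.comp_hasDerivAt s ((hasDerivAt_const s (0 : Vec N)).prodMk (hasDerivAt_id s))
      rw [← hode n hn s hs]
      exact h4
    · exact (hsmC.continuous.comp (by fun_prop : Continuous fun s : ℝ => ((0 : Vec N), s))).intervalIntegrable _ _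
  have hlim1 : Tendsto (fun n => mollify volume n c (0, h) - mollify volume n c (0, 0)) atTop
      (𝓝 (c (0, h) - c (0, 0))) :=
    (tendsto_mollify_of_continuous hcc _).sub (tendsto_mollify_of_continuous hcc _)
  -- Mollification of the continuous correlation converges pointwise, and the Hölder bound is
  -- uniform in `n` and `s`.
  have hlim2 : Tendsto (fun n => ∫ s in (0 : ℝ)..h, mollify volume n C (0, s)) atTop
      (𝓝 (∫ s in (0 : ℝ)..h, C (0, s))) := by
    refine intervalIntegral.tendsto_integral_filter_of_dominated_convergence
      (fun _ => (eLpNorm X 2 volume * eLpNorm Z 2 volume).toReal) ?_ ?_ ?_ ?_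
    · refine .of_forall fun n => ?_
      have hsmC : ContDiff ℝ ∞ (mollify volume n C) := contDiff_mollify n hCc.locallyIntegrable
      exact (hsmC.continuous.comp (by fun_prop : Continuous fun s : ℝ => ((0 : Vec N), s))).aestronglyMeasurable
    · refine .of_forall fun n => .of_forall fun s _ => ?_
      exact norm_mollify_le n (fun w => abs_correlation_le (p := 2) (q := 2) hX hZ w) _
    · exact intervalIntegrable_const
    · exact .of_forall fun s _ => tendsto_mollify_of_continuous hCc _
  have hev : ∀ᶠ n : ℕ in atTop, 1 / ((n : ℝ) + 1) < d - h :=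
    tendsto_one_div_add_atTop_nhds_zero_nat.eventually_lt_const (by linarith)
  refine tendsto_nhds_unique hlim1 (hlim2.congr' ?_)
  filter_upwards [hev] with n hn
  exact (hftc n hn).symm

end PorousMedium

end

/-! ### The truncated weight and its derivative. -/

noncomputable section

namespace PorousMedium

/-- A bounded smooth increasing substitute for `w` on `[0, ∞)`. -/
def trunc (ℓ w : ℝ) : ℝ := ℓ * w / (ℓ + w)

/-- `(1 - κ / w)₊`. -/
def excess (κ w : ℝ) : ℝ := max (w - κ) 0 / w

/-- The weight `(1 - κ / w)₊² T(w)^c` with `T = trunc ℓ`. -/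
def weight (c κ ℓ w : ℝ) : ℝ := excess κ w ^ 2 * trunc ℓ w ^ c

/-- The derivative of `weight c κ ℓ`. -/
def weightDeriv (c κ ℓ w : ℝ) : ℝ :=
  trunc ℓ w ^ c * excess κ w * (2 * κ / w ^ 2 + c * excess κ w * (ℓ / (w * (ℓ + w))))

variable {c κ ℓ w : ℝ}

theorem trunc_nonneg (hℓ : 0 < ℓ) (hw : 0 ≤ w) : 0 ≤ trunc ℓ w := by unfold trunc; positivity

theorem trunc_pos (hℓ : 0 < ℓ) (hw : 0 < w) : 0 < trunc ℓ w := by unfold trunc; positivity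

theorem trunc_le_self (hℓ : 0 < ℓ) (hw : 0 ≤ w) : trunc ℓ w ≤ w := by
  unfold trunc
  rw [div_le_iff₀ (by positivity)]
  nlinarith

theorem trunc_le_level (hℓ : 0 < ℓ) (hw : 0 ≤ w) : trunc ℓ w ≤ ℓ := by
  unfold trunc
  rw [div_le_iff₀ (by positivity)]
  nlinarith

/-- This reflects that `T` is concave on `[0, ∞)` with `T(0) = 0`. It compares the weight at a
slightly smaller argument with the weight at `w`, with a constant independent of `ℓ`. -/
theorem mul_trunc_le (hℓ : 0 < ℓ) (hw : 0 ≤ w) {a : ℝ} (ha : 0 ≤ a) (ha1 : a ≤ 1) :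
    a * trunc ℓ w ≤ trunc ℓ (a * w) := by
  unfold trunc
  rw [mul_div_assoc', div_le_div_iff₀ (by positivity) (by positivity)]
  have : 0 ≤ a * (ℓ * w) := by positivity
  nlinarith [mul_nonneg (mul_nonneg this hw) (sub_nonneg.2 ha1)]

theorem tendsto_trunc (hw : 0 ≤ w) :
    Tendsto (fun n : ℕ => trunc ((n : ℝ) + 1) w) atTop (𝓝 w) := by
  have h1 : ∀ n : ℕ, trunc ((n : ℝ) + 1) w = w / (1 + w * (1 / ((n : ℝ) + 1))) := by
    intro n
    unfold trunc
    have : (0 : ℝ) < (n : ℝ) + 1 := by positivity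
    field_simp
  simp only [h1]
  have h2 : Tendsto (fun n : ℕ => 1 + w * (1 / ((n : ℝ) + 1))) atTop (𝓝 (1 + w * 0)) :=
    tendsto_const_nhds.add (tendsto_one_div_add_atTop_nhds_zero_nat.const_mul w)
  have h3 : Tendsto (fun n : ℕ => w / (1 + w * (1 / ((n : ℝ) + 1)))) atTop (𝓝 (w / (1 + w * 0))) :=
    (tendsto_const_nhds (x := w)).div h2 (by simp)
  simpa using h3

theorem excess_nonneg (hw : 0 ≤ w) : 0 ≤ excess κ w := by unfold excess; positivity

theorem excess_le_one (hκ : 0 < κ) (hw : 0 ≤ w) : excess κ w ≤ 1 := by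
  unfold excess
  exact div_le_one_of_le₀ (max_le (by linarith) hw) hw

theorem excess_eq_zero (h : w ≤ κ) : excess κ w = 0 := by
  unfold excess
  rw [max_eq_right (by linarith), zero_div]

theorem excess_of_le (hκ : 0 < κ) (h : κ ≤ w) : excess κ w = 1 - κ / w := by
  unfold excess
  have : w ≠ 0 := by linarith
  rw [max_eq_left (by linarith)]
  field_simp

theorem weight_eq_zero (h : w ≤ κ) : weight c κ ℓ w = 0 := by
  simp [weight, excess_eq_zero h]

theorem weightDeriv_eq_zero (h : w ≤ κ) : weightDeriv c κ ℓ w = 0 := by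
  simp [weightDeriv, excess_eq_zero h]

theorem weight_nonneg (hℓ : 0 < ℓ) (hw : 0 ≤ w) : 0 ≤ weight c κ ℓ w :=
  mul_nonneg (sq_nonneg _) (Real.rpow_nonneg (trunc_nonneg hℓ hw) _)

theorem weight_le_rpow_trunc (hκ : 0 < κ) (hℓ : 0 < ℓ) (hw : 0 ≤ w) :
    weight c κ ℓ w ≤ trunc ℓ w ^ c := by
  unfold weight
  refine mul_le_of_le_one_left (Real.rpow_nonneg (trunc_nonneg hℓ hw) _) ?_
  exact pow_le_one₀ (excess_nonneg hw) (excess_le_one hκ hw)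

theorem weightDeriv_nonneg (hc : 0 ≤ c) (hκ : 0 < κ) (hℓ : 0 < ℓ) : 0 ≤ weightDeriv c κ ℓ w := by
  rcases le_or_gt w κ with h | h
  · rw [weightDeriv_eq_zero h]
  · have hw : 0 < w := hκ.trans h
    have h1 := excess_nonneg (κ := κ) hw.le
    have h2 := Real.rpow_nonneg (trunc_nonneg hℓ hw.le) c
    unfold weightDeriv
    positivity

/-- Differentiating the square costs one factor of the excess. The remaining factors `2κ/w` and `c
(1 - κ/w)₊ ℓ/(ℓ + w)` are at most `2` and `c` on `{w > κ}`, so the bound does not depend on `κ` or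
`ℓ`. -/
theorem mul_weightDeriv_le (hc : 0 ≤ c) (hκ : 0 < κ) (hℓ : 0 < ℓ) :
    w * weightDeriv c κ ℓ w ≤ (c + 2) * (trunc ℓ w ^ c * excess κ w) := by
  rcases le_or_gt w κ with h | h
  · simp [weightDeriv_eq_zero h, excess_eq_zero h]
  · have hw : 0 < w := hκ.trans h
    have h1 := excess_nonneg (κ := κ) hw.le
    have h3 := excess_le_one hκ hw.le
    have h2 := Real.rpow_nonneg (trunc_nonneg hℓ hw.le) c
    have e : w * weightDeriv c κ ℓ w = trunc ℓ w ^ c * excess κ w *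
        (2 * (κ / w) + c * (excess κ w * (ℓ / (ℓ + w)))) := by
      unfold weightDeriv
      field_simp
    rw [e, mul_comm (c + 2)]
    refine mul_le_mul_of_nonneg_left ?_ (by positivity)
    have h4 : κ / w ≤ 1 := (div_le_one hw).2 h.le
    have h5 : ℓ / (ℓ + w) ≤ 1 := (div_le_one (by positivity)).2 (by linarith)
    have h6 : excess κ w * (ℓ / (ℓ + w)) ≤ 1 := mul_le_one₀ h3 (by positivity) h5
    nlinarith [mul_le_mul_of_nonneg_left h6 hc]

theorem weight_le (hκ : 0 < κ) (hℓ : 0 < ℓ) (hw : 0 ≤ w) :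
    weight c κ ℓ w ≤ trunc ℓ w ^ c * excess κ w := by
  unfold weight
  have h1 := excess_nonneg (κ := κ) hw
  have h3 := excess_le_one hκ hw
  have h2 := Real.rpow_nonneg (trunc_nonneg hℓ hw) c
  nlinarith [mul_nonneg (mul_nonneg h1 h2) (sub_nonneg.2 h3)]

theorem weight_add_mul_deriv_le (hc : 0 ≤ c) (hκ : 0 < κ) (hℓ : 0 < ℓ) (hw : 0 ≤ w) :
    weight c κ ℓ w + w * weightDeriv c κ ℓ w ≤ (c + 3) * (trunc ℓ w ^ c * excess κ w) := by
  have h1 := mul_weightDeriv_le (w := w) hc hκ hℓ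
  have h2 := weight_le (c := c) hκ hℓ hw
  linarith

/-- The square removes the kink at `w = κ`. Since `κ > 0`, the weight vanishes near every `w ≤ 0`,
so the singular expressions at the origin do no harm. -/
theorem hasDerivAt_weight (hκ : 0 < κ) (hℓ : 0 < ℓ) (w : ℝ) :
    HasDerivAt (weight c κ ℓ) (weightDeriv c κ ℓ w) w := by
  rcases lt_or_ge 0 w with hw | hw
  · have hmax : HasDerivAt (fun x : ℝ => max (x - κ) 0 ^ 2) (2 * max (w - κ) 0) w := by
      rcases lt_trichotomy w κ with h | h | h
      · have : (fun x : ℝ => max (x - κ) 0 ^ 2) =ᶠ[𝓝 w] fun _ => 0 := by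
          filter_upwards [Iio_mem_nhds h] with x hx
          rw [max_eq_right (by simpa using hx.le)]; norm_num
        rw [max_eq_right (by linarith), mul_zero]
        exact (hasDerivAt_const w (0 : ℝ)).congr_of_eventuallyEq this
      · subst h
        simp only [sub_self, max_self, mul_zero]
        rw [hasDerivAt_iff_isLittleO]
        simp only [sub_self, max_self, smul_zero, sub_zero]
        have h1 : (fun x : ℝ => max (x - w) 0 ^ 2 - 0 ^ 2) =O[𝓝 w] fun x => (x - w) ^ 2 := by
          refine Asymptotics.IsBigO.of_bound 1 (.of_forall fun x => ?_)
          rw [one_mul, zero_pow two_ne_zero, sub_zero, Real.norm_of_nonneg (sq_nonneg _),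
            Real.norm_of_nonneg (sq_nonneg _)]
          rcases le_total (x - w) 0 with h | h
          · rw [max_eq_right h]; nlinarith
          · rw [max_eq_left h]
        refine h1.trans_isLittleO ?_
        have h2 : (fun x : ℝ => (x - w) ^ 2) = fun x => (x - w) * (x - w) := by ext; ring
        rw [h2]
        have h3 : (fun x : ℝ => x - w) =o[𝓝 w] fun _ => (1 : ℝ) := by
          rw [Asymptotics.isLittleO_one_iff]
          have : Continuous fun x : ℝ => x - w := by fun_prop
          simpa using this.tendsto w
        simpa using h3.mul_isBigO (Asymptotics.isBigO_refl (fun x : ℝ => x - w) (𝓝 w))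
      · have : (fun x : ℝ => max (x - κ) 0 ^ 2) =ᶠ[𝓝 w] fun x => (x - κ) ^ 2 := by
          filter_upwards [Ioi_mem_nhds h] with x hx
          rw [max_eq_left (by simpa using hx.le)]
        rw [max_eq_left (by linarith)]
        refine HasDerivAt.congr_of_eventuallyEq ?_ this
        simpa using ((hasDerivAt_id' w).sub_const κ).fun_pow 2
    have hT : HasDerivAt (trunc ℓ) (ℓ ^ 2 / (ℓ + w) ^ 2) w := by
      refine (((hasDerivAt_id' w).const_mul ℓ).fun_div ((hasDerivAt_id' w).const_add ℓ)
        (by positivity)).congr_deriv ?_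
      congr 1
      ring
    have hTp := trunc_pos hℓ hw
    have hTc := hT.rpow_const (p := c) (Or.inl hTp.ne')
    have hsq : HasDerivAt (fun x : ℝ => x ^ 2) (2 * w) w := by
      simpa using hasDerivAt_pow 2 w
    have hex := hmax.fun_div hsq (by positivity)
    have hfull := hex.fun_mul hTc
    have e1 : weight c κ ℓ = fun x => max (x - κ) 0 ^ 2 / x ^ 2 * trunc ℓ x ^ c := by
      ext x
      rw [weight, excess, div_pow]
    rw [e1]
    refine hfull.congr_deriv ?_
    have hTr : trunc ℓ w ^ (c - 1) = trunc ℓ w ^ c / trunc ℓ w := Real.rpow_sub_one hTp.ne' c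
    have hmm : max (w - κ) 0 * max (w - κ) 0 = max (w - κ) 0 * (w - κ) := by
      rcases le_total (w - κ) 0 with h | h
      · rw [max_eq_right h]; simp
      · rw [max_eq_left h]
    rw [hTr]
    unfold weightDeriv excess
    generalize trunc ℓ w ^ c = P at *
    generalize hM : max (w - κ) 0 = M at *
    unfold trunc
    have hs : ℓ + w ≠ 0 := by positivity
    -- This identity removes the positive part without distinguishing the cases `w ≤ κ` and `w > κ`.
    have hM2 : M ^ 2 = M * (w - κ) := by rw [sq, hmm]
    have hA : (2 * M * w ^ 2 - M ^ 2 * (2 * w)) / (w ^ 2) ^ 2 = M / w * (2 * κ / w ^ 2) := by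
      rw [hM2]
      field_simp
      ring
    have hB : M ^ 2 / w ^ 2 * (ℓ ^ 2 / (ℓ + w) ^ 2 * c * (P / (ℓ * w / (ℓ + w))))
        = P * (M / w) * (c * (M / w) * (ℓ / (w * (ℓ + w)))) := by
      field_simp
    rw [hA, hB]
    ring
  · have : weight c κ ℓ =ᶠ[𝓝 w] fun _ => 0 := by
      filter_upwards [Iio_mem_nhds (hw.trans_lt hκ)] with x hx
      exact weight_eq_zero (le_of_lt hx)
    rw [weightDeriv_eq_zero (hw.trans hκ.le)]
    exact (hasDerivAt_const w (0 : ℝ)).congr_of_eventuallyEq this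

theorem continuous_weightDeriv (hκ : 0 < κ) (hℓ : 0 < ℓ) : Continuous (weightDeriv c κ ℓ) := by
  rw [continuous_iff_continuousAt]
  intro w
  rcases lt_or_ge 0 w with hw | hw
  · have hT : ContinuousAt (trunc ℓ) w := by
      refine (continuousAt_const.mul continuousAt_id).div (continuousAt_const.add continuousAt_id) ?_
      change ℓ + w ≠ 0
      positivity
    have hTc : ContinuousAt (fun x => trunc ℓ x ^ c) w :=
      hT.rpow_const (Or.inl (trunc_pos hℓ hw).ne')
    have hE : ContinuousAt (excess κ) w :=
      ((continuousAt_id.sub continuousAt_const).max continuousAt_const).div continuousAt_id hw.ne'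
    have h1 : ContinuousAt (fun x : ℝ => 2 * κ / x ^ 2) w :=
      continuousAt_const.div (continuousAt_id.pow 2) (pow_ne_zero 2 hw.ne')
    have h2 : ContinuousAt (fun x : ℝ => ℓ / (x * (ℓ + x))) w :=
      continuousAt_const.div (continuousAt_id.mul (continuousAt_const.add continuousAt_id))
        (mul_pos hw (add_pos hℓ hw)).ne'
    exact (hTc.mul hE).mul (h1.add ((continuousAt_const.mul hE).mul h2))
  · have : weightDeriv c κ ℓ =ᶠ[𝓝 w] fun _ => 0 := by
      filter_upwards [Iio_mem_nhds (hw.trans_lt hκ)] with x hx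
      exact weightDeriv_eq_zero (le_of_lt hx)
    exact continuousAt_const.congr this.symm

theorem contDiff_weight (hκ : 0 < κ) (hℓ : 0 < ℓ) : ContDiff ℝ 1 (weight c κ ℓ) := by
  rw [contDiff_one_iff_deriv]
  refine ⟨fun w => (hasDerivAt_weight hκ hℓ w).differentiableAt, ?_⟩
  have : deriv (weight c κ ℓ) = weightDeriv c κ ℓ :=
    funext fun w => (hasDerivAt_weight hκ hℓ w).deriv
  rw [this]
  exact continuous_weightDeriv hκ hℓ

theorem monotone_weight (hc : 0 ≤ c) (hκ : 0 < κ) (hℓ : 0 < ℓ) : Monotone (weight c κ ℓ) :=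
  monotone_of_deriv_nonneg (fun w => (hasDerivAt_weight hκ hℓ w).differentiableAt) fun w => by
    rw [(hasDerivAt_weight hκ hℓ w).deriv]
    exact weightDeriv_nonneg hc hκ hℓ

theorem weight_le_level (hc : 0 ≤ c) (hκ : 0 < κ) (hℓ : 0 < ℓ) (hw : 0 ≤ w) :
    weight c κ ℓ w ≤ ℓ ^ c :=
  (weight_le_rpow_trunc hκ hℓ hw).trans
    (Real.rpow_le_rpow (trunc_nonneg hℓ hw) (trunc_le_level hℓ hw) hc)

/-! ### The radial map with the truncated weight. -/

section Radial

variable {k : ℕ}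

/-- The map `v ↦ weight(|v|) v`. -/
def weightMap (c κ ℓ : ℝ) (v : Vec k) : Vec k := weight c κ ℓ ‖v‖ • v

theorem weightMap_zero : weightMap c κ ℓ (0 : Vec k) = 0 := by simp [weightMap]

theorem norm_weightMap (hℓ : 0 < ℓ) (v : Vec k) :
    ‖weightMap c κ ℓ v‖ = weight c κ ℓ ‖v‖ * ‖v‖ := by
  rw [weightMap, norm_smul, Real.norm_of_nonneg (weight_nonneg hℓ (norm_nonneg _))]

/-- The norm is not differentiable at the origin, but the map vanishes on the ball of radius `κ`. -/
theorem contDiff_weightMap (hκ : 0 < κ) (hℓ : 0 < ℓ) : ContDiff ℝ 1 (weightMap (k := k) c κ ℓ) := by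
  rw [contDiff_iff_contDiffAt]
  intro v
  rcases eq_or_ne v 0 with rfl | hv
  · have : weightMap (k := k) c κ ℓ =ᶠ[𝓝 0] fun _ => 0 := by
      filter_upwards [Metric.ball_mem_nhds (0 : Vec k) hκ] with x hx
      rw [weightMap, weight_eq_zero (by simpa using (mem_ball_zero_iff.1 hx).le), zero_smul]
    exact contDiffAt_const.congr_of_eventuallyEq this
  · exact ((contDiff_weight hκ hℓ).contDiffAt.comp v (contDiffAt_norm ℝ hv)).smul contDiffAt_id

/-- The multiple of `ξ` will meet the ellipticity condition; the rank-one term along `v` will meet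
the diagonal structure condition. -/
theorem fderiv_weightMap (hκ : 0 < κ) (hℓ : 0 < ℓ) (v ξ : Vec k) :
    fderiv ℝ (weightMap c κ ℓ) v ξ = weight c κ ℓ ‖v‖ • ξ +
      (weightDeriv c κ ℓ ‖v‖ / ‖v‖ * inner ℝ v ξ) • v := by
  rcases eq_or_ne v 0 with rfl | hv
  · have : weightMap (k := k) c κ ℓ =ᶠ[𝓝 0] fun _ => 0 := by
      filter_upwards [Metric.ball_mem_nhds (0 : Vec k) hκ] with x hx
      rw [weightMap, weight_eq_zero (by simpa using (mem_ball_zero_iff.1 hx).le), zero_smul]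
    rw [this.fderiv_eq]
    simp [weight_eq_zero hκ.le]
  · have h1 : HasFDerivAt (fun x : Vec k => ‖x‖) (‖v‖⁻¹ • innerSL ℝ v) v := by
      have h2 := (hasStrictFDerivAt_norm_sq v).hasFDerivAt.sqrt (by simpa using hv)
      have e : (fun x : Vec k => √(‖x‖ ^ 2)) = fun x => ‖x‖ :=
        funext fun x => Real.sqrt_sq (norm_nonneg x)
      rw [e] at h2
      refine h2.congr_fderiv ?_
      ext y
      rw [Real.sqrt_sq (norm_nonneg v)]
      simp
      ring
    have h3 := (hasDerivAt_weight (c := c) hκ hℓ ‖v‖).comp_hasFDerivAt v h1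
    have h4 : HasFDerivAt (weightMap c κ ℓ) _ v := h3.smul (hasFDerivAt_id v)
    rw [h4.fderiv]
    simp [smul_smul, div_eq_mul_inv]

theorem norm_fderiv_weightMap_apply_le (hc : 0 ≤ c) (hκ : 0 < κ) (hℓ : 0 < ℓ) (v ξ : Vec k) :
    ‖fderiv ℝ (weightMap c κ ℓ) v ξ‖ ≤
      (weight c κ ℓ ‖v‖ + ‖v‖ * weightDeriv c κ ℓ ‖v‖) * ‖ξ‖ := by
  rw [fderiv_weightMap hκ hℓ]
  refine (norm_add_le _ _).trans ?_
  have hD := weightDeriv_nonneg (w := ‖v‖) hc hκ hℓ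
  rw [norm_smul, norm_smul, Real.norm_of_nonneg (weight_nonneg hℓ (norm_nonneg _)), norm_mul,
    Real.norm_of_nonneg (div_nonneg hD (norm_nonneg _)), add_mul]
  refine add_le_add le_rfl ?_
  rcases eq_or_ne v 0 with rfl | hv
  · simp
  · have hv' : 0 < ‖v‖ := norm_pos_iff.2 hv
    calc weightDeriv c κ ℓ ‖v‖ / ‖v‖ * ‖inner ℝ v ξ‖ * ‖v‖
        ≤ weightDeriv c κ ℓ ‖v‖ / ‖v‖ * (‖v‖ * ‖ξ‖) * ‖v‖ := by
          gcongr
          exact norm_inner_le_norm v ξ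
      _ = ‖v‖ * weightDeriv c κ ℓ ‖v‖ * ‖ξ‖ := by
          field_simp

theorem norm_fderiv_weightMap_le (hc : 0 ≤ c) (hκ : 0 < κ) (hℓ : 0 < ℓ) (v : Vec k) :
    ‖fderiv ℝ (weightMap c κ ℓ) v‖ ≤ (c + 3) * ℓ ^ c := by
  have hℓc : 0 ≤ ℓ ^ c := Real.rpow_nonneg hℓ.le _
  refine ContinuousLinearMap.opNorm_le_bound _ (by positivity) fun ξ => ?_
  refine (norm_fderiv_weightMap_apply_le hc hκ hℓ v ξ).trans ?_
  gcongr
  refine (weight_add_mul_deriv_le hc hκ hℓ (norm_nonneg v)).trans ?_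
  gcongr
  have h1 : trunc ℓ ‖v‖ ^ c ≤ ℓ ^ c :=
    Real.rpow_le_rpow (trunc_nonneg hℓ (norm_nonneg _)) (trunc_le_level hℓ (norm_nonneg _)) hc
  exact (mul_le_mul h1 (excess_le_one hκ (norm_nonneg _)) (excess_nonneg (norm_nonneg _))
    hℓc).trans_eq (mul_one _)

theorem norm_mkGrad_le {N : ℕ} {h ξ : Fin N → Vec k} {b : ℝ} (hb : 0 ≤ b)
    (hh : ∀ α, ‖h α‖ ≤ b * ‖ξ α‖) : ‖mkGrad h‖ ≤ b * ‖mkGrad ξ‖ := by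
  rw [PiLp.norm_eq_of_L2, PiLp.norm_eq_of_L2, ← Real.sqrt_sq hb, ← Real.sqrt_mul (sq_nonneg b),
    Finset.mul_sum]
  refine Real.sqrt_le_sqrt (Finset.sum_le_sum fun α _ => ?_)
  rw [← mul_pow]
  exact pow_le_pow_left₀ (norm_nonneg _) (by simpa [Real.sqrt_sq hb] using hh α) 2

end Radial

/-! ### The convex primitive that carries the time derivative. -/

section Primitive

/-- `σ ↦ ∫₀^σ τ^m weight(τ^m) dτ`. -/
def weightPrim (m c κ ℓ σ : ℝ) : ℝ := ∫ τ in (0 : ℝ)..σ, τ ^ m * weight c κ ℓ (τ ^ m)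

variable {m : ℝ}

theorem continuous_weightPrim_integrand (hm : 0 < m) (hκ : 0 < κ) (hℓ : 0 < ℓ) :
    Continuous fun τ : ℝ => τ ^ m * weight c κ ℓ (τ ^ m) :=
  (Real.continuous_rpow_const hm.le).mul
    ((contDiff_weight hκ hℓ).continuous.comp (Real.continuous_rpow_const hm.le))

theorem continuous_weightPrim (hm : 0 < m) (hκ : 0 < κ) (hℓ : 0 < ℓ) :
    Continuous (weightPrim m c κ ℓ) :=
  intervalIntegral.continuous_primitive
    (fun _ _ => (continuous_weightPrim_integrand hm hκ hℓ).intervalIntegrable _ _) 0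

theorem monotoneOn_weightPrim_integrand (hm : 0 < m) (hc : 0 ≤ c) (hκ : 0 < κ) (hℓ : 0 < ℓ)
    {a b : ℝ} (ha : 0 ≤ a) (hab : a ≤ b) :
    a ^ m * weight c κ ℓ (a ^ m) ≤ b ^ m * weight c κ ℓ (b ^ m) := by
  have h1 : a ^ m ≤ b ^ m := Real.rpow_le_rpow ha hab hm.le
  exact mul_le_mul h1 (monotone_weight hc hκ hℓ h1) (weight_nonneg hℓ (Real.rpow_nonneg ha _))
    (Real.rpow_nonneg (ha.trans hab) _)

/-- The integrand is nondecreasing on `[0, ∞)`, so the primitive is convex there and lies above its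
tangents. -/
theorem weightPrim_convex (hm : 0 < m) (hc : 0 ≤ c) (hκ : 0 < κ) (hℓ : 0 < ℓ)
    {a b : ℝ} (ha : 0 ≤ a) (hb : 0 ≤ b) :
    a ^ m * weight c κ ℓ (a ^ m) * (b - a) ≤ weightPrim m c κ ℓ b - weightPrim m c κ ℓ a := by
  have hci := continuous_weightPrim_integrand (c := c) hm hκ hℓ
  rw [weightPrim, weightPrim, intervalIntegral.integral_interval_sub_left
    (hci.intervalIntegrable _ _) (hci.intervalIntegrable _ _)]
  rcases le_total a b with h | h
  · have := intervalIntegral.integral_mono_on (μ := volume) h (f := fun _ => a ^ m * weight c κ ℓ (a ^ m))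
      intervalIntegrable_const (hci.intervalIntegrable _ _)
      (fun x hx => monotoneOn_weightPrim_integrand hm hc hκ hℓ ha hx.1)
    simp only [intervalIntegral.integral_const, smul_eq_mul] at this
    linarith
  · have := intervalIntegral.integral_mono_on (μ := volume) h (g := fun _ => a ^ m * weight c κ ℓ (a ^ m))
      (hci.intervalIntegrable _ _) intervalIntegrable_const
      (fun x hx => monotoneOn_weightPrim_integrand hm hc hκ hℓ (hb.trans hx.1) hx.2)
    simp only [intervalIntegral.integral_const, smul_eq_mul] at this
    rw [intervalIntegral.integral_symm]
    linarith

theorem weightPrim_zero : weightPrim m c κ ℓ 0 = 0 := by simp [weightPrim]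

theorem weightPrim_nonneg (hℓ : 0 < ℓ) {σ : ℝ} (hσ : 0 ≤ σ) : 0 ≤ weightPrim m c κ ℓ σ :=
  intervalIntegral.integral_nonneg hσ fun _ hτ =>
    mul_nonneg (Real.rpow_nonneg hτ.1 _) (weight_nonneg hℓ (Real.rpow_nonneg hτ.1 _))

theorem weightPrim_le (hm : 0 < m) (hc : 0 ≤ c) (hκ : 0 < κ) (hℓ : 0 < ℓ) {σ : ℝ} (hσ : 0 ≤ σ) :
    weightPrim m c κ ℓ σ ≤ σ * (σ ^ m * weight c κ ℓ (σ ^ m)) := by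
  have := weightPrim_convex (c := c) hm hc hκ hℓ hσ le_rfl
  rw [weightPrim_zero] at this
  linarith

/-- Tangent inequality at a smaller point `σ'` with `σ'^m = (1 - δ/2) σ^m`. There the excess is
still at least `δ/2`, which counts twice, and `σ - σ' ≥ δσ/2` gives the third factor. -/
theorem le_weightPrim (hm : 0 < m) (hm1 : m ≤ 1) (hc : 0 ≤ c) (hκ : 0 < κ) (hℓ : 0 < ℓ)
    {δ σ : ℝ} (hδ : 0 < δ) (hδ1 : δ < 1) (hσ0 : 0 ≤ σ) (hσ : κ ≤ (1 - δ) * σ ^ m) :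
    (δ / 2) ^ 3 * (1 / 2) ^ (c + 1) * (σ * (σ ^ m * trunc ℓ (σ ^ m) ^ c)) ≤
      weightPrim m c κ ℓ σ := by
  set w := σ ^ m with hw
  have hw0 : 0 ≤ w := Real.rpow_nonneg hσ0 m
  have hwp : 0 < w := by
    rcases hw0.eq_or_lt with h | h
    · rw [← h, mul_zero] at hσ; linarith
    · exact h
  -- The choice rests on `(1 - δ/2)² ≥ 1 - δ`: after the step down to `a w`, half of the gap to `κ`
  -- remains.
  set a : ℝ := 1 - δ / 2 with ha
  have ha0 : 0 < a := by rw [ha]; linarith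
  have ha1 : a ≤ 1 := by rw [ha]; linarith
  have ha2 : 1 / 2 ≤ a := by rw [ha]; linarith
  set σ' := a ^ (1 / m) * σ with hσ'
  have hap : 0 ≤ a ^ (1 / m) := Real.rpow_nonneg ha0.le _
  -- Here `m ≤ 1` enters: `1/m ≥ 1` makes the step from `σ` down to `σ'` at least as long,
  -- relatively, as the step from `w` to `a w`.
  have hap1 : a ^ (1 / m) ≤ a := by
    have := Real.rpow_le_rpow_of_exponent_ge ha0 ha1 (one_le_one_div hm hm1)
    simpa using this
  have hσ'0 : 0 ≤ σ' := mul_nonneg hap hσ0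
  have hw' : σ' ^ m = a * w := by
    rw [hσ', Real.mul_rpow hap hσ0, ← Real.rpow_mul ha0.le, one_div_mul_cancel hm.ne',
      Real.rpow_one]
  have hgap : δ / 2 * σ ≤ σ - σ' := by
    have : σ' ≤ a * σ := mul_le_mul_of_nonneg_right hap1 hσ0
    rw [ha] at this
    linarith
  have hex : δ / 2 ≤ excess κ (a * w) := by
    have h1 : κ ≤ a * w := by
      refine hσ.trans (mul_le_mul_of_nonneg_right ?_ hw0)
      rw [ha]; linarith
    have haw : 0 < a * w := by positivity
    rw [excess_of_le hκ h1, le_sub_iff_add_le, ← le_sub_iff_add_le', div_le_iff₀ haw]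
    have : (1 - δ) * w ≤ (1 - δ / 2) * (a * w) := by
      rw [ha]
      nlinarith [mul_nonneg hw0 (sq_nonneg (δ / 2))]
    exact hσ.trans this
  have htr : (1 / 2) ^ c * trunc ℓ w ^ c ≤ trunc ℓ (a * w) ^ c := by
    rw [← Real.mul_rpow (by norm_num) (trunc_nonneg hℓ hw0)]
    refine Real.rpow_le_rpow (mul_nonneg (by norm_num) (trunc_nonneg hℓ hw0)) ?_ hc
    exact (mul_le_mul_of_nonneg_right ha2 (trunc_nonneg hℓ hw0)).trans
      (mul_trunc_le hℓ hw0 ha0.le ha1)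
  have h1 := weightPrim_convex (c := c) hm hc hκ hℓ hσ'0 hσ0
  have h2 := weightPrim_nonneg (m := m) (c := c) (κ := κ) hℓ hσ'0
  have hT : 0 ≤ trunc ℓ w ^ c := Real.rpow_nonneg (trunc_nonneg hℓ hw0) _
  calc (δ / 2) ^ 3 * (1 / 2) ^ (c + 1) * (σ * (w * trunc ℓ w ^ c))
      = (1 / 2 * w) * ((δ / 2) ^ 2 * ((1 / 2) ^ c * trunc ℓ w ^ c)) * (δ / 2 * σ) := by
        rw [Real.rpow_add (by norm_num), Real.rpow_one]; ring
    _ ≤ (a * w) * (excess κ (a * w) ^ 2 * trunc ℓ (a * w) ^ c) * (σ - σ') := by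
        have hT' : 0 ≤ trunc ℓ (a * w) ^ c :=
          Real.rpow_nonneg (trunc_nonneg hℓ (by positivity)) _
        gcongr
    _ ≤ weightPrim m c κ ℓ σ := by
        rw [hw'] at h1
        rw [weight] at h1
        linarith

theorem norm_vpow {k : ℕ} (y : Vec k) (hm : 0 < m) : ‖vpow y m‖ = ‖y‖ ^ m := by
  rw [vpow, norm_smul, Real.norm_of_nonneg (Real.rpow_nonneg (norm_nonneg _) _)]
  rcases eq_or_ne y 0 with rfl | hy
  · simp [hm.ne']
  · have hp : 0 < ‖y‖ := norm_pos_iff.2 hy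
    rw [Real.rpow_sub_one hp.ne']
    field_simp

/-- Finite-difference substitute for `∂_t u · Φ(u^m) = ∂_t B(|u|)`. The vector `Φ(y^m)` is a
nonnegative multiple of `y`, so Cauchy–Schwarz reduces the claim to the scalar tangent inequality.
-/
theorem weightPrim_sub_le_inner {k : ℕ} (hm : 0 < m) (hc : 0 ≤ c) (hκ : 0 < κ) (hℓ : 0 < ℓ)
    (y y' : Vec k) :
    weightPrim m c κ ℓ ‖y‖ - weightPrim m c κ ℓ ‖y'‖ ≤
      inner ℝ (y - y') (weightMap c κ ℓ (vpow y m)) := by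
  have h1 := weightPrim_convex (c := c) hm hc hκ hℓ (norm_nonneg y) (norm_nonneg y')
  have hg := weight_nonneg (c := c) (κ := κ) hℓ (Real.rpow_nonneg (norm_nonneg y) m)
  have h2 : inner ℝ y (weightMap c κ ℓ (vpow y m)) = ‖y‖ ^ m * weight c κ ℓ (‖y‖ ^ m) * ‖y‖ := by
    rw [weightMap, norm_vpow y hm, inner_smul_right]
    have : inner ℝ y (vpow y m) = ‖y‖ ^ m * ‖y‖ := by
      rw [vpow, inner_smul_right, real_inner_self_eq_norm_sq]
      rcases eq_or_ne y 0 with rfl | hy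
      · simp
      · have hp : 0 < ‖y‖ := norm_pos_iff.2 hy
        rw [Real.rpow_sub_one hp.ne']
        field_simp
    rw [this]; ring
  have h3 : inner ℝ y' (weightMap c κ ℓ (vpow y m)) ≤
      ‖y‖ ^ m * weight c κ ℓ (‖y‖ ^ m) * ‖y'‖ := by
    refine (real_inner_le_norm _ _).trans ?_
    rw [norm_weightMap hℓ, norm_vpow y hm]
    apply le_of_eq; ring
  rw [inner_sub_left, h2]
  linarith

theorem continuous_vpow {k : ℕ} (hm : 0 < m) : Continuous fun y : Vec k => vpow y m := by
  rw [continuous_iff_continuousAt]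
  intro y
  rcases eq_or_ne y 0 with rfl | hy
  · rw [ContinuousAt, tendsto_iff_norm_sub_tendsto_zero]
    have h0 : vpow (0 : Vec k) m = 0 := by simp [vpow]
    simp only [h0, sub_zero, norm_vpow _ hm]
    have : Continuous fun e : Vec k => ‖e‖ ^ m := continuous_norm.rpow_const fun _ => Or.inr hm.le
    simpa [hm.ne'] using this.tendsto 0
  · exact (continuous_norm.continuousAt.rpow_const (Or.inl (norm_ne_zero_iff.2 hy))).smul
      continuousAt_id

end Primitive

end PorousMedium

end

/-! ### Pointwise flux estimate and globally extended solutions. -/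

noncomputable section

namespace PorousMedium

variable {N k : ℕ}

theorem inner_gradVec (x y : GradVec N k) : inner ℝ x y = ∑ α, inner ℝ (x α) (y α) :=
  PiLp.inner_apply x y

theorem norm_mkGrad_smul_const_le {a : Fin N → ℝ} {D : ℝ} (hD : 0 ≤ D) (ha : ∑ α, a α ^ 2 ≤ D ^ 2)
    (v : Vec k) : ‖mkGrad fun α => a α • v‖ ≤ D * ‖v‖ := by
  rw [PiLp.norm_eq_of_L2]
  have h : ∑ α, ‖a α • v‖ ^ 2 ≤ (D * ‖v‖) ^ 2 := by
    simp only [norm_smul, mul_pow, ← Finset.sum_mul, Real.norm_eq_abs, sq_abs]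
    gcongr
  exact (Real.sqrt_le_sqrt h).trans_eq (Real.sqrt_sq (by positivity))

/-- Applying the functional to its own gradient vector `e` gives `|e|² ≤ D |e|`. -/
theorem sum_fderiv_single_sq_le (T : Vec N →L[ℝ] ℝ) {D : ℝ} (hT : ‖T‖ ≤ D) :
    ∑ α, (T (EuclideanSpace.single α 1)) ^ 2 ≤ D ^ 2 := by
  set S := ∑ α, (T (EuclideanSpace.single α 1)) ^ 2 with hS
  have hD : 0 ≤ D := (norm_nonneg _).trans hT
  let e : Vec N := WithLp.toLp 2 fun α => T (EuclideanSpace.single α 1)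
  have he : ‖e‖ ^ 2 = S := by
    rw [EuclideanSpace.norm_sq_eq]
    simp [e, hS]
  have hTe : T e = S := by
    have hv : e = ∑ α, e α • (EuclideanSpace.single α (1 : ℝ) : Vec N) := by
      have := (EuclideanSpace.basisFun (Fin N) ℝ).sum_repr e
      simpa using this.symm
    rw [hv, map_sum, hS]
    refine Finset.sum_congr rfl fun α _ => ?_
    simp [e, sq]
  have h1 : S ≤ D * ‖e‖ := by
    rw [← hTe]
    exact (le_abs_self _).trans ((T.le_opNorm e).trans (by gcongr))
  have h2 : ‖e‖ ≤ D := by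
    rcases (norm_nonneg e).eq_or_lt with h | h
    · rw [← h]; exact hD
    · rw [← he, sq] at h1
      exact le_of_mul_le_mul_right h1 h
  rw [← he]
  exact pow_le_pow_left₀ (norm_nonneg _) h2 2

/-- The constant in the Caccioppoli inequality. -/
def fluxConst (ν L c : ℝ) : ℝ := 4 * L ^ 2 / ν + (c + 3) ^ 2 / ν + 1

theorem fluxConst_pos {ν L c : ℝ} (hν : 0 < ν) : 0 < fluxConst ν L c := by
  unfold fluxConst; positivity

/-- The weight `T(|v|)^c` restricted to `{|v| > κ}`. -/
def levelWeight (c κ ℓ w : ℝ) : ℝ := if κ < w then trunc ℓ w ^ c else 0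

theorem levelWeight_nonneg {c κ ℓ w : ℝ} (hℓ : 0 < ℓ) (hw : 0 ≤ w) : 0 ≤ levelWeight c κ ℓ w := by
  unfold levelWeight
  split_ifs
  · exact Real.rpow_nonneg (trunc_nonneg hℓ hw) _
  · exact le_rfl

/-- Young's inequality in scalar form. Here `x`, `w`, `f` stand for `|ξ|`, `|v|`, `|F|`; `P` for
`T^c`, `θ` for the excess, `W` for the level weight; and `i₁`, …, `i₄` for the four pairings of `Y`
and `F` with the two parts of the test gradient. The ellipticity supplies `ν`; `T2` and `T3` spend
`ν/4` each. In `T3` a single factor `θ` is enough because `Pθ` is the geometric mean of `g = θ²P`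
and `P`. -/
theorem flux_scalar_bound {ν L c D ζ θ P g W x w f i₁ i₂ i₃ i₄ : ℝ} (hν : 0 < ν) (hc : 0 ≤ c)
    (hD : 0 ≤ D) (hζ : 0 ≤ ζ) (hζ1 : ζ ≤ 1) (hP0 : 0 ≤ P) (hθ0 : 0 ≤ θ) (hθ1 : θ ≤ 1)
    (hw0 : 0 ≤ w) (hf0 : 0 ≤ f) (hgP : g = θ ^ 2 * P) (hlw : W = P ∨ (W = 0 ∧ θ = 0))
    (h₁ : ν * (g * x ^ 2) ≤ i₁) (h₂ : -(L * x * (D * w)) ≤ i₂)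
    (h₃ : -(f * ((c + 3) * (P * θ) * x)) ≤ i₃) (h₄ : -(f * (D * w)) ≤ i₄) :
    ν / 2 * (ζ ^ 2 * (g * x ^ 2)) - fluxConst ν L c * (D ^ 2 * (w ^ 2 * g) + f ^ 2 * W) ≤
      ζ ^ 2 * i₁ + 2 * ζ * g * i₂ + (ζ ^ 2 * i₃ + 2 * ζ * g * i₄) := by
  have hg0 : 0 ≤ g := by rw [hgP]; positivity
  have hW0 : 0 ≤ W := by
    rcases hlw with h | ⟨h, -⟩
    · rw [h]; exact hP0
    · rw [h]
  have T1 : ν * (ζ ^ 2 * (g * x ^ 2)) ≤ ζ ^ 2 * i₁ := by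
    have := mul_le_mul_of_nonneg_left h₁ (sq_nonneg ζ)
    linarith
  have T2 : -(ν / 4 * (ζ ^ 2 * (g * x ^ 2)) + 4 * L ^ 2 / ν * (D ^ 2 * (w ^ 2 * g))) ≤
      2 * ζ * g * i₂ := by
    have h1 : -(L * x * (D * w)) ≤ i₂ := h₂
    have h2 : 0 ≤ 2 * ζ * g := by positivity
    have h3 := mul_le_mul_of_nonneg_left h1 h2
    have h4 : 2 * ζ * g * (L * x * (D * w)) ≤
        ν / 4 * (ζ ^ 2 * (g * x ^ 2)) + 4 * L ^ 2 / ν * (D ^ 2 * (w ^ 2 * g)) := by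
      have e : ν / 4 * (ζ ^ 2 * (g * x ^ 2)) + 4 * L ^ 2 / ν * (D ^ 2 * (w ^ 2 * g)) -
          2 * ζ * g * (L * x * (D * w)) = g / (4 * ν) * (ν * ζ * x - 4 * L * D * w) ^ 2 := by
        field_simp
        ring
      have : 0 ≤ g / (4 * ν) * (ν * ζ * x - 4 * L * D * w) ^ 2 := by positivity
      linarith
    linarith
  have T3 : -(ν / 4 * (ζ ^ 2 * (g * x ^ 2)) + (c + 3) ^ 2 / ν * (f ^ 2 * W)) ≤
      ζ ^ 2 * i₃ := by
    have h1 : -(f * ((c + 3) * (P * θ) * x)) ≤ i₃ := h₃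
    have h3 := mul_le_mul_of_nonneg_left h1 (sq_nonneg ζ)
    have h4 : ζ ^ 2 * (f * ((c + 3) * (P * θ) * x)) ≤
        ν / 4 * (ζ ^ 2 * (g * x ^ 2)) + (c + 3) ^ 2 / ν * (f ^ 2 * W) := by
      rcases hlw with h | ⟨h, hθz⟩
      · rw [h, hgP]
        have e : ν / 4 * (ζ ^ 2 * (θ ^ 2 * P * x ^ 2)) + (c + 3) ^ 2 / ν * (f ^ 2 * P) -
            ζ ^ 2 * (f * ((c + 3) * (P * θ) * x)) =
            P * (ζ ^ 2 / (4 * ν) * (ν * θ * x - 2 * (c + 3) * f) ^ 2 +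
              (c + 3) ^ 2 / ν * f ^ 2 * (1 - ζ ^ 2)) := by
          field_simp
          ring
        have h6 : 0 ≤ 1 - ζ ^ 2 := sub_nonneg.2 (pow_le_one₀ hζ hζ1)
        have : 0 ≤ P * (ζ ^ 2 / (4 * ν) * (ν * θ * x - 2 * (c + 3) * f) ^ 2 +
              (c + 3) ^ 2 / ν * f ^ 2 * (1 - ζ ^ 2)) := by positivity
        linarith
      · rw [hθz, h]
        have : 0 ≤ ν / 4 * (ζ ^ 2 * (g * x ^ 2)) := by positivity
        simpa using this
    linarith
  have T4 : -(f ^ 2 * W + D ^ 2 * (w ^ 2 * g)) ≤ 2 * ζ * g * i₄ := by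
    have h1 : -(f * (D * w)) ≤ i₄ := h₄
    have h2 : 0 ≤ 2 * ζ * g := by positivity
    have h3 := mul_le_mul_of_nonneg_left h1 h2
    have hgW : g ≤ W := by
      rcases hlw with h | ⟨h, hθz⟩
      · rw [h, hgP]
        exact mul_le_of_le_one_left hP0 (pow_le_one₀ hθ0 hθ1)
      · rw [h, hgP, hθz]; simp
    have h4 : 2 * ζ * g * (f * (D * w)) ≤ f ^ 2 * g + D ^ 2 * (w ^ 2 * g) := by
      have h5 : 2 * ζ * g * (f * (D * w)) ≤ 2 * g * (f * (D * w)) := by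
        have h7 : ζ * (2 * g * (f * (D * w))) ≤ 2 * g * (f * (D * w)) :=
          mul_le_of_le_one_left (by positivity) hζ1
        linarith
      have h8 : g * (2 * (f * (D * w))) ≤ g * (f ^ 2 + D ^ 2 * w ^ 2) := by
        refine mul_le_mul_of_nonneg_left ?_ hg0
        linarith [sq_nonneg (f - D * w)]
      linarith
    have h6 : f ^ 2 * g ≤ f ^ 2 * W := by gcongr
    linarith
  have hfin : fluxConst ν L c * (D ^ 2 * (w ^ 2 * g) + f ^ 2 * W) =
      (4 * L ^ 2 / ν * (D ^ 2 * (w ^ 2 * g)) + D ^ 2 * (w ^ 2 * g) +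
        (c + 3) ^ 2 / ν * (D ^ 2 * (w ^ 2 * g))) +
      (4 * L ^ 2 / ν * (f ^ 2 * W) + (c + 3) ^ 2 / ν * (f ^ 2 * W) + f ^ 2 * W) := by
    unfold fluxConst
    ring
  have p1 : 0 ≤ (c + 3) ^ 2 / ν * (D ^ 2 * (w ^ 2 * g)) := by positivity
  have p2 : 0 ≤ 4 * L ^ 2 / ν * (f ^ 2 * W) := by positivity
  linarith

theorem inner_flux_ge {ν L c κ ℓ D ζ : ℝ} (hν : 0 < ν) (hc : 0 ≤ c) (hκ : 0 < κ) (hℓ : 0 < ℓ)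
    (hD : 0 ≤ D) (hζ : 0 ≤ ζ) (hζ1 : ζ ≤ 1) {Y F ξ : GradVec N k} {v : Vec k} {a : Fin N → ℝ}
    (ha : ∑ α, a α ^ 2 ≤ D ^ 2) (hell : ν * ‖ξ‖ ^ 2 ≤ inner ℝ Y ξ) (hgr : ‖Y‖ ≤ L * ‖ξ‖)
    (hdiag : 0 ≤ ∑ α, inner ℝ (Y α) v * inner ℝ (ξ α) v) :
    ν / 2 * (ζ ^ 2 * (weight c κ ℓ ‖v‖ * ‖ξ‖ ^ 2)) - fluxConst ν L c *
        (D ^ 2 * (‖v‖ ^ 2 * weight c κ ℓ ‖v‖) + ‖F‖ ^ 2 * levelWeight c κ ℓ ‖v‖) ≤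
      inner ℝ (Y + F) (mkGrad fun α => ζ ^ 2 • fderiv ℝ (weightMap c κ ℓ) v (ξ α) +
        (2 * ζ * a α) • weightMap c κ ℓ v) := by
  set g := weight c κ ℓ ‖v‖ with hg
  have hg0 : 0 ≤ g := weight_nonneg hℓ (norm_nonneg _)
  set P := trunc ℓ ‖v‖ ^ c with hP
  have hP0 : 0 ≤ P := Real.rpow_nonneg (trunc_nonneg hℓ (norm_nonneg _)) _
  set θ := excess κ ‖v‖ with hθ
  have hθ0 : 0 ≤ θ := excess_nonneg (norm_nonneg _)
  have hθ1 : θ ≤ 1 := excess_le_one hκ (norm_nonneg _)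
  have hgP : g = θ ^ 2 * P := rfl
  set Dw := mkGrad fun α => fderiv ℝ (weightMap c κ ℓ) v (ξ α) with hDw
  set Av := mkGrad fun α => a α • v with hAv
  have hAvn : ‖Av‖ ≤ D * ‖v‖ := norm_mkGrad_smul_const_le hD ha v
  have hsplit : (mkGrad fun α => ζ ^ 2 • fderiv ℝ (weightMap c κ ℓ) v (ξ α) +
        (2 * ζ * a α) • weightMap c κ ℓ v) = ζ ^ 2 • Dw + (2 * ζ * g) • Av := by
    ext1 α
    simp only [hDw, hAv, weightMap, PiLp.add_apply, PiLp.smul_apply, smul_smul]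
    congr 2
    ring
  have hbd0 : 0 ≤ (c + 3) * (P * θ) := by positivity
  have hDwn : ‖Dw‖ ≤ (c + 3) * (P * θ) * ‖ξ‖ := by
    have := norm_mkGrad_le (h := fun α => fderiv ℝ (weightMap c κ ℓ) v (ξ α)) (ξ := fun α => ξ α)
      hbd0 (fun α => (norm_fderiv_weightMap_apply_le hc hκ hℓ v (ξ α)).trans
        (mul_le_mul_of_nonneg_right (weight_add_mul_deriv_le hc hκ hℓ (norm_nonneg _))
          (norm_nonneg _)))
    exact this
  -- The derivative of the weight contributes `weightDeriv/|v| ≥ 0` times the sum in the diagonal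
  -- condition, so it can be dropped; ellipticity handles the rest.
  have hYDw : ν * (g * ‖ξ‖ ^ 2) ≤ inner ℝ Y Dw := by
    have e : inner ℝ Y Dw = g * inner ℝ Y ξ + weightDeriv c κ ℓ ‖v‖ / ‖v‖ *
        ∑ α, inner ℝ (Y α) v * inner ℝ (ξ α) v := by
      rw [inner_gradVec, inner_gradVec, Finset.mul_sum, Finset.mul_sum, ← Finset.sum_add_distrib]
      refine Finset.sum_congr rfl fun α _ => ?_
      simp only [hDw, fderiv_weightMap hκ hℓ, inner_add_right, inner_smul_right,
        real_inner_comm (ξ α) v]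
      ring
    rw [e]
    have h1 : 0 ≤ weightDeriv c κ ℓ ‖v‖ / ‖v‖ :=
      div_nonneg (weightDeriv_nonneg hc hκ hℓ) (norm_nonneg _)
    nlinarith [mul_nonneg h1 hdiag, mul_le_mul_of_nonneg_left hell hg0]
  have hYAv : |inner ℝ Y Av| ≤ L * ‖ξ‖ * (D * ‖v‖) :=
    (abs_real_inner_le_norm _ _).trans
      (mul_le_mul hgr hAvn (norm_nonneg _) ((norm_nonneg _).trans hgr))
  have hFDw : |inner ℝ F Dw| ≤ ‖F‖ * ((c + 3) * (P * θ) * ‖ξ‖) :=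
    (abs_real_inner_le_norm _ _).trans (by gcongr)
  have hFAv : |inner ℝ F Av| ≤ ‖F‖ * (D * ‖v‖) :=
    (abs_real_inner_le_norm _ _).trans (by gcongr)
  have hlw : levelWeight c κ ℓ ‖v‖ = P ∨ (levelWeight c κ ℓ ‖v‖ = 0 ∧ θ = 0) := by
    unfold levelWeight
    split_ifs with h
    · exact Or.inl rfl
    · exact Or.inr ⟨rfl, excess_eq_zero (not_lt.1 h)⟩
  set W := levelWeight c κ ℓ ‖v‖ with hW
  have hW0 : 0 ≤ W := levelWeight_nonneg hℓ (norm_nonneg _)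
  set x := ‖ξ‖ with hx
  set w := ‖v‖ with hw
  set f := ‖F‖ with hf
  have hw0 : 0 ≤ w := norm_nonneg _
  have hf0 : 0 ≤ f := norm_nonneg _
  rw [hsplit, inner_add_left, inner_add_right, inner_add_right, inner_smul_right, inner_smul_right,
    inner_smul_right, inner_smul_right]
  exact flux_scalar_bound hν hc hD hζ hζ1 hP0 hθ0 hθ1 hw0 hf0 hgP hlw hYDw (abs_le.1 hYAv).1
    (abs_le.1 hFDw).1 (abs_le.1 hFAv).1

/-- Global data of a weak solution cut off outside a box. -/
structure IsCutoffSolution (m ν L : ℝ) (x₀ : Vec N) (R a b : ℝ) (U : SpaceTime N → Vec k)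
    (G Y F : SpaceTime N → GradVec N k) : Prop where
  memLp : MemLp U (ENNReal.ofReal (1 + m)) volume
  memLp_vpow : MemLp (fun z => vpow (U z) m) 2 volume
  memLp_grad : MemLp G 2 volume
  memLp_flux : MemLp Y 2 volume
  memLp_force : MemLp F 2 volume
  ellipticity : ∀ᵐ z, ν * ‖G z‖ ^ 2 ≤ inner ℝ (Y z) (G z)
  growth : ∀ᵐ z, ‖Y z‖ ≤ L * ‖G z‖
  diagonal : ∀ᵐ z, 0 ≤ ∑ α : Fin N,
    inner ℝ (Y z α) (vpow (U z) m) * inner ℝ (G z α) (vpow (U z) m)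
  slice : ∀ᵐ t : ℝ, t ∈ Icc a b →
    HasWeakGradient (Metric.ball x₀ R) (fun x => vpow (U (x, t)) m) (fun x => G (x, t))
  weak : ∀ φ : SpaceTime N → Vec k, ContDiff ℝ ∞ φ → HasCompactSupport φ →
    tsupport φ ⊆ Metric.closedBall x₀ R ×ˢ Icc a b →
    ∫ z, inner ℝ (U z) (timeDeriv φ z) = ∫ z, inner ℝ (Y z + F z) (spaceGrad φ z)

theorem integrable_of_memLp_of_eq_zero {α H : Type*} [MeasurableSpace α] {μ : Measure α}
    [NormedAddCommGroup H] {q : ℝ≥0∞} (hq : 1 ≤ q) {f : α → H} (hf : MemLp f q μ) {K : Set α}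
    (hK : μ K ≠ ⊤) (hz : ∀ z, z ∉ K → f z = 0) : Integrable f μ := by
  have : IsFiniteMeasure (μ.restrict K) := ⟨by simpa using hK.lt_top⟩
  have h1 : IntegrableOn f K μ := (hf.restrict K).integrable hq
  rwa [integrableOn_iff_integrable_of_support_subset] at h1
  intro z hz'
  by_contra hcon
  exact hz' (hz z hcon)

theorem hasWeakGradient_zero {Ω : Set (Vec N)} :
    HasWeakGradient (k := k) Ω (fun _ => 0) (fun _ => 0) :=
  ⟨integrableOn_zero.locallyIntegrableOn, integrableOn_zero.locallyIntegrableOn, by simp⟩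

theorem aestronglyMeasurable_mkGrad {α : Type*} [MeasurableSpace α] {μ : Measure α}
    {h : α → Fin N → Vec k} (hh : ∀ i, AEStronglyMeasurable (fun x => h x i) μ) :
    AEStronglyMeasurable (fun x => mkGrad (h x)) μ := by
  have h1 : AEStronglyMeasurable h μ := by
    refine AEMeasurable.aestronglyMeasurable ?_
    exact aemeasurable_pi_iff.2 fun i => (hh i).aemeasurable
  exact (PiLp.continuous_toLp 2 _).comp_aestronglyMeasurable h1

/-- The ramp in time that vanishes before `a` and equals one after `b`. -/
def ramp (a b t : ℝ) : ℝ := max 0 (min 1 ((t - a) / (b - a)))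

theorem ramp_nonneg (a b t : ℝ) : 0 ≤ ramp a b t := le_max_left _ _

theorem ramp_le_one (a b t : ℝ) : ramp a b t ≤ 1 := max_le zero_le_one (min_le_left _ _)

theorem ramp_eq_zero {a b t : ℝ} (hab : a < b) (ht : t ≤ a) : ramp a b t = 0 := by
  refine max_eq_left ((min_le_right _ _).trans ?_)
  exact div_nonpos_of_nonpos_of_nonneg (by linarith) (by linarith)

theorem ramp_eq_one {a b t : ℝ} (hab : a < b) (ht : b ≤ t) : ramp a b t = 1 := by
  have : 1 ≤ (t - a) / (b - a) := (one_le_div (by linarith)).2 (by linarith)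
  rw [ramp, min_eq_left this, max_eq_right zero_le_one]

theorem continuous_ramp (a b : ℝ) : Continuous (ramp a b) := by unfold ramp; fun_prop

theorem ramp_add_le {a b t h : ℝ} (hab : a < b) (hh : 0 ≤ h) :
    ramp a b (t + h) ≤ ramp a b t + 1 / (b - a) * h := by
  have hba : 0 < b - a := by linarith
  have hp : 0 ≤ 1 / (b - a) * h := by positivity
  have e : (t + h - a) / (b - a) = (t - a) / (b - a) + 1 / (b - a) * h := by
    field_simp; ring
  unfold ramp
  rw [e]
  refine max_le (by linarith [le_max_left 0 (min 1 ((t - a) / (b - a)))]) ?_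
  have h1 : min 1 ((t - a) / (b - a) + 1 / (b - a) * h) ≤
      min 1 ((t - a) / (b - a)) + 1 / (b - a) * h := by
    rcases le_total 1 ((t - a) / (b - a)) with h | h
    · rw [min_eq_left h]
      exact (min_le_left _ _).trans (by linarith)
    · rw [min_eq_right h]
      exact min_le_right _ _
  exact h1.trans (by linarith [le_max_right 0 (min 1 ((t - a) / (b - a)))])

end PorousMedium

end

/-! ### The test map of the energy estimate. -/

noncomputable section

namespace PorousMedium

variable {N k : ℕ}

theorem measurable_trunc (ℓ : ℝ) : Measurable (trunc ℓ) := by unfold trunc; fun_prop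

theorem measurable_levelWeight (c κ ℓ : ℝ) : Measurable (levelWeight c κ ℓ) := by
  unfold levelWeight
  exact Measurable.ite measurableSet_Ioi ((measurable_trunc ℓ).pow_const c) measurable_const

theorem levelWeight_le_level {c κ ℓ w : ℝ} (hc : 0 ≤ c) (hℓ : 0 < ℓ) (hw : 0 ≤ w) :
    levelWeight c κ ℓ w ≤ ℓ ^ c := by
  unfold levelWeight
  split_ifs
  · exact Real.rpow_le_rpow (trunc_nonneg hℓ hw) (trunc_le_level hℓ hw) hc
  · exact Real.rpow_nonneg hℓ.le _

theorem Integrable.mul_of_nonneg_of_le {α : Type*} [MeasurableSpace α] {μ : Measure α}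
    {f g : α → ℝ} (hf : Integrable f μ) (hg : AEStronglyMeasurable g μ) {M : ℝ}
    (h0 : ∀ x, 0 ≤ g x) (hM : ∀ x, g x ≤ M) : Integrable (fun x => f x * g x) μ := by
  have := hf.bdd_mul (c := M) hg (.of_forall fun x => by
    rw [Real.norm_of_nonneg (h0 x)]; exact hM x)
  simpa only [mul_comm] using this

theorem hasDerivAt_tendsto_right {f : ℝ → ℝ} {f' x : ℝ} (h : HasDerivAt f f' x) :
    Tendsto (fun s => (f (x + s) - f x) / s) (𝓝[>] 0) (𝓝 f') := by
  have h1 := hasDerivAt_iff_tendsto_slope_zero.1 h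
  have h2 := h1.mono_left (nhdsWithin_mono 0 (fun s (hs : s ∈ Ioi (0 : ℝ)) => (ne_of_gt hs)))
  refine h2.congr fun s => ?_
  rw [smul_eq_mul, div_eq_inv_mul]

theorem hasDerivAt_tendsto_left {f : ℝ → ℝ} {f' x : ℝ} (h : HasDerivAt f f' x) :
    Tendsto (fun s => (f x - f (x - s)) / s) (𝓝[>] 0) (𝓝 f') := by
  have h1 := hasDerivAt_iff_tendsto_slope_zero.1 h
  have h3 : Tendsto (fun s : ℝ => -s) (𝓝[>] 0) (𝓝[≠] 0) := by
    refine tendsto_nhdsWithin_iff.2 ⟨?_, ?_⟩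
    · have : Continuous fun s : ℝ => -s := continuous_neg
      simpa using (this.tendsto 0).mono_left nhdsWithin_le_nhds
    · filter_upwards [self_mem_nhdsWithin] with s hs
      simpa using (ne_of_gt hs)
  refine (h1.comp h3).congr fun s => ?_
  simp only [Function.comp, smul_eq_mul, ← sub_eq_add_neg, inv_neg]
  ring

section Energy

variable {m ν L c κ ℓ : ℝ} {x₀ : Vec N} {R R' a b ta tb te τ D : ℝ} {U : SpaceTime N → Vec k}
  {G Y F : SpaceTime N → GradVec N k} {ζ : Vec N → ℝ}

/-- The time factor of the test function. -/
def timeCut (ta tb τ t : ℝ) : ℝ := if t ≤ τ then ramp ((ta + tb) / 2) tb t else 0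

theorem timeCut_nonneg (t : ℝ) : 0 ≤ timeCut ta tb τ t := by
  unfold timeCut; split_ifs
  · exact ramp_nonneg _ _ _
  · exact le_rfl

theorem timeCut_le_one (t : ℝ) : timeCut ta tb τ t ≤ 1 := by
  unfold timeCut; split_ifs
  · exact ramp_le_one _ _ _
  · exact zero_le_one

theorem timeCut_eq_zero (hab : ta < tb) (hτ : τ ≤ te) {t : ℝ} (ht : t ∉ Icc ta te) :
    timeCut ta tb τ t = 0 := by
  unfold timeCut; split_ifs with h
  · refine ramp_eq_zero (by linarith) ?_
    have : t < ta := by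
      by_contra h'
      exact ht ⟨not_lt.1 h', h.trans hτ⟩
    linarith
  · rfl

theorem measurable_timeCut : Measurable (timeCut ta tb τ) :=
  Measurable.ite measurableSet_Iic (continuous_ramp _ _).measurable measurable_const

/-- The test function of the energy estimate. -/
def testMap (m c κ ℓ ta tb τ : ℝ) (ζ : Vec N → ℝ) (U : SpaceTime N → Vec k) (z : SpaceTime N) :
    Vec k :=
  (timeCut ta tb τ z.2 * ζ z.1 ^ 2) • weightMap c κ ℓ (vpow (U z) m)

/-- The spatial gradient of `testMap`. -/
def testGrad (m c κ ℓ ta tb τ : ℝ) (ζ : Vec N → ℝ) (U : SpaceTime N → Vec k)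
    (G : SpaceTime N → GradVec N k) (z : SpaceTime N) : GradVec N k :=
  timeCut ta tb τ z.2 • mkGrad fun α =>
    ζ z.1 ^ 2 • fderiv ℝ (weightMap c κ ℓ) (vpow (U z) m) (G z α) +
      (2 * ζ z.1 * fderiv ℝ ζ z.1 (EuclideanSpace.single α 1)) • weightMap c κ ℓ (vpow (U z) m)

/-- A smooth spatial cutoff function. -/
structure IsCutoff (x₀ : Vec N) (R D : ℝ) (ζ : Vec N → ℝ) : Prop where
  contDiff : ContDiff ℝ ∞ ζ
  nonneg : ∀ x, 0 ≤ ζ x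
  le_one : ∀ x, ζ x ≤ 1
  tsupport_subset : tsupport ζ ⊆ Metric.closedBall x₀ R
  norm_fderiv_le : ∀ x, ‖fderiv ℝ ζ x‖ ≤ D

theorem IsCutoff.hasCompactSupport (h : IsCutoff x₀ R D ζ) : HasCompactSupport ζ :=
  (isCompact_closedBall x₀ R).of_isClosed_subset (isClosed_tsupport _) h.tsupport_subset

theorem IsCutoff.eq_zero (h : IsCutoff x₀ R D ζ) {x : Vec N} (hx : x ∉ Metric.closedBall x₀ R) :
    ζ x = 0 := image_eq_zero_of_notMem_tsupport fun hx' => hx (h.tsupport_subset hx')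

theorem IsCutoff.nonneg_bound (h : IsCutoff x₀ R D ζ) : 0 ≤ D :=
  (norm_nonneg _).trans (h.norm_fderiv_le x₀)

theorem testMap_eq_zero (hζ : IsCutoff x₀ R D ζ) (hab : ta < tb) (hτ : τ ≤ te) {z : SpaceTime N}
    (hz : z ∉ Metric.closedBall x₀ R ×ˢ Icc ta te) : testMap m c κ ℓ ta tb τ ζ U z = 0 := by
  rw [testMap]
  by_cases h1 : z.1 ∈ Metric.closedBall x₀ R
  · rw [timeCut_eq_zero hab hτ fun h2 => hz ⟨h1, h2⟩, zero_mul, zero_smul]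
  · rw [hζ.eq_zero h1]; simp

theorem testGrad_eq_zero (hζ : IsCutoff x₀ R D ζ) (hab : ta < tb) (hτ : τ ≤ te) {z : SpaceTime N}
    (hz : z ∉ Metric.closedBall x₀ R ×ˢ Icc ta te) : testGrad m c κ ℓ ta tb τ ζ U G z = 0 := by
  rw [testGrad]
  by_cases h1 : z.1 ∈ Metric.closedBall x₀ R
  · rw [timeCut_eq_zero hab hτ fun h2 => hz ⟨h1, h2⟩, zero_smul]
  · rw [hζ.eq_zero h1]
    simp only [ne_eq, OfNat.ofNat_ne_zero, not_false_eq_true, zero_pow, zero_smul, mul_zero,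
      zero_mul, add_zero]
    exact smul_zero _

/-- The truncation bounds the weight by `ℓ^c`, so the test map is dominated by `|U|^m` and lies in
the dual of the space `L^(1+m)` of `U`. -/
theorem IsCutoffSolution.memLp_testMap (hS : IsCutoffSolution m ν L x₀ R' a b U G Y F)
    (hm : 0 < m) (hc : 0 ≤ c) (hκ : 0 < κ) (hℓ : 0 < ℓ) (hζ : IsCutoff x₀ R D ζ) :
    MemLp (testMap m c κ ℓ ta tb τ ζ U) (ENNReal.ofReal ((1 + m) / m)) volume := by
  have h1 : MemLp (fun z => ‖U z‖ ^ m) (ENNReal.ofReal ((1 + m) / m)) volume := by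
    have := hS.memLp.norm_rpow_div (ENNReal.ofReal m)
    rw [ENNReal.toReal_ofReal hm.le, ← ENNReal.ofReal_div_of_pos hm] at this
    exact this
  refine MemLp.of_le_mul (c := ℓ ^ c) h1 ?_ (.of_forall fun z => ?_)
  · have s1 : AEStronglyMeasurable (fun z : SpaceTime N => timeCut ta tb τ z.2 * ζ z.1 ^ 2) volume :=
      ((measurable_timeCut.comp measurable_snd).mul
        ((hζ.contDiff.continuous.measurable.comp measurable_fst).pow_const 2)).aestronglyMeasurable
    have s2 : AEStronglyMeasurable (fun z => weightMap c κ ℓ (vpow (U z) m)) volume :=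
      ((contDiff_weightMap hκ hℓ).continuous.comp (continuous_vpow hm)).comp_aestronglyMeasurable
        hS.memLp.1
    exact s1.smul s2
  · have h2 := timeCut_nonneg (ta := ta) (tb := tb) (τ := τ) z.2
    have h3 := timeCut_le_one (ta := ta) (tb := tb) (τ := τ) z.2
    have hz2 : ζ z.1 ^ 2 ≤ 1 := pow_le_one₀ (hζ.nonneg _) (hζ.le_one _)
    have hU : 0 ≤ ‖U z‖ ^ m := Real.rpow_nonneg (norm_nonneg _) _
    rw [testMap, norm_smul, norm_weightMap hℓ, norm_vpow _ hm, Real.norm_of_nonneg hU,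
      Real.norm_of_nonneg (mul_nonneg h2 (sq_nonneg _))]
    have h4 : timeCut ta tb τ z.2 * ζ z.1 ^ 2 ≤ 1 := mul_le_one₀ h3 (sq_nonneg _) hz2
    have h5 : 0 ≤ weight c κ ℓ (‖U z‖ ^ m) * ‖U z‖ ^ m := mul_nonneg (weight_nonneg hℓ hU) hU
    refine (mul_le_of_le_one_left h5 h4).trans ?_
    exact mul_le_mul_of_nonneg_right (weight_le_level hc hκ hℓ hU) hU

theorem IsCutoffSolution.memLp_testGrad (hS : IsCutoffSolution m ν L x₀ R' a b U G Y F)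
    (hc : 0 ≤ c) (hκ : 0 < κ) (hℓ : 0 < ℓ) (hζ : IsCutoff x₀ R D ζ) :
    MemLp (testGrad m c κ ℓ ta tb τ ζ U G) 2 volume := by
  have hℓc : 0 ≤ ℓ ^ c := Real.rpow_nonneg hℓ.le _
  have hD := hζ.nonneg_bound
  have hvm := hS.memLp_vpow.1
  have hdom : MemLp (fun z => (c + 3) * ℓ ^ c * ‖G z‖ + 2 * D * ℓ ^ c * ‖vpow (U z) m‖) 2 volume :=
    (hS.memLp_grad.norm.const_mul _).add (hS.memLp_vpow.norm.const_mul _)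
  refine MemLp.of_le_mul (c := 1) hdom ?_ (.of_forall fun z => ?_)
  · have s0 : AEStronglyMeasurable (fun z : SpaceTime N => timeCut ta tb τ z.2) volume :=
      (measurable_timeCut.comp measurable_snd).aestronglyMeasurable
    refine s0.smul (aestronglyMeasurable_mkGrad fun α => ?_)
    have s1 : AEStronglyMeasurable (fun z : SpaceTime N => ζ z.1 ^ 2) volume :=
      ((hζ.contDiff.continuous.comp continuous_fst).pow 2).aestronglyMeasurable
    have hDc : Continuous (fderiv ℝ (weightMap (k := k) c κ ℓ)) :=
      (contDiff_weightMap hκ hℓ).continuous_fderiv (by simp)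
    have hGα : AEStronglyMeasurable (fun z => G z α) volume :=
      (PiLp.proj (𝕜 := ℝ) 2 (fun _ : Fin N => Vec k) α).continuous.comp_aestronglyMeasurable
        hS.memLp_grad.1
    have s2 : AEStronglyMeasurable
        (fun z => fderiv ℝ (weightMap c κ ℓ) (vpow (U z) m) (G z α)) volume :=
      isBoundedBilinearMap_apply.continuous.comp_aestronglyMeasurable
        ((hDc.comp_aestronglyMeasurable hvm).prodMk hGα)
    have s3 : AEStronglyMeasurable (fun z : SpaceTime N =>
        2 * ζ z.1 * fderiv ℝ ζ z.1 (EuclideanSpace.single α 1)) volume :=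
      ((continuous_const.mul (hζ.contDiff.continuous.comp continuous_fst)).mul
        (((hζ.contDiff.continuous_fderiv (by simp)).clm_apply continuous_const).comp
          continuous_fst)).aestronglyMeasurable
    have s4 : AEStronglyMeasurable (fun z => weightMap c κ ℓ (vpow (U z) m)) volume :=
      (contDiff_weightMap hκ hℓ).continuous.comp_aestronglyMeasurable hvm
    exact (s1.smul s2).add (s3.smul s4)
  · have h2 := timeCut_nonneg (ta := ta) (tb := tb) (τ := τ) z.2
    have h3 := timeCut_le_one (ta := ta) (tb := tb) (τ := τ) z.2
    have hz2 : ζ z.1 ^ 2 ≤ 1 := pow_le_one₀ (hζ.nonneg _) (hζ.le_one _)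
    set v := vpow (U z) m
    have e : (mkGrad fun α => ζ z.1 ^ 2 • fderiv ℝ (weightMap c κ ℓ) v (G z α) +
        (2 * ζ z.1 * fderiv ℝ ζ z.1 (EuclideanSpace.single α 1)) • weightMap c κ ℓ v) =
        ζ z.1 ^ 2 • (mkGrad fun α => fderiv ℝ (weightMap c κ ℓ) v (G z α)) +
        (2 * ζ z.1) • (mkGrad fun α => fderiv ℝ ζ z.1 (EuclideanSpace.single α 1) •
          weightMap c κ ℓ v) := by
      ext1 α
      simp only [PiLp.add_apply, PiLp.smul_apply, smul_smul]
    have n1 : ‖mkGrad fun α => fderiv ℝ (weightMap c κ ℓ) v (G z α)‖ ≤ (c + 3) * ℓ ^ c * ‖G z‖ :=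
      norm_mkGrad_le (ξ := fun α => G z α) (by positivity) fun α =>
        ContinuousLinearMap.le_of_opNorm_le _ (norm_fderiv_weightMap_le hc hκ hℓ v) _
    have n2 : ‖mkGrad fun α => fderiv ℝ ζ z.1 (EuclideanSpace.single α 1) • weightMap c κ ℓ v‖ ≤
        D * (ℓ ^ c * ‖v‖) := by
      refine (norm_mkGrad_smul_const_le hD
        (sum_fderiv_single_sq_le _ (hζ.norm_fderiv_le z.1)) _).trans ?_
      rw [norm_weightMap hℓ]
      have := weight_le_level (c := c) hc hκ hℓ (norm_nonneg v)
      gcongr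
    have hdn : 0 ≤ (c + 3) * ℓ ^ c * ‖G z‖ + 2 * D * ℓ ^ c * ‖v‖ := by positivity
    rw [testGrad, e, norm_smul, Real.norm_of_nonneg h2, one_mul, Real.norm_of_nonneg hdn]
    refine (mul_le_of_le_one_left (norm_nonneg _) h3).trans ((norm_add_le _ _).trans ?_)
    rw [norm_smul, norm_smul, Real.norm_of_nonneg (sq_nonneg _),
      Real.norm_of_nonneg (mul_nonneg zero_le_two (hζ.nonneg _))]
    refine add_le_add ((mul_le_of_le_one_left (norm_nonneg _) hz2).trans n1) ?_
    have : 2 * ζ z.1 ≤ 2 := by linarith [hζ.le_one z.1]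
    calc 2 * ζ z.1 * _ ≤ 2 * (D * (ℓ ^ c * ‖v‖)) :=
          mul_le_mul this n2 (norm_nonneg _) zero_le_two
      _ = _ := by ring

/-- On each slice the time factor is a constant, so its jump at `τ` is invisible and the spatial
chain rule applies. -/
theorem IsCutoffSolution.slice_testMap (hS : IsCutoffSolution m ν L x₀ R' a b U G Y F)
    (hc : 0 ≤ c) (hκ : 0 < κ) (hℓ : 0 < ℓ) (hζ : IsCutoff x₀ R D ζ) (hR : R < R')
    (hab : ta < tb) (hτ : τ ≤ te) (hta : a ≤ ta) (hte : te ≤ b) :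
    ∀ᵐ t : ℝ, HasWeakGradient univ (fun x => testMap m c κ ℓ ta tb τ ζ U (x, t))
      (fun x => testGrad m c κ ℓ ta tb τ ζ U G (x, t)) := by
  filter_upwards [hS.slice] with t ht
  by_cases htI : t ∈ Icc ta te
  · have h1 := ht ⟨hta.trans htI.1, htI.2.trans hte⟩
    have hsm : ContDiff ℝ ∞ (fun x => timeCut ta tb τ t * ζ x ^ 2) :=
      contDiff_const.mul (hζ.contDiff.pow 2)
    have hsub : tsupport (fun x => timeCut ta tb τ t * ζ x ^ 2) ⊆ tsupport ζ := by
      refine closure_mono fun x hx => ?_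
      intro hx0
      exact hx (by simp [hx0])
    have h2 := (h1.smul_comp Metric.isOpen_ball hsm
      (hζ.hasCompactSupport.of_isClosed_subset (isClosed_tsupport _) hsub)
      ((hsub.trans hζ.tsupport_subset).trans (Metric.closedBall_subset_ball hR))
      (contDiff_weightMap hκ hℓ) (norm_fderiv_weightMap_le hc hκ hℓ) weightMap_zero).1
    have e1 : (fun x => testGrad m c κ ℓ ta tb τ ζ U G (x, t)) = fun x => mkGrad fun α =>
        (timeCut ta tb τ t * ζ x ^ 2) • fderiv ℝ (weightMap c κ ℓ) (vpow (U (x, t)) m) (G (x, t) α) +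
        fderiv ℝ (fun x => timeCut ta tb τ t * ζ x ^ 2) x (EuclideanSpace.single α 1) •
          weightMap c κ ℓ (vpow (U (x, t)) m) := by
      ext1 x
      have hd := hζ.contDiff.differentiable (by simp) x
      ext1 α
      have e : fderiv ℝ (fun x => timeCut ta tb τ t * ζ x ^ 2) x (EuclideanSpace.single α 1)
          = timeCut ta tb τ t * (2 * ζ x * fderiv ℝ ζ x (EuclideanSpace.single α 1)) := by
        rw [fderiv_const_mul (hd.fun_pow 2), fderiv_fun_pow 2 hd]
        simp
      simp only [testGrad, PiLp.smul_apply, e, smul_add, smul_smul]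
    rw [e1]
    exact h2
  · have e1 : (fun x => testMap m c κ ℓ ta tb τ ζ U (x, t)) = fun _ => 0 := by
      ext1 x; exact testMap_eq_zero hζ hab hτ fun h => htI h.2
    have e2 : (fun x => testGrad m c κ ℓ ta tb τ ζ U G (x, t)) = fun _ => 0 := by
      ext1 x; exact testGrad_eq_zero hζ hab hτ fun h => htI h.2
    rw [e1, e2]
    exact hasWeakGradient_zero

end Energy

end PorousMedium

end

/-! ### Energy estimates on slices and for the gradient. -/

noncomputable section

namespace PorousMedium

variable {N k : ℕ}

section Energy

variable {m ν L c κ ℓ : ℝ} {x₀ : Vec N} {R R' a b ta tb te τ D : ℝ} {U : SpaceTime N → Vec k}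
  {G Y F : SpaceTime N → GradVec N k} {ζ : Vec N → ℝ}

/-- The jump at `τ` produces the indicator of `(τ - h, τ]`, where the ramp is already one since `h ≤
τ - tb`. Elsewhere only the slope `2/(tb - ta)` of the ramp is lost. The ramp starts at the midpoint
of `ta` and `tb`, so a shift by `h ≤ (tb - ta)/2` creates nothing before `ta`. -/
theorem timeCut_sub_ge {h : ℝ} (hab : ta < tb) (hτ : τ ≤ te) (h0 : 0 < h)
    (h1 : h ≤ (tb - ta) / 2) (h2 : h ≤ τ - tb) (t : ℝ) :
    (Ioc (τ - h) τ).indicator 1 t - 2 / (tb - ta) * h * (Icc ta te).indicator 1 t ≤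
      timeCut ta tb τ t - timeCut ta tb τ (t + h) := by
  have hp : 0 < tb - ta := by linarith
  have hlip : 0 ≤ 2 / (tb - ta) * h := by positivity
  have hind : 0 ≤ (Icc ta te).indicator (1 : ℝ → ℝ) t := indicator_nonneg (by simp) t
  have hz := mul_nonneg hlip hind
  rcases lt_or_ge τ t with h3 | h3
  · rw [timeCut, timeCut, if_neg (by linarith), if_neg (by linarith),
      indicator_of_notMem (by simp [h3])]
    linarith
  rcases lt_or_ge τ (t + h) with h4 | h4
  · rw [timeCut, timeCut, if_pos h3, if_neg (by linarith),
      indicator_of_mem (by constructor <;> linarith), ramp_eq_one (by linarith) (by linarith)]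
    simp only [Pi.one_apply]; linarith
  · rw [indicator_of_notMem (fun hh => by have := hh.1; linarith)]
    rcases lt_or_ge t ta with h5 | h5
    · rw [timeCut, timeCut, if_pos h3, if_pos h4, ramp_eq_zero (by linarith) (by linarith),
        ramp_eq_zero (by linarith) (by linarith)]
      linarith
    · have := ramp_add_le (a := (ta + tb) / 2) (b := tb) (t := t) (by linarith) h0.le
      have e : 1 / (tb - (ta + tb) / 2) = 2 / (tb - ta) := by
        have : tb - (ta + tb) / 2 = (tb - ta) / 2 := by ring
        rw [this]; field_simp
      rw [e] at this
      rw [timeCut, timeCut, if_pos h3, if_pos h4, indicator_of_mem (show t ∈ Icc ta te from ⟨h5, by linarith⟩)]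
      simp only [Pi.one_apply]; linarith

theorem IsCutoffSolution.integrable_weightPrim
    (hS : IsCutoffSolution m ν L x₀ R' a b U G Y F) (hm : 0 < m) (hc : 0 ≤ c) (hκ : 0 < κ)
    (hℓ : 0 < ℓ) : Integrable (fun z => weightPrim m c κ ℓ ‖U z‖) volume := by
  have h1 : Integrable (fun z => ‖U z‖ ^ (1 + m)) volume := by
    have := hS.memLp.integrable_norm_rpow (by simp; linarith) (by simp)
    rwa [ENNReal.toReal_ofReal (by linarith)] at this
  refine (h1.const_mul (ℓ ^ c)).mono' ?_ (.of_forall fun z => ?_)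
  · exact (continuous_weightPrim hm hκ hℓ).comp_aestronglyMeasurable hS.memLp.1.norm
  · have hU : 0 ≤ ‖U z‖ ^ m := Real.rpow_nonneg (norm_nonneg _) _
    rw [Real.norm_of_nonneg (weightPrim_nonneg hℓ (norm_nonneg _))]
    refine (weightPrim_le hm hc hκ hℓ (norm_nonneg _)).trans ?_
    have h2 := weight_le_level (c := c) hc hκ hℓ hU
    rcases (norm_nonneg (U z)).eq_or_lt with h | h
    · rw [← h, zero_mul, Real.zero_rpow (by linarith), mul_zero]
    rw [Real.rpow_add h, Real.rpow_one]
    have h3 := mul_le_mul_of_nonneg_left h2 (mul_nonneg (norm_nonneg (U z)) hU)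
    linarith

/-- Moving the shift onto `U` writes the drop of the correlation as the integral of `(U(z) - U(z -
e)) · ψ(z)`. Convexity replaces this by increments of the primitive, and shifting back puts the
difference on the time cutoff. -/
theorem IsCutoffSolution.increment_ge (hS : IsCutoffSolution m ν L x₀ R' a b U G Y F)
    (hm : 0 < m) (hc : 0 ≤ c) (hκ : 0 < κ) (hℓ : 0 < ℓ) (hζ : IsCutoff x₀ R D ζ) (hab : ta < tb)
    (hτ : τ ≤ te) {h : ℝ} (h0 : 0 < h) (h1 : h ≤ (tb - ta) / 2) (h2 : h ≤ τ - tb) :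
    (∫ t in (τ - h)..τ, ∫ x, ζ x ^ 2 * weightPrim m c κ ℓ ‖U (x, t)‖) - 2 / (tb - ta) * h *
        (∫ z in Metric.closedBall x₀ R ×ˢ Icc ta te, weightPrim m c κ ℓ ‖U z‖) ≤
      correlation volume U (testMap m c κ ℓ ta tb τ ζ U) 0 -
        correlation volume U (testMap m c κ ℓ ta tb τ ζ U) (0, h) := by
  set ψ := testMap m c κ ℓ ta tb τ ζ U with hψ
  set e : SpaceTime N := (0, h) with he
  set B : SpaceTime N → ℝ := fun z => weightPrim m c κ ℓ ‖U z‖ with hB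
  set η := timeCut ta tb τ with hη
  have hp : 0 < tb - ta := by linarith
  have hlip : 0 ≤ 2 / (tb - ta) * h := by positivity
  have : Fact (1 ≤ ENNReal.ofReal (1 + m)) := ⟨by simp [hm.le]⟩
  have hHC : ENNReal.HolderConjugate (ENNReal.ofReal (1 + m)) (ENNReal.ofReal ((1 + m) / m)) := by
    apply ENNReal.HolderConjugate.of_toReal
    rw [ENNReal.toReal_ofReal (by positivity), ENNReal.toReal_ofReal (by positivity),
      Real.holderConjugate_iff]
    constructor
    · linarith
    · field_simp
  have hψm : MemLp ψ (ENNReal.ofReal ((1 + m) / m)) volume := hS.memLp_testMap hm hc hκ hℓ hζ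
  have hBi : Integrable B volume := hS.integrable_weightPrim hm hc hκ hℓ
  have hBn : ∀ z, 0 ≤ B z := fun z => weightPrim_nonneg hℓ (norm_nonneg _)
  have hζ2 : ∀ x, ζ x ^ 2 ≤ 1 := fun x => pow_le_one₀ (hζ.nonneg _) (hζ.le_one _)
  have hζm : Measurable fun z : SpaceTime N => ζ z.1 ^ 2 :=
    (hζ.contDiff.continuous.measurable.comp measurable_fst).pow_const 2
  have hBζ : Integrable (fun z => B z * ζ z.1 ^ 2) volume :=
    Integrable.mul_of_nonneg_of_le hBi hζm.aestronglyMeasurable (fun _ => sq_nonneg _)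
      (fun z => hζ2 _)
  have hBη : Integrable (fun z => (B z * ζ z.1 ^ 2) * η z.2) volume :=
    Integrable.mul_of_nonneg_of_le hBζ (measurable_timeCut.comp measurable_snd).aestronglyMeasurable
      (fun _ => timeCut_nonneg _) (fun z => timeCut_le_one _)
  have hBη' : Integrable (fun z => (B z * ζ z.1 ^ 2) * η (z.2 + h)) volume :=
    Integrable.mul_of_nonneg_of_le hBζ
      (measurable_timeCut.comp (measurable_snd.add_const h)).aestronglyMeasurable
      (fun _ => timeCut_nonneg _) (fun z => timeCut_le_one _)
  have hUi : Integrable (fun z => inner ℝ (U z) (ψ z)) volume :=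
    integrable_inner_of_memLp hS.memLp hψm
  have hUe : MemLp (fun z => U (z - e)) (ENNReal.ofReal (1 + m)) volume := by
    simpa only [sub_eq_add_neg] using memLp_translate hS.memLp (-e)
  have hUi' : Integrable (fun z => inner ℝ (U (z - e)) (ψ z)) volume :=
    integrable_inner_of_memLp hUe hψm
  have c1 : correlation volume U ψ e = ∫ z, inner ℝ (U (z - e)) (ψ z) := by
    rw [correlation, ← integral_sub_right_eq_self _ e]
    simp only [sub_add_cancel]
  have c0 : correlation volume U ψ 0 = ∫ z, inner ℝ (U z) (ψ z) := by
    simp only [correlation, add_zero]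
  rw [c1, c0, ← integral_sub hUi hUi']
  -- the translated energy
  have hz2 : ∀ z : SpaceTime N, ((z - e).1 = z.1) ∧ ((z - e).2 + h = z.2) := fun z => by
    simp [he]
  have tr : ∫ z, (B (z - e) * ζ z.1 ^ 2) * η z.2 = ∫ z, (B z * ζ z.1 ^ 2) * η (z.2 + h) := by
    rw [← integral_sub_right_eq_self (fun z => (B z * ζ z.1 ^ 2) * η (z.2 + h)) e]
    simp only [(hz2 _).1, (hz2 _).2]
  have tri : Integrable (fun z => (B (z - e) * ζ z.1 ^ 2) * η z.2) volume := by
    have := hBη'.comp_sub_right e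
    simpa only [(hz2 _).1, (hz2 _).2] using this
  have step1 : ∫ z, ((B z * ζ z.1 ^ 2) * η z.2 - (B (z - e) * ζ z.1 ^ 2) * η z.2) ≤
      ∫ z, (inner ℝ (U z) (ψ z) - inner ℝ (U (z - e)) (ψ z)) := by
    refine integral_mono (hBη.sub tri) (hUi.sub hUi') fun z => ?_
    have h3 := weightPrim_sub_le_inner hm hc hκ hℓ (U z) (U (z - e))
    have h4 : 0 ≤ η z.2 * ζ z.1 ^ 2 := mul_nonneg (timeCut_nonneg _) (sq_nonneg _)
    have h5 := mul_le_mul_of_nonneg_left h3 h4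
    simp only [← inner_sub_left]
    rw [hψ, testMap, inner_smul_right]
    simp only [hB]
    linarith
  refine le_trans ?_ step1
  rw [integral_sub hBη tri, tr, ← integral_sub hBη hBη']
  have hI1 : Integrable (fun z : SpaceTime N => (B z * ζ z.1 ^ 2) * (Ioc (τ - h) τ).indicator 1 z.2)
      volume := by
    refine Integrable.mul_of_nonneg_of_le (M := 1) hBζ
      ((measurable_one.indicator measurableSet_Ioc).comp measurable_snd).aestronglyMeasurable
      (fun z => indicator_nonneg (by simp) _) (fun z => indicator_le_self' (by simp) _)
  have hI2 : Integrable (fun z : SpaceTime N => (B z * ζ z.1 ^ 2) * (Icc ta te).indicator 1 z.2)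
      volume := by
    refine Integrable.mul_of_nonneg_of_le (M := 1) hBζ
      ((measurable_one.indicator measurableSet_Icc).comp measurable_snd).aestronglyMeasurable
      (fun z => indicator_nonneg (by simp) _) (fun z => indicator_le_self' (by simp) _)
  have step2 : (∫ z : SpaceTime N, (B z * ζ z.1 ^ 2) * (Ioc (τ - h) τ).indicator 1 z.2) -
      2 / (tb - ta) * h * ∫ z : SpaceTime N, (B z * ζ z.1 ^ 2) * (Icc ta te).indicator 1 z.2 ≤
      ∫ z, ((B z * ζ z.1 ^ 2) * η z.2 - (B z * ζ z.1 ^ 2) * η (z.2 + h)) := by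
    rw [← integral_const_mul, ← integral_sub hI1 (hI2.const_mul _)]
    refine integral_mono (hI1.sub (hI2.const_mul _)) (hBη.sub hBη') fun z => ?_
    have h3 := mul_le_mul_of_nonneg_left (timeCut_sub_ge hab hτ h0 h1 h2 z.2)
      (mul_nonneg (hBn z) (sq_nonneg (ζ z.1)))
    simp only [hη]
    linarith
  refine le_trans (sub_le_sub (le_of_eq ?_) ?_) step2
  · rw [intervalIntegral.integral_of_le (by linarith), ← integral_indicator measurableSet_Ioc,
      Measure.volume_eq_prod, integral_prod_symm _ (by rwa [← Measure.volume_eq_prod])]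
    refine integral_congr_ae (.of_forall fun t => ?_)
    by_cases ht : t ∈ Ioc (τ - h) τ
    · simp only [indicator_of_mem ht, Pi.one_apply, mul_one, hB]
      simp only [mul_comm]
    · simp only [indicator_of_notMem ht, mul_zero, integral_zero]
  · refine mul_le_mul_of_nonneg_left ?_ hlip
    rw [← integral_indicator (measurableSet_closedBall.prod measurableSet_Icc)]
    refine integral_mono hI2 (hBi.indicator (measurableSet_closedBall.prod measurableSet_Icc))
      fun z => ?_
    by_cases hz : z ∈ Metric.closedBall x₀ R ×ˢ Icc ta te
    · simp only [indicator_of_mem hz, indicator_of_mem hz.2, Pi.one_apply, mul_one]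
      exact mul_le_of_le_one_right (hBn z) (hζ2 _)
    · simp only [indicator_of_notMem hz]
      by_cases h3 : z.1 ∈ Metric.closedBall x₀ R
      · simp only [indicator_of_notMem (fun h4 => hz ⟨h3, h4⟩), mul_zero, le_refl]
      · simp [hζ.eq_zero h3]

/-- The right-hand side of the energy estimate. -/
def energyBound (m ν L c κ ℓ ta tb te D R : ℝ) (x₀ : Vec N) (U : SpaceTime N → Vec k)
    (F : SpaceTime N → GradVec N k) : ℝ :=
  ∫ z in Metric.closedBall x₀ R ×ˢ Icc ta te,
    (2 / (tb - ta) * weightPrim m c κ ℓ ‖U z‖ + fluxConst ν L c *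
      (D ^ 2 * (‖vpow (U z) m‖ ^ 2 * weight c κ ℓ ‖vpow (U z) m‖) +
        ‖F z‖ ^ 2 * levelWeight c κ ℓ ‖vpow (U z) m‖))

theorem IsCutoffSolution.integrable_source (hS : IsCutoffSolution m ν L x₀ R' a b U G Y F)
    (hc : 0 ≤ c) (hκ : 0 < κ) (hℓ : 0 < ℓ) :
    Integrable (fun z => D ^ 2 * (‖vpow (U z) m‖ ^ 2 * weight c κ ℓ ‖vpow (U z) m‖) +
        ‖F z‖ ^ 2 * levelWeight c κ ℓ ‖vpow (U z) m‖) volume := by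
  have h1 := hS.memLp_vpow.integrable_norm_pow (by norm_num)
  have h2 := hS.memLp_force.integrable_norm_pow (by norm_num)
  simp only at h1 h2
  have hw : Continuous (weight c κ ℓ) := (contDiff_weight hκ hℓ).continuous
  refine (Integrable.const_mul ?_ _).add ?_
  · exact Integrable.mul_of_nonneg_of_le h1
      (hw.comp_aestronglyMeasurable hS.memLp_vpow.1.norm)
      (fun z => weight_nonneg hℓ (norm_nonneg _)) (fun z => weight_le_level hc hκ hℓ (norm_nonneg _))
  · exact Integrable.mul_of_nonneg_of_le h2
      ((measurable_levelWeight c κ ℓ).comp_aemeasurable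
        hS.memLp_vpow.1.norm.aemeasurable).aestronglyMeasurable
      (fun z => levelWeight_nonneg hℓ (norm_nonneg _))
      (fun z => levelWeight_le_level hc hℓ (norm_nonneg _))

theorem IsCutoffSolution.integrable_gradEnergy (hS : IsCutoffSolution m ν L x₀ R' a b U G Y F)
    (hc : 0 ≤ c) (hκ : 0 < κ) (hℓ : 0 < ℓ) (hζ : IsCutoff x₀ R D ζ) :
    Integrable (fun z => ζ z.1 ^ 2 * (weight c κ ℓ ‖vpow (U z) m‖ * ‖G z‖ ^ 2)) volume := by
  have h1 := hS.memLp_grad.integrable_norm_pow (by norm_num)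
  have hw : Continuous (weight c κ ℓ) := (contDiff_weight hκ hℓ).continuous
  have h2 := Integrable.mul_of_nonneg_of_le h1
    (hw.comp_aestronglyMeasurable hS.memLp_vpow.1.norm)
    (fun z => weight_nonneg hℓ (norm_nonneg _)) (fun z => weight_le_level hc hκ hℓ (norm_nonneg _))
  have h3 := Integrable.mul_of_nonneg_of_le h2 (M := 1) (g := fun z => ζ z.1 ^ 2)
    ((hζ.contDiff.continuous.comp continuous_fst).pow 2).aestronglyMeasurable
    (fun _ => sq_nonneg _) (fun z => pow_le_one₀ (hζ.nonneg _) (hζ.le_one _))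
  refine h3.congr (.of_forall fun z => ?_)
  simp only
  ring

/-- Integrated form of `inner_flux_ge`. The time factor is kept on the gradient term and, being at
most one, dropped on the source term. -/
theorem IsCutoffSolution.flux_ge (hS : IsCutoffSolution m ν L x₀ R' a b U G Y F) (hν : 0 < ν)
    (hc : 0 ≤ c) (hκ : 0 < κ) (hℓ : 0 < ℓ) (hζ : IsCutoff x₀ R D ζ) (hab : ta < tb)
    (hτ : τ ≤ te) :
    ν / 2 * (∫ z, timeCut ta tb τ z.2 *
        (ζ z.1 ^ 2 * (weight c κ ℓ ‖vpow (U z) m‖ * ‖G z‖ ^ 2))) -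
      fluxConst ν L c * (∫ z in Metric.closedBall x₀ R ×ˢ Icc ta te,
        (D ^ 2 * (‖vpow (U z) m‖ ^ 2 * weight c κ ℓ ‖vpow (U z) m‖) +
          ‖F z‖ ^ 2 * levelWeight c κ ℓ ‖vpow (U z) m‖)) ≤
      correlation volume (fun z => Y z + F z) (testGrad m c κ ℓ ta tb τ ζ U G) 0 := by
  have hK : MeasurableSet (Metric.closedBall x₀ R ×ˢ Icc ta te) :=
    measurableSet_closedBall.prod measurableSet_Icc
  have i1 : Integrable (fun z => timeCut ta tb τ z.2 *
      (ζ z.1 ^ 2 * (weight c κ ℓ ‖vpow (U z) m‖ * ‖G z‖ ^ 2))) volume := by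
    have := Integrable.mul_of_nonneg_of_le (hS.integrable_gradEnergy hc hκ hℓ hζ) (M := 1)
      (g := fun z => timeCut ta tb τ z.2)
      (measurable_timeCut.comp measurable_snd).aestronglyMeasurable
      (fun z => timeCut_nonneg _) (fun z => timeCut_le_one _)
    exact this.congr (.of_forall fun z => mul_comm _ _)
  have i2 := (hS.integrable_source (D := D) hc hκ hℓ).indicator hK
  have i3 : Integrable (fun z => inner ℝ (Y z + F z) (testGrad m c κ ℓ ta tb τ ζ U G z)) volume :=
    integrable_inner_of_memLp (p := 2) (q := 2) (hS.memLp_flux.add hS.memLp_force)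
      (hS.memLp_testGrad hc hκ hℓ hζ)
  have e0 : correlation volume (fun z => Y z + F z) (testGrad m c κ ℓ ta tb τ ζ U G) 0 =
      ∫ z, inner ℝ (Y z + F z) (testGrad m c κ ℓ ta tb τ ζ U G z) := by
    simp only [correlation, add_zero]
  rw [e0, ← integral_indicator hK, ← integral_const_mul, ← integral_const_mul,
    ← integral_sub (i1.const_mul _) (i2.const_mul _)]
  refine integral_mono_ae ((i1.const_mul _).sub (i2.const_mul _)) i3 ?_
  filter_upwards [hS.ellipticity, hS.growth, hS.diagonal] with z he hg hd
  by_cases hz : z ∈ Metric.closedBall x₀ R ×ˢ Icc ta te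
  · simp only [indicator_of_mem hz]
    have h1 := inner_flux_ge (F := F z) hν hc hκ hℓ hζ.nonneg_bound (hζ.nonneg z.1) (hζ.le_one z.1)
      (sum_fderiv_single_sq_le _ (hζ.norm_fderiv_le z.1)) he hg hd
    have h2 := timeCut_nonneg (ta := ta) (tb := tb) (τ := τ) z.2
    have h3 := timeCut_le_one (ta := ta) (tb := tb) (τ := τ) z.2
    have h4 := mul_le_mul_of_nonneg_left h1 h2
    rw [testGrad, inner_smul_right]
    refine le_trans ?_ h4
    have h5 : 0 ≤ fluxConst ν L c *
        (D ^ 2 * (‖vpow (U z) m‖ ^ 2 * weight c κ ℓ ‖vpow (U z) m‖) +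
          ‖F z‖ ^ 2 * levelWeight c κ ℓ ‖vpow (U z) m‖) := by
      have := weight_nonneg (c := c) (κ := κ) hℓ (norm_nonneg (vpow (U z) m))
      have := levelWeight_nonneg (c := c) (κ := κ) hℓ (norm_nonneg (vpow (U z) m))
      have := (fluxConst_pos (L := L) (c := c) hν).le
      positivity
    have h6 := mul_le_of_le_one_left h5 h3
    linarith
  · simp only [indicator_of_notMem hz]
    rw [testGrad_eq_zero hζ hab hτ hz, inner_zero_right]
    by_cases h1 : z.1 ∈ Metric.closedBall x₀ R
    · rw [timeCut_eq_zero hab hτ fun h2 => hz ⟨h1, h2⟩]; simp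
    · rw [hζ.eq_zero h1]; simp

theorem cthickening_prod_subset {d : ℝ} (h0 : 0 ≤ d) (hR : R + d ≤ R') (ha : a + d ≤ ta)
    (hb : te + d ≤ b) :
    Metric.cthickening d (Metric.closedBall x₀ R ×ˢ Icc ta te) ⊆
      Metric.closedBall x₀ R' ×ˢ Icc a b := by
  rw [((isCompact_closedBall x₀ R).prod isCompact_Icc).cthickening_eq_biUnion_closedBall h0]
  intro z hz
  simp only [mem_iUnion, exists_prop] at hz
  obtain ⟨y, hy, hzy⟩ := hz
  rw [Metric.mem_closedBall, Prod.dist_eq, max_le_iff, Real.dist_eq, abs_le] at hzy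
  have h1 := hy.1
  have h2 := hy.2
  refine ⟨?_, ?_, ?_⟩
  · rw [Metric.mem_closedBall] at h1 ⊢
    linarith [dist_triangle z.1 y.1 x₀]
  · linarith [h2.1, hzy.2.1]
  · linarith [h2.2, hzy.2.2]

/-- The correlation identity equates the drop in `increment_ge` with minus the integrated flux
correlation. The bound on `h` keeps the shifted test map inside the region where the equation holds
and the time cutoff estimate valid. -/
theorem IsCutoffSolution.increment_le (hS : IsCutoffSolution m ν L x₀ R' a b U G Y F)
    (hm : 0 < m) (hc : 0 ≤ c) (hκ : 0 < κ) (hℓ : 0 < ℓ) (hζ : IsCutoff x₀ R D ζ)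
    (hR : R < R') (ha : a < ta) (hab : ta < tb) (hbτ : tb < τ) (hτ : τ ≤ te) (hb : te < b) :
    ∀ᶠ h in 𝓝[>] (0 : ℝ),
      (∫ t in (τ - h)..τ, ∫ x, ζ x ^ 2 * weightPrim m c κ ℓ ‖U (x, t)‖) / h +
        (∫ s in (0 : ℝ)..h, correlation volume (fun z => Y z + F z)
          (testGrad m c κ ℓ ta tb τ ζ U G) (0, s)) / h ≤
        2 / (tb - ta) *
          (∫ z in Metric.closedBall x₀ R ×ˢ Icc ta te, weightPrim m c κ ℓ ‖U z‖) := by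
  have hHC : ENNReal.HolderConjugate (ENNReal.ofReal (1 + m)) (ENNReal.ofReal ((1 + m) / m)) := by
    apply ENNReal.HolderConjugate.of_toReal
    rw [ENNReal.toReal_ofReal (by positivity), ENNReal.toReal_ofReal (by positivity),
      Real.holderConjugate_iff]
    constructor
    · linarith
    · field_simp
  set d := min (R' - R) (min (ta - a) (b - te)) with hd
  have hd0 : 0 < d := lt_min (by linarith) (lt_min (by linarith) (by linarith))
  have hd1 : d ≤ R' - R := min_le_left _ _
  have hd2 : d ≤ ta - a := (min_le_right _ _).trans (min_le_left _ _)
  have hd3 : d ≤ b - te := (min_le_right _ _).trans (min_le_right _ _)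
  set δ := min d (min ((tb - ta) / 2) (τ - tb)) with hδ
  have hδ0 : 0 < δ := lt_min hd0 (lt_min (by linarith) (by linarith))
  filter_upwards [Ioo_mem_nhdsGT hδ0] with h hh
  have h1 : h < d := hh.2.trans_le (min_le_left _ _)
  have h2 : h ≤ (tb - ta) / 2 := hh.2.le.trans ((min_le_right _ _).trans (min_le_left _ _))
  have h3 : h ≤ τ - tb := hh.2.le.trans ((min_le_right _ _).trans (min_le_right _ _))
  have hq1 : 1 ≤ ENNReal.ofReal ((1 + m) / m) := by
    rw [ENNReal.one_le_ofReal, le_div_iff₀ hm]; linarith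
  have hK : IsCompact (Metric.closedBall x₀ R ×ˢ Icc ta te) :=
    (isCompact_closedBall x₀ R).prod isCompact_Icc
  have hψ := hS.memLp_testMap (ta := ta) (tb := tb) (τ := τ) hm hc hκ hℓ hζ
  have hZ := hS.memLp_testGrad (ta := ta) (tb := tb) (τ := τ) hc hκ hℓ hζ
  have key := correlation_sub_eq_integral hq1 ENNReal.ofReal_ne_top hS.memLp
    (hS.memLp_flux.add hS.memLp_force) hψ hZ
    (integrable_of_memLp_of_eq_zero hq1 hψ hK.measure_ne_top
      fun z hz => testMap_eq_zero hζ hab hτ hz)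
    (integrable_of_memLp_of_eq_zero (by norm_num) hZ hK.measure_ne_top
      fun z hz => testGrad_eq_zero hζ hab hτ hz)
    (hS.slice_testMap hc hκ hℓ hζ hR hab hτ ha.le hb.le) hK
    (fun z hz => testMap_eq_zero hζ hab hτ hz)
    (cthickening_prod_subset hd0.le (by linarith) (by linarith) (by linarith))
    hS.weak hh.1.le h1
  have key2 := hS.increment_ge hm hc hκ hℓ hζ hab hτ hh.1 h2 h3
  have e : (fun z => Y z + F z) = Y + F := rfl
  rw [← add_div, div_le_iff₀ hh.1, e]
  linarith

theorem tendsto_intervalIntegral_div {f : ℝ → ℝ} (hf : Continuous f) :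
    Tendsto (fun h => (∫ s in (0 : ℝ)..h, f s) / h) (𝓝[>] 0) (𝓝 (f 0)) := by
  have := hasDerivAt_tendsto_right (intervalIntegral.integral_hasDerivAt_right
    (hf.intervalIntegrable 0 0) (hf.stronglyMeasurableAtFilter _ _) hf.continuousAt)
  simpa using this

theorem energyBound_eq (hS : IsCutoffSolution m ν L x₀ R' a b U G Y F)
    (hm : 0 < m) (hc : 0 ≤ c) (hκ : 0 < κ) (hℓ : 0 < ℓ) :
    energyBound m ν L c κ ℓ ta tb te D R x₀ U F = 2 / (tb - ta) *
      (∫ z in Metric.closedBall x₀ R ×ˢ Icc ta te, weightPrim m c κ ℓ ‖U z‖) +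
      fluxConst ν L c * (∫ z in Metric.closedBall x₀ R ×ˢ Icc ta te,
        (D ^ 2 * (‖vpow (U z) m‖ ^ 2 * weight c κ ℓ ‖vpow (U z) m‖) +
          ‖F z‖ ^ 2 * levelWeight c κ ℓ ‖vpow (U z) m‖)) := by
  rw [energyBound, integral_add, integral_const_mul, integral_const_mul]
  · exact (hS.integrable_weightPrim hm hc hκ hℓ).integrableOn.const_mul _
  · exact (hS.integrable_source hc hκ hℓ).integrableOn.const_mul _

/-- As the step `h` tends to zero, the backward time averages converge for almost every `τ` by
Lebesgue differentiation, and the flux average converges because the correlation is continuous. The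
gradient term is nonnegative and is discarded. -/
theorem IsCutoffSolution.energy_slice (hS : IsCutoffSolution m ν L x₀ R' a b U G Y F)
    (hν : 0 < ν) (hm : 0 < m) (hc : 0 ≤ c) (hκ : 0 < κ) (hℓ : 0 < ℓ) (hζ : IsCutoff x₀ R D ζ)
    (hR : R < R') (ha : a < ta) (hab : ta < tb) (hb : te < b) :
    ∀ᵐ τ : ℝ, τ ∈ Ioc tb te → ∫ x, ζ x ^ 2 * weightPrim m c κ ℓ ‖U (x, τ)‖ ≤
      energyBound m ν L c κ ℓ ta tb te D R x₀ U F := by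
  have hβ : Integrable (fun t => ∫ x, ζ x ^ 2 * weightPrim m c κ ℓ ‖U (x, t)‖) volume := by
    have h1 := Integrable.mul_of_nonneg_of_le (hS.integrable_weightPrim (c := c) hm hc hκ hℓ)
      (M := 1) (g := fun z => ζ z.1 ^ 2)
      ((hζ.contDiff.continuous.comp continuous_fst).pow 2).aestronglyMeasurable
      (fun _ => sq_nonneg _) (fun z => pow_le_one₀ (hζ.nonneg _) (hζ.le_one _))
    rw [Measure.volume_eq_prod] at h1
    refine h1.integral_prod_right.congr (.of_forall fun t => ?_)
    simp only [mul_comm]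
  filter_upwards [LocallyIntegrable.ae_hasDerivAt_integral hβ.locallyIntegrable] with τ hτd hτ
  have hd := hasDerivAt_tendsto_left (hτd 0)
  have hC : Continuous fun s : ℝ => correlation volume (fun z => Y z + F z)
      (testGrad m c κ ℓ ta tb τ ζ U G) (0, s) :=
    (continuous_correlation (p := 2) (q := 2) (by norm_num) (by norm_num)
      (hS.memLp_flux.add hS.memLp_force) (hS.memLp_testGrad hc hκ hℓ hζ)).comp
      (Continuous.prodMk_right 0)
  have hl := hd.add (tendsto_intervalIntegral_div hC)
  have h1 := hS.increment_le hm hc hκ hℓ hζ hR ha hab hτ.1 hτ.2 hb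
  have h2 := le_of_tendsto hl (h1.mono fun h hh => by
    rwa [intervalIntegral.integral_interval_sub_left hβ.intervalIntegrable
      hβ.intervalIntegrable])
  have h3 := hS.flux_ge hν hc hκ hℓ hζ hab hτ.2
  have h4 : 0 ≤ ν / 2 * (∫ z, timeCut ta tb τ z.2 *
      (ζ z.1 ^ 2 * (weight c κ ℓ ‖vpow (U z) m‖ * ‖G z‖ ^ 2))) := by
    refine mul_nonneg (by positivity) (integral_nonneg fun z => ?_)
    have := weight_nonneg (c := c) (κ := κ) hℓ (norm_nonneg (vpow (U z) m))
    have := timeCut_nonneg (ta := ta) (tb := tb) (τ := τ) z.2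
    positivity
  rw [energyBound_eq hS hm hc hκ hℓ]
  have e : ((0 : Vec N), (0 : ℝ)) = 0 := rfl
  rw [e] at h2
  linarith

/-- Same limit with `τ = te`, now discarding the nonnegative slice term. Hence no exceptional set of
times has to be avoided. -/
theorem IsCutoffSolution.energy_grad (hS : IsCutoffSolution m ν L x₀ R' a b U G Y F)
    (hν : 0 < ν) (hm : 0 < m) (hc : 0 ≤ c) (hκ : 0 < κ) (hℓ : 0 < ℓ) (hζ : IsCutoff x₀ R D ζ)
    (hR : R < R') (ha : a < ta) (hab : ta < tb) (hbe : tb < te) (hb : te < b) :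
    ν / 2 * (∫ z, timeCut ta tb te z.2 *
      (ζ z.1 ^ 2 * (weight c κ ℓ ‖vpow (U z) m‖ * ‖G z‖ ^ 2))) ≤
      energyBound m ν L c κ ℓ ta tb te D R x₀ U F := by
  have hC : Continuous fun s : ℝ => correlation volume (fun z => Y z + F z)
      (testGrad m c κ ℓ ta tb te ζ U G) (0, s) :=
    (continuous_correlation (p := 2) (q := 2) (by norm_num) (by norm_num)
      (hS.memLp_flux.add hS.memLp_force) (hS.memLp_testGrad hc hκ hℓ hζ)).comp
      (Continuous.prodMk_right 0)
  have h1 := hS.increment_le hm hc hκ hℓ hζ hR ha hab hbe le_rfl hb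
  have h2 := le_of_tendsto (tendsto_intervalIntegral_div hC) ((h1.and self_mem_nhdsWithin).mono
    fun h hh => by
      have h0 : (0 : ℝ) < h := hh.2
      have : 0 ≤ (∫ t in (te - h)..te, ∫ x, ζ x ^ 2 * weightPrim m c κ ℓ ‖U (x, t)‖) / h :=
        div_nonneg (intervalIntegral.integral_nonneg (by linarith) fun t _ =>
          integral_nonneg fun x => mul_nonneg (sq_nonneg _)
            (weightPrim_nonneg hℓ (norm_nonneg _))) h0.le
      exact (le_add_of_nonneg_left this).trans hh.1)
  have h3 := hS.flux_ge hν hc hκ hℓ hζ hab (le_refl te)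
  rw [energyBound_eq hS hm hc hκ hℓ]
  have e : ((0 : Vec N), (0 : ℝ)) = 0 := rfl
  rw [e] at h2
  linarith

end Energy

end PorousMedium

end

/-! ### Parabolic Sobolev inequality for the truncated powers. -/

noncomputable section

namespace PorousMedium

variable {N k : ℕ}

section Gain

variable {m ν L c κ ℓ : ℝ} {x₀ : Vec N} {R R' a b ta tb te τ D : ℝ} {U : SpaceTime N → Vec k}
  {G Y F : SpaceTime N → GradVec N k} {ζ : Vec N → ℝ}

/-- The map entering Sobolev has exponent `c/2`, so that the square of its gradient is controlled by
the weight with exponent `c` from the energy estimate. Its derivative carries one factor of the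
excess, whose square is exactly the one in that weight. -/
theorem sq_weight_half_le (hκ : 0 < κ) (hℓ : 0 < ℓ) {w : ℝ} (hw : 0 ≤ w) :
    (trunc ℓ w ^ (c / 2) * excess κ w) ^ 2 = weight c κ ℓ w ∧
      weight (c / 2) κ ℓ w ^ 2 ≤ weight c κ ℓ w := by
  have h1 : (trunc ℓ w ^ (c / 2)) ^ 2 = trunc ℓ w ^ c := by
    rw [← Real.rpow_mul_natCast (trunc_nonneg hℓ hw)]
    congr 1
    push_cast; ring
  have h2 : (trunc ℓ w ^ (c / 2) * excess κ w) ^ 2 = weight c κ ℓ w := by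
    rw [mul_pow, h1, weight, mul_comm]
  refine ⟨h2, ?_⟩
  rw [← h2]
  exact pow_le_pow_left₀ (weight_nonneg hℓ hw) (weight_le hκ hℓ hw) 2

theorem norm_sq_truncGrad_le (hc : 0 ≤ c) (hκ : 0 < κ) (hℓ : 0 < ℓ) {ζ : ℝ} {v : Vec k}
    {ξ : GradVec N k} {a : Fin N → ℝ} (hD : 0 ≤ D) (ha : ∑ α, a α ^ 2 ≤ D ^ 2) :
    ‖mkGrad fun α => ζ • fderiv ℝ (weightMap (c / 2) κ ℓ) v (ξ α) +
        a α • weightMap (c / 2) κ ℓ v‖ ^ 2 ≤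
      2 * (c / 2 + 3) ^ 2 * (ζ ^ 2 * (weight c κ ℓ ‖v‖ * ‖ξ‖ ^ 2)) +
        2 * (D ^ 2 * (‖v‖ ^ 2 * weight c κ ℓ ‖v‖)) := by
  obtain ⟨e1, e2⟩ := sq_weight_half_le (c := c) hκ hℓ (norm_nonneg v)
  have e : (mkGrad fun α => ζ • fderiv ℝ (weightMap (c / 2) κ ℓ) v (ξ α) +
      a α • weightMap (c / 2) κ ℓ v) =
      ζ • (mkGrad fun α => fderiv ℝ (weightMap (c / 2) κ ℓ) v (ξ α)) +
      mkGrad fun α => a α • weightMap (c / 2) κ ℓ v := by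
    ext1 α
    simp only [PiLp.add_apply, PiLp.smul_apply]
  have hb : 0 ≤ (c / 2 + 3) * (trunc ℓ ‖v‖ ^ (c / 2) * excess κ ‖v‖) :=
    mul_nonneg (by positivity) (mul_nonneg (Real.rpow_nonneg (trunc_nonneg hℓ (norm_nonneg _)) _)
      (excess_nonneg (norm_nonneg _)))
  have n1 : ‖mkGrad fun α => fderiv ℝ (weightMap (c / 2) κ ℓ) v (ξ α)‖ ≤
      (c / 2 + 3) * (trunc ℓ ‖v‖ ^ (c / 2) * excess κ ‖v‖) * ‖ξ‖ :=
    norm_mkGrad_le (ξ := fun α => ξ α) hb fun α =>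
      (norm_fderiv_weightMap_apply_le (by positivity) hκ hℓ v (ξ α)).trans
        (mul_le_mul_of_nonneg_right (weight_add_mul_deriv_le (by positivity) hκ hℓ
          (norm_nonneg v)) (norm_nonneg _))
  have n2 : ‖mkGrad fun α => a α • weightMap (c / 2) κ ℓ v‖ ≤
      D * (weight (c / 2) κ ℓ ‖v‖ * ‖v‖) := by
    have := norm_mkGrad_smul_const_le hD ha (weightMap (c / 2) κ ℓ v)
    rwa [norm_weightMap hℓ] at this
  set p := mkGrad fun α => fderiv ℝ (weightMap (c / 2) κ ℓ) v (ξ α)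
  set r := mkGrad fun α => a α • weightMap (c / 2) κ ℓ v
  have n1' := pow_le_pow_left₀ (norm_nonneg p) n1 2
  have n2' := pow_le_pow_left₀ (norm_nonneg r) n2 2
  have e3 : ((c / 2 + 3) * (trunc ℓ ‖v‖ ^ (c / 2) * excess κ ‖v‖) * ‖ξ‖) ^ 2 =
      (c / 2 + 3) ^ 2 * (weight c κ ℓ ‖v‖ * ‖ξ‖ ^ 2) := by rw [← e1]; ring
  have e4 : (D * (weight (c / 2) κ ℓ ‖v‖ * ‖v‖)) ^ 2 ≤ D ^ 2 * (‖v‖ ^ 2 * weight c κ ℓ ‖v‖) := by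
    have := mul_le_mul_of_nonneg_left e2 (mul_nonneg (sq_nonneg D) (sq_nonneg ‖v‖))
    linarith
  rw [e3] at n1'
  have h3 : ‖ζ • p + r‖ ^ 2 ≤ 2 * (ζ ^ 2 * ‖p‖ ^ 2) + 2 * ‖r‖ ^ 2 := by
    have h4 := pow_le_pow_left₀ (norm_nonneg _) (norm_add_le (ζ • p) r) 2
    rw [norm_smul] at h4
    have h5 : (‖ζ‖ * ‖p‖) ^ 2 = ζ ^ 2 * ‖p‖ ^ 2 := by
      rw [mul_pow, Real.norm_eq_abs, sq_abs]
    linarith [sq_nonneg (‖ζ‖ * ‖p‖ - ‖r‖)]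
  rw [e]
  have h6 := mul_le_mul_of_nonneg_left n1' (sq_nonneg ζ)
  linarith

/-- The weak spatial gradient of `ζ • weightMap (c / 2) κ ℓ (vpow U m)`. -/
def truncGrad (m c κ ℓ : ℝ) (ζ : Vec N → ℝ) (U : SpaceTime N → Vec k)
    (G : SpaceTime N → GradVec N k) (z : SpaceTime N) : GradVec N k :=
  mkGrad fun α => ζ z.1 • fderiv ℝ (weightMap (c / 2) κ ℓ) (vpow (U z) m) (G z α) +
    fderiv ℝ ζ z.1 (EuclideanSpace.single α 1) • weightMap (c / 2) κ ℓ (vpow (U z) m)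

/-- Hölder with the exponents `N/(N-2)` and `N/2`, followed by the Sobolev inequality for `f`. -/
theorem sobolev_interpolation (hN : 3 ≤ N) {f : Vec N → Vec k} {g : Vec N → GradVec N k}
    (h : HasWeakGradient univ f g) (hf : Integrable f) (hg : Integrable g) {K : Set (Vec N)}
    (hK : Bornology.IsBounded K) (hfK : ∀ x, x ∉ K → f x = 0) {B : Vec N → ℝ≥0∞}
    (hB : AEMeasurable B) :
    ∫⁻ x, ‖f x‖ₑ ^ (2 : ℝ) * B x ^ (2 / (N : ℝ)) ≤
      (eLpNormLESNormFDerivOfEqInnerConst (volume : Measure (Vec N)) 2 : ℝ≥0∞) ^ (2 : ℝ) *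
        (∫⁻ x, ‖g x‖ₑ ^ (2 : ℝ)) * (∫⁻ x, B x) ^ (2 / (N : ℝ)) := by
  have hN' : (3 : ℝ) ≤ N := by exact_mod_cast hN
  have hN2 : (0 : ℝ) < N - 2 := by linarith
  have h1 := ENNReal.lintegral_mul_norm_pow_le (μ := volume) (f := fun x => ‖f x‖ₑ ^ (2 * N / (N - 2) : ℝ))
    (g := B) (hf.aestronglyMeasurable.enorm.pow_const _) hB (p := ((N : ℝ) - 2) / N)
    (q := 2 / (N : ℝ)) (by positivity) (by positivity) (by field_simp; ring)
  have h2 : ∀ x, (‖f x‖ₑ ^ (2 * N / (N - 2) : ℝ)) ^ (((N : ℝ) - 2) / N) = ‖f x‖ₑ ^ (2 : ℝ) := by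
    intro x
    rw [← ENNReal.rpow_mul]
    congr 1
    field_simp
  simp only [h2] at h1
  refine h1.trans ?_
  gcongr
  have h3 := h.eLpNorm_le hN hf hg hK hfK
  have hpos : (0 : ℝ) < 2 * N / (N - 2) := by positivity
  rw [eLpNorm_eq_lintegral_rpow_enorm_toReal (by simpa using hpos) (by simp),
    eLpNorm_eq_lintegral_rpow_enorm_toReal (by norm_num) (by norm_num),
    ENNReal.toReal_ofReal hpos.le, ENNReal.toReal_ofNat] at h3
  have h4 := ENNReal.rpow_le_rpow h3 (zero_le_two (α := ℝ))
  rw [ENNReal.mul_rpow_of_nonneg _ _ zero_le_two, ← ENNReal.rpow_mul, ← ENNReal.rpow_mul] at h4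
  have e1 : 1 / (2 * N / (N - 2)) * 2 = ((N : ℝ) - 2) / N := by field_simp
  rw [e1] at h4
  simpa using h4

/-- After `tb` the time cutoff is one, so `energy_grad` controls the main term with the factor
`2/ν`. The term from `Dζ` is already part of the source in the energy bound, since the flux constant
is at least one. -/
theorem IsCutoffSolution.lintegral_truncGrad_le
    (hS : IsCutoffSolution m ν L x₀ R' a b U G Y F)
    (hν : 0 < ν) (hm : 0 < m) (hc : 0 ≤ c) (hκ : 0 < κ) (hℓ : 0 < ℓ) (hζ : IsCutoff x₀ R D ζ)
    (hR : R < R') (ha : a < ta) (hab : ta < tb) (hbe : tb < te) (hb : te < b) :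
    ∫⁻ z in univ ×ˢ Ioc tb te, ‖truncGrad m c κ ℓ ζ U G z‖ₑ ^ (2 : ℝ) ≤
      ENNReal.ofReal ((4 * (c / 2 + 3) ^ 2 / ν + 2) *
        energyBound m ν L c κ ℓ ta tb te D R x₀ U F) := by
  set C := 2 * (c / 2 + 3) ^ 2 with hC
  set f : SpaceTime N → ℝ := fun z => timeCut ta tb te z.2 *
      (ζ z.1 ^ 2 * (weight c κ ℓ ‖vpow (U z) m‖ * ‖G z‖ ^ 2)) with hf
  set g : SpaceTime N → ℝ := fun z => D ^ 2 * (‖vpow (U z) m‖ ^ 2 * weight c κ ℓ ‖vpow (U z) m‖)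
    with hg
  set K := Metric.closedBall x₀ R ×ˢ Icc ta te with hKd
  have hK : MeasurableSet K := measurableSet_closedBall.prod measurableSet_Icc
  have hw0 : ∀ z, 0 ≤ weight c κ ℓ ‖vpow (U z) m‖ := fun z => weight_nonneg hℓ (norm_nonneg _)
  have hw : Continuous (weight c κ ℓ) := (contDiff_weight hκ hℓ).continuous
  have hg0 : ∀ z, 0 ≤ g z := fun z => by have := hw0 z; positivity
  have hf0 : ∀ z, 0 ≤ f z := fun z => by
    have := hw0 z; have := timeCut_nonneg (ta := ta) (tb := tb) (τ := te) z.2; positivity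
  have i1 : Integrable f volume := by
    have := Integrable.mul_of_nonneg_of_le (hS.integrable_gradEnergy hc hκ hℓ hζ) (M := 1)
      (g := fun z => timeCut ta tb te z.2)
      (measurable_timeCut.comp measurable_snd).aestronglyMeasurable
      (fun z => timeCut_nonneg _) (fun z => timeCut_le_one _)
    exact this.congr (.of_forall fun z => mul_comm _ _)
  have i2 : Integrable g volume := by
    have h1 := hS.memLp_vpow.integrable_norm_pow (by norm_num)
    exact (Integrable.mul_of_nonneg_of_le h1
      (hw.comp_aestronglyMeasurable hS.memLp_vpow.1.norm)
      (fun z => weight_nonneg hℓ (norm_nonneg _))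
      (fun z => weight_le_level hc hκ hℓ (norm_nonneg _))).const_mul _
  have i3 : Integrable (K.indicator g) volume := i2.indicator hK
  have hsum : Integrable (fun z => C * f z + 2 * K.indicator g z) volume :=
    (i1.const_mul _).add (i3.const_mul _)
  have hind0 : ∀ z, 0 ≤ K.indicator g z := fun z => indicator_nonneg (fun z _ => hg0 z) z
  have hpt : ∀ z ∈ (univ : Set (Vec N)) ×ˢ Ioc tb te, ‖truncGrad m c κ ℓ ζ U G z‖ₑ ^ (2 : ℝ) ≤
      ENNReal.ofReal (C * f z + 2 * K.indicator g z) := by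
    intro z hz
    rw [← ofReal_norm, ENNReal.ofReal_rpow_of_nonneg (norm_nonneg _) zero_le_two,
      Real.rpow_two]
    refine ENNReal.ofReal_le_ofReal ?_
    by_cases hx : z.1 ∈ Metric.closedBall x₀ R
    · have hzK : z ∈ K := ⟨hx, (hab.trans hz.2.1).le, hz.2.2⟩
      have ht : timeCut ta tb te z.2 = 1 := by
        rw [timeCut, if_pos hz.2.2, ramp_eq_one (by linarith) hz.2.1.le]
      have := norm_sq_truncGrad_le (v := vpow (U z) m) (ξ := G z) (ζ := ζ z.1) hc hκ hℓ
        hζ.nonneg_bound (sum_fderiv_single_sq_le _ (hζ.norm_fderiv_le z.1))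
      simp only [hf, ht, one_mul, indicator_of_mem hzK, hC, hg]
      exact this
    · have h1 : ζ z.1 = 0 := hζ.eq_zero hx
      have h2 : fderiv ℝ ζ z.1 = 0 :=
        fderiv_of_notMem_tsupport (𝕜 := ℝ) fun h => hx (hζ.tsupport_subset h)
      have h3 : truncGrad m c κ ℓ ζ U G z = 0 := by
        rw [truncGrad, h1, h2]; ext1 α; simp
      rw [h3, norm_zero]
      have h4 := hf0 z
      have h5 := hind0 z
      have : 0 ≤ C := by rw [hC]; positivity
      rw [zero_pow two_ne_zero]
      positivity
  refine (setLIntegral_mono' (MeasurableSet.univ.prod measurableSet_Ioc) hpt).trans ?_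
  refine (setLIntegral_le_lintegral _ _).trans ?_
  rw [← ofReal_integral_eq_lintegral_ofReal hsum (.of_forall fun z => by
    have := hf0 z; have := hind0 z; positivity)]
  refine ENNReal.ofReal_le_ofReal ?_
  rw [integral_add (i1.const_mul _) (i3.const_mul _), integral_const_mul, integral_const_mul,
    integral_indicator hK]
  have h1 := hS.energy_grad hν hm hc hκ hℓ hζ hR ha hab hbe hb
  have h2 : ∫ z in K, g z ≤ energyBound m ν L c κ ℓ ta tb te D R x₀ U F := by
    rw [energyBound]
    have hint := ((hS.integrable_weightPrim hm hc hκ hℓ).const_mul (2 / (tb - ta))).add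
      ((hS.integrable_source (D := D) hc hκ hℓ).const_mul (fluxConst ν L c))
    refine integral_mono i2.integrableOn hint.integrableOn fun z => ?_
    have h3 : 0 ≤ weightPrim m c κ ℓ ‖U z‖ := weightPrim_nonneg hℓ (norm_nonneg _)
    have h4 := levelWeight_nonneg (c := c) (κ := κ) hℓ (norm_nonneg (vpow (U z) m))
    have h5 : 1 ≤ fluxConst ν L c := by
      unfold fluxConst
      exact le_add_of_nonneg_left (by positivity)
    have h6 := hg0 z
    have h7 : 0 ≤ ‖F z‖ ^ 2 * levelWeight c κ ℓ ‖vpow (U z) m‖ := by positivity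
    have h8 : 0 ≤ 2 / (tb - ta) * weightPrim m c κ ℓ ‖U z‖ := by
      have : 0 < tb - ta := by linarith
      positivity
    have h9 : g z + ‖F z‖ ^ 2 * levelWeight c κ ℓ ‖vpow (U z) m‖ ≤ fluxConst ν L c *
      (g z + ‖F z‖ ^ 2 * levelWeight c κ ℓ ‖vpow (U z) m‖) :=
      le_mul_of_one_le_left (by positivity) h5
    simp only [hg] at h9 h7 ⊢
    linarith
  have e1 : C * ∫ z, f z = 4 * (c / 2 + 3) ^ 2 / ν * (ν / 2 * ∫ z, f z) := by
    rw [hC]; field_simp; ring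
  rw [e1]
  have h3 : 0 ≤ 4 * (c / 2 + 3) ^ 2 / ν := by positivity
  have h4 := mul_le_mul_of_nonneg_left h1 h3
  simp only [hf] at h4 ⊢
  linarith

/-- On almost every slice the primitive is bounded by the energy, and its power `2/N` comes out of
the time integral. What is left is the integral of the squared gradient, bounded by one more power
of the energy. -/
theorem IsCutoffSolution.parabolic_sobolev (hN : 3 ≤ N)
    (hS : IsCutoffSolution m ν L x₀ R' a b U G Y F)
    (hν : 0 < ν) (hm : 0 < m) (hc : 0 ≤ c) (hκ : 0 < κ) (hℓ : 0 < ℓ) (hζ : IsCutoff x₀ R D ζ)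
    (hR : R < R') (ha : a < ta) (hab : ta < tb) (hbe : tb < te) (hb : te < b) :
    ∫⁻ z in univ ×ˢ Ioc tb te, ‖ζ z.1 • weightMap (c / 2) κ ℓ (vpow (U z) m)‖ₑ ^ (2 : ℝ) *
        ENNReal.ofReal (ζ z.1 ^ 2 * weightPrim m c κ ℓ ‖U z‖) ^ (2 / (N : ℝ)) ≤
      (eLpNormLESNormFDerivOfEqInnerConst (volume : Measure (Vec N)) 2 : ℝ≥0∞) ^ (2 : ℝ) *
        ENNReal.ofReal (4 * (c / 2 + 3) ^ 2 / ν + 2) *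
          ENNReal.ofReal (energyBound m ν L c κ ℓ ta tb te D R x₀ U F) ^ (1 + 2 / (N : ℝ)) := by
  set E := energyBound m ν L c κ ℓ ta tb te D R x₀ U F with hE
  set S := (eLpNormLESNormFDerivOfEqInnerConst (volume : Measure (Vec N)) 2 : ℝ≥0∞) ^ (2 : ℝ)
  have hζm : AEStronglyMeasurable (fun z : SpaceTime N => ζ z.1) volume :=
    (hζ.contDiff.continuous.comp continuous_fst).aestronglyMeasurable
  have hwm : AEStronglyMeasurable (fun z => weightMap (c / 2) κ ℓ (vpow (U z) m)) volume :=
    (contDiff_weightMap hκ hℓ).continuous.comp_aestronglyMeasurable hS.memLp_vpow.1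
  have hVm : AEStronglyMeasurable (fun z => ζ z.1 • weightMap (c / 2) κ ℓ (vpow (U z) m)) volume :=
    hζm.smul hwm
  have hBi : Integrable (fun z => ζ z.1 ^ 2 * weightPrim m c κ ℓ ‖U z‖) volume := by
    have h1 := Integrable.mul_of_nonneg_of_le (hS.integrable_weightPrim (c := c) hm hc hκ hℓ)
      (M := 1) (g := fun z => ζ z.1 ^ 2)
      ((hζ.contDiff.continuous.comp continuous_fst).pow 2).aestronglyMeasurable
      (fun _ => sq_nonneg _) (fun z => pow_le_one₀ (hζ.nonneg _) (hζ.le_one _))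
    refine h1.congr (.of_forall fun t => ?_)
    simp only [mul_comm]
  have hB0 : ∀ z, 0 ≤ ζ z.1 ^ 2 * weightPrim m c κ ℓ ‖U z‖ := fun z =>
    mul_nonneg (sq_nonneg _) (weightPrim_nonneg hℓ (norm_nonneg _))
  have hWm : AEStronglyMeasurable (truncGrad m c κ ℓ ζ U G) volume := by
    refine aestronglyMeasurable_mkGrad fun α => ?_
    have hDc : Continuous (fderiv ℝ (weightMap (k := k) (c / 2) κ ℓ)) :=
      (contDiff_weightMap hκ hℓ).continuous_fderiv (by simp)
    have hGα : AEStronglyMeasurable (fun z => G z α) volume :=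
      (PiLp.proj (𝕜 := ℝ) 2 (fun _ : Fin N => Vec k) α).continuous.comp_aestronglyMeasurable
        hS.memLp_grad.1
    have s2 : AEStronglyMeasurable
        (fun z => fderiv ℝ (weightMap (c / 2) κ ℓ) (vpow (U z) m) (G z α)) volume :=
      isBoundedBilinearMap_apply.continuous.comp_aestronglyMeasurable
        ((hDc.comp_aestronglyMeasurable hS.memLp_vpow.1).prodMk hGα)
    have s3 : AEStronglyMeasurable (fun z : SpaceTime N =>
        fderiv ℝ ζ z.1 (EuclideanSpace.single α 1)) volume :=
      (((hζ.contDiff.continuous_fderiv (by simp)).clm_apply continuous_const).comp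
          continuous_fst).aestronglyMeasurable
    exact (hζm.smul s2).add (s3.smul hwm)
  have hslice : ∀ᵐ t : ℝ, t ∈ Ioc tb te →
      ∫⁻ x, ‖ζ x • weightMap (c / 2) κ ℓ (vpow (U (x, t)) m)‖ₑ ^ (2 : ℝ) *
        ENNReal.ofReal (ζ x ^ 2 * weightPrim m c κ ℓ ‖U (x, t)‖) ^ (2 / (N : ℝ)) ≤
      S * (∫⁻ x, ‖truncGrad m c κ ℓ ζ U G (x, t)‖ₑ ^ (2 : ℝ)) * ENNReal.ofReal E ^ (2 / (N : ℝ)) := by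
    have hBi' := hBi
    rw [Measure.volume_eq_prod] at hBi'
    filter_upwards [hS.slice, hS.energy_slice hν hm hc hκ hℓ hζ hR ha hab hb, hBi'.prod_left_ae]
      with t h1 h2 h3 ht
    have h4 := (h1 ⟨(ha.trans (hab.trans ht.1)).le, ht.2.trans hb.le⟩).smul_comp
      Metric.isOpen_ball hζ.contDiff hζ.hasCompactSupport
      (hζ.tsupport_subset.trans (Metric.closedBall_subset_ball hR))
      (contDiff_weightMap hκ hℓ) (norm_fderiv_weightMap_le (c := c / 2) (by positivity) hκ hℓ)
      weightMap_zero
    have h5 := sobolev_interpolation hN h4.1 h4.2.1 h4.2.2 (Metric.isBounded_closedBall (x := x₀)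
      (r := R)) (fun x hx => by rw [hζ.eq_zero hx, zero_smul])
      (B := fun x => ENNReal.ofReal (ζ x ^ 2 * weightPrim m c κ ℓ ‖U (x, t)‖))
      h3.aestronglyMeasurable.aemeasurable.ennreal_ofReal
    refine h5.trans ?_
    rw [← ofReal_integral_eq_lintegral_ofReal h3 (.of_forall fun x => hB0 (x, t))]
    have h6 := ENNReal.ofReal_le_ofReal (h2 ht)
    gcongr
    exact le_rfl
  have hprod : (volume : Measure (SpaceTime N)).restrict (univ ×ˢ Ioc tb te) =
      (volume : Measure (Vec N)).prod (volume.restrict (Ioc tb te)) := by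
    rw [Measure.volume_eq_prod, ← Measure.prod_restrict, Measure.restrict_univ]
  have hm1 : AEMeasurable (fun z => ‖ζ z.1 • weightMap (c / 2) κ ℓ (vpow (U z) m)‖ₑ ^ (2 : ℝ) *
      ENNReal.ofReal (ζ z.1 ^ 2 * weightPrim m c κ ℓ ‖U z‖) ^ (2 / (N : ℝ))) volume :=
    (hVm.enorm.pow_const _).mul
      (hBi.aestronglyMeasurable.aemeasurable.ennreal_ofReal.pow_const _)
  have hm2 : AEMeasurable (fun z => ‖truncGrad m c κ ℓ ζ U G z‖ₑ ^ (2 : ℝ)) volume :=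
    hWm.enorm.pow_const _
  have h1 := hS.lintegral_truncGrad_le hν hm hc hκ hℓ hζ hR ha hab hbe hb
  have hm1' := hm1.restrict (s := univ ×ˢ Ioc tb te)
  have hm2' := hm2.restrict (s := univ ×ˢ Ioc tb te)
  rw [hprod] at hm1' hm2' h1 ⊢
  rw [lintegral_prod_symm _ hm2'] at h1
  rw [lintegral_prod_symm _ hm1']
  have h2 : ∀ᵐ t ∂(volume.restrict (Ioc tb te)),
      ∫⁻ x, ‖ζ x • weightMap (c / 2) κ ℓ (vpow (U (x, t)) m)‖ₑ ^ (2 : ℝ) *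
        ENNReal.ofReal (ζ x ^ 2 * weightPrim m c κ ℓ ‖U (x, t)‖) ^ (2 / (N : ℝ)) ≤
      (S * ENNReal.ofReal E ^ (2 / (N : ℝ))) *
        (∫⁻ x, ‖truncGrad m c κ ℓ ζ U G (x, t)‖ₑ ^ (2 : ℝ)) := by
    rw [ae_restrict_iff' measurableSet_Ioc]
    filter_upwards [hslice] with t ht htI
    refine (ht htI).trans_eq (by ring)
  refine (lintegral_mono_ae h2).trans ?_
  rw [lintegral_const_mul'' _ hm2'.lintegral_prod_left']
  refine (mul_le_mul_right h1 _).trans_eq ?_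
  rw [ENNReal.ofReal_mul (by positivity), ENNReal.rpow_add_of_nonneg _ _ zero_le_one
    (by positivity), ENNReal.rpow_one]
  ring

end Gain

end PorousMedium

end

/-! ### Tails above a level and gain of integrability. -/

noncomputable section

namespace PorousMedium

variable {N k : ℕ}

/-- The power `|y|^s` restricted to `{|y| > h}`. -/
def tailPow (s h : ℝ) (y : Vec k) : ℝ≥0∞ := if h < ‖y‖ then ‖y‖ₑ ^ s else 0

theorem measurable_tailPow (s h : ℝ) : Measurable (tailPow (k := k) s h) :=
  Measurable.ite (measurableSet_lt measurable_const measurable_norm)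
    (measurable_enorm.pow_const s) measurable_const

theorem tailPow_of_lt {s h : ℝ} (hh : 0 ≤ h) {y : Vec k} (hy : h < ‖y‖) :
    tailPow s h y = ENNReal.ofReal (‖y‖ ^ s) := by
  rw [tailPow, if_pos hy, ← ofReal_norm, ENNReal.ofReal_rpow_of_pos (hh.trans_lt hy)]

theorem tailPow_le_enorm (s h : ℝ) (y : Vec k) : tailPow s h y ≤ ‖y‖ₑ ^ s := by
  unfold tailPow; split_ifs
  · exact le_rfl
  · exact zero_le

theorem tailPow_le_mul {s s' h : ℝ} (hh : 0 < h) (hs : s' ≤ s) (y : Vec k) :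
    tailPow s' h y ≤ ENNReal.ofReal (h ^ (s' - s)) * tailPow s h y := by
  by_cases hy : h < ‖y‖
  · have hy0 := hh.trans hy
    rw [tailPow_of_lt hh.le hy, tailPow_of_lt hh.le hy,
      ← ENNReal.ofReal_mul (Real.rpow_nonneg hh.le _)]
    refine ENNReal.ofReal_le_ofReal ?_
    have h1 : ‖y‖ ^ s' = ‖y‖ ^ (s' - s) * ‖y‖ ^ s := by
      rw [← Real.rpow_add hy0]; congr 1; ring
    rw [h1]
    exact mul_le_mul_of_nonneg_right (Real.rpow_le_rpow_of_nonpos hh hy.le (by linarith))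
      (Real.rpow_nonneg hy0.le _)
  · simp [tailPow, hy]

theorem tailPow_le_mul_rpow {s q θ h : ℝ} (hh : 0 < h) (hq : q ≤ s * θ) (y : Vec k) :
    tailPow q h y ≤ ENNReal.ofReal (h ^ (q - s * θ)) * tailPow s h y ^ θ := by
  refine (tailPow_le_mul hh hq y).trans ?_
  gcongr
  by_cases hy : h < ‖y‖
  · rw [tailPow, tailPow, if_pos hy, if_pos hy, ENNReal.rpow_mul]
  · simp [tailPow, hy]

section Gain

variable {m ν L c κ ℓ h : ℝ} {x₀ : Vec N} {R R' a b ta tb te τ D : ℝ} {U : SpaceTime N → Vec k}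
  {G Y F : SpaceTime N → GradVec N k} {ζ : Vec N → ℝ}

theorem weight_rpow_le (hh : 1 ≤ h) (hc : 0 ≤ c) (hℓ : 0 < ℓ) {σ : ℝ} (hσ : h < σ) :
    weight c (h ^ m) ℓ (σ ^ m) ≤ σ ^ (m * c) := by
  have hσ0 : 0 < σ := by linarith
  have hw : 0 ≤ σ ^ m := Real.rpow_nonneg hσ0.le _
  refine (weight_le_rpow_trunc (by positivity) hℓ hw).trans ?_
  rw [Real.rpow_mul hσ0.le]
  exact Real.rpow_le_rpow (trunc_nonneg hℓ hw) (trunc_le_self hℓ hw) hc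

theorem ofReal_weightPrim_le (hm : 0 < m) (hh : 1 ≤ h) (hc : 0 ≤ c) (hℓ : 0 < ℓ) (y : Vec k) :
    ENNReal.ofReal (weightPrim m c (h ^ m) ℓ ‖y‖) ≤ tailPow (1 + m + m * c) h y := by
  have hκ : 0 < h ^ m := by positivity
  have h1 := weightPrim_le (c := c) hm hc hκ hℓ (norm_nonneg y)
  by_cases hy : h < ‖y‖
  · have hy0 : 0 < ‖y‖ := by linarith
    rw [tailPow_of_lt (by linarith) hy]
    refine ENNReal.ofReal_le_ofReal (h1.trans ?_)
    rw [Real.rpow_add hy0, Real.rpow_add hy0, Real.rpow_one, mul_assoc]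
    have := weight_rpow_le (m := m) hh hc hℓ hy
    gcongr
  · have h2 : weight c (h ^ m) ℓ (‖y‖ ^ m) = 0 :=
      weight_eq_zero (Real.rpow_le_rpow (norm_nonneg _) (not_lt.1 hy) hm.le)
    rw [h2, mul_zero, mul_zero] at h1
    rw [ENNReal.ofReal_of_nonpos h1]
    exact zero_le

/-- On `{|y| > h}` with `h ≥ 1`, the power `2m ≤ 1 + m` can be raised. The spatial and temporal
cutoff errors are thus controlled by the same tail. -/
theorem ofReal_sq_mul_weight_le (hm : 0 < m) (hm1 : m ≤ 1) (hh : 1 ≤ h) (hc : 0 ≤ c) (hℓ : 0 < ℓ)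
    (y : Vec k) :
    ENNReal.ofReal (‖vpow y m‖ ^ 2 * weight c (h ^ m) ℓ ‖vpow y m‖) ≤
      tailPow (1 + m + m * c) h y := by
  rw [norm_vpow y hm]
  by_cases hy : h < ‖y‖
  · have hy0 : 0 < ‖y‖ := by linarith
    rw [tailPow_of_lt (by linarith) hy]
    refine ENNReal.ofReal_le_ofReal ?_
    have h1 := weight_rpow_le (m := m) hh hc hℓ hy
    have h2 : (‖y‖ ^ m) ^ 2 ≤ ‖y‖ ^ (1 + m) := by
      rw [← Real.rpow_mul_natCast hy0.le]
      exact Real.rpow_le_rpow_of_exponent_le (by linarith) (by push_cast; linarith)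
    rw [Real.rpow_add hy0]
    have h3 := weight_nonneg (c := c) (κ := h ^ m) hℓ (Real.rpow_nonneg hy0.le m)
    exact mul_le_mul h2 h1 h3 (Real.rpow_nonneg hy0.le _)
  · have h2 : weight c (h ^ m) ℓ (‖y‖ ^ m) = 0 :=
      weight_eq_zero (Real.rpow_le_rpow (norm_nonneg _) (not_lt.1 hy) hm.le)
    rw [h2, mul_zero, ENNReal.ofReal_zero]
    exact zero_le

theorem ofReal_levelWeight_le (hm : 0 < m) (hh : 1 ≤ h) (hc : 0 ≤ c) (hℓ : 0 < ℓ) (y : Vec k) :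
    ENNReal.ofReal (levelWeight c (h ^ m) ℓ ‖vpow y m‖) ≤ tailPow (m * c) h y := by
  rw [norm_vpow y hm, levelWeight]
  by_cases hy : h < ‖y‖
  · have hy0 : 0 < ‖y‖ := by linarith
    have hw : 0 ≤ ‖y‖ ^ m := Real.rpow_nonneg hy0.le _
    rw [tailPow_of_lt (by linarith) hy]
    refine ENNReal.ofReal_le_ofReal ?_
    rw [if_pos (Real.rpow_lt_rpow (by linarith) hy hm), Real.rpow_mul hy0.le]
    exact Real.rpow_le_rpow (trunc_nonneg hℓ hw) (trunc_le_self hℓ hw) hc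
  · rw [if_neg (not_lt.2 (Real.rpow_le_rpow (norm_nonneg _) (not_lt.1 hy) hm.le)),
      ENNReal.ofReal_zero]
    exact zero_le

/-- Using `T(w) ≤ w` removes `ℓ` from the right-hand side, as needed for the limit of infinite
truncation level. -/
theorem IsCutoffSolution.energyBound_le (hS : IsCutoffSolution m ν L x₀ R' a b U G Y F)
    (hν : 0 < ν) (hm : 0 < m) (hm1 : m ≤ 1) (hh : 1 ≤ h) (hc : 0 ≤ c) (hℓ : 0 < ℓ)
    (hab : ta < tb) :
    ENNReal.ofReal (energyBound m ν L c (h ^ m) ℓ ta tb te D R x₀ U F) ≤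
      ENNReal.ofReal (2 / (tb - ta) + fluxConst ν L c * D ^ 2) *
        (∫⁻ z in Metric.closedBall x₀ R ×ˢ Icc ta te, tailPow (1 + m + m * c) h (U z)) +
      ENNReal.ofReal (fluxConst ν L c) *
        ∫⁻ z in Metric.closedBall x₀ R ×ˢ Icc ta te, ‖F z‖ₑ ^ (2 : ℝ) * tailPow (m * c) h (U z) := by
  have hκ : 0 < h ^ m := by positivity
  have hf := fluxConst_pos (L := L) (c := c) hν
  have hlip : 0 < 2 / (tb - ta) := by
    have : 0 < tb - ta := by linarith
    positivity
  have hint : Integrable (fun z => 2 / (tb - ta) * weightPrim m c (h ^ m) ℓ ‖U z‖ +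
      fluxConst ν L c * (D ^ 2 * (‖vpow (U z) m‖ ^ 2 * weight c (h ^ m) ℓ ‖vpow (U z) m‖) +
        ‖F z‖ ^ 2 * levelWeight c (h ^ m) ℓ ‖vpow (U z) m‖)) volume :=
    ((hS.integrable_weightPrim (c := c) hm hc hκ hℓ).const_mul (2 / (tb - ta))).add
      ((hS.integrable_source (D := D) hc hκ hℓ).const_mul (fluxConst ν L c))
  have h0 : ∀ z, 0 ≤ weightPrim m c (h ^ m) ℓ ‖U z‖ := fun z =>
    weightPrim_nonneg hℓ (norm_nonneg _)
  have h1 : ∀ z, 0 ≤ ‖vpow (U z) m‖ ^ 2 * weight c (h ^ m) ℓ ‖vpow (U z) m‖ := fun z =>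
    mul_nonneg (sq_nonneg _) (weight_nonneg hℓ (norm_nonneg _))
  have h2 : ∀ z, 0 ≤ levelWeight c (h ^ m) ℓ ‖vpow (U z) m‖ := fun z =>
    levelWeight_nonneg hℓ (norm_nonneg _)
  rw [energyBound, ofReal_integral_eq_lintegral_ofReal hint.integrableOn (.of_forall fun z => by
    have := h0 z; have := h1 z; have := h2 z
    simp only [Pi.zero_apply]; positivity)]
  have hm1' : AEMeasurable (fun z => tailPow (1 + m + m * c) h (U z))
      (volume.restrict (Metric.closedBall x₀ R ×ˢ Icc ta te)) :=
    ((measurable_tailPow _ _).comp_aemeasurable hS.memLp.1.aemeasurable).restrict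
  rw [← lintegral_const_mul'' _ hm1', ← lintegral_const_mul' _ _ ENNReal.ofReal_ne_top,
    ← lintegral_add_left' (hm1'.const_mul _)]
  refine lintegral_mono fun z => ?_
  have e1 := ofReal_weightPrim_le (c := c) (ℓ := ℓ) hm hh hc hℓ (U z)
  have e2 := ofReal_sq_mul_weight_le (c := c) (ℓ := ℓ) hm hm1 hh hc hℓ (U z)
  have e3 := ofReal_levelWeight_le (c := c) (ℓ := ℓ) hm hh hc hℓ (U z)
  have p0 := h0 z; have p1 := h1 z; have p2 := h2 z
  have eF : ENNReal.ofReal (‖F z‖ ^ 2) = ‖F z‖ₑ ^ (2 : ℝ) := by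
    rw [← ofReal_norm, ENNReal.ofReal_rpow_of_nonneg (norm_nonneg _) zero_le_two, Real.rpow_two]
  rw [ENNReal.ofReal_add (by positivity) (by positivity), ENNReal.ofReal_mul hlip.le,
    ENNReal.ofReal_mul hf.le, ENNReal.ofReal_add (by positivity) (by positivity),
    ENNReal.ofReal_mul (sq_nonneg D), ENNReal.ofReal_mul (sq_nonneg ‖F z‖), eF,
    ENNReal.ofReal_add hlip.le (by positivity), ENNReal.ofReal_mul hf.le]
  calc _ ≤ ENNReal.ofReal (2 / (tb - ta)) * tailPow (1 + m + m * c) h (U z) +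
        ENNReal.ofReal (fluxConst ν L c) * (ENNReal.ofReal (D ^ 2) *
          tailPow (1 + m + m * c) h (U z) + ‖F z‖ₑ ^ (2 : ℝ) * tailPow (m * c) h (U z)) := by
        gcongr
    _ = _ := by ring

/-- The loss of the energy estimate between two levels. -/
def levelLoss (N : ℕ) (c δ : ℝ) : ℝ := δ ^ 4 * ((δ / 2) ^ 3 * (1 / 2) ^ (c + 1)) ^ (2 / (N : ℝ))

/-- Above the next level the excess is at least `δ`, so both factors of the Sobolev integrand are
comparable to pure truncated powers. The fourth power of `δ` is the squared weight; the cubic factor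
comes from `le_weightPrim`. -/
theorem level_lower_bound (hm : 0 < m) (hm1 : m ≤ 1) (hc : 0 ≤ c) (hκ : 0 < κ)
    (hℓ : 0 < ℓ) {δ : ℝ} (hδ : 0 < δ) (hδ1 : δ < 1) {y : Vec k} (hy : κ ≤ (1 - δ) * ‖y‖ ^ m) :
    ENNReal.ofReal (levelLoss N c δ) *
        ENNReal.ofReal ((‖y‖ ^ m) ^ 2 * trunc ℓ (‖y‖ ^ m) ^ c *
          (‖y‖ * (‖y‖ ^ m * trunc ℓ (‖y‖ ^ m) ^ c)) ^ (2 / (N : ℝ))) ≤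
      ‖weightMap (c / 2) κ ℓ (vpow y m)‖ₑ ^ (2 : ℝ) *
        ENNReal.ofReal (weightPrim m c κ ℓ ‖y‖) ^ (2 / (N : ℝ)) := by
  set w := ‖y‖ ^ m with hw
  have hw0 : 0 ≤ w := Real.rpow_nonneg (norm_nonneg _) m
  have hwp : 0 < w := by
    rcases hw0.eq_or_lt with h | h
    · rw [← h, mul_zero] at hy; linarith
    · exact h
  have hT : 0 ≤ trunc ℓ w ^ c := Real.rpow_nonneg (trunc_nonneg hℓ hw0) _
  have hp := le_weightPrim hm hm1 hc hκ hℓ hδ hδ1 (norm_nonneg y) hy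
  have hpn : 0 ≤ ‖y‖ * (w * trunc ℓ w ^ c) := mul_nonneg (norm_nonneg _) (mul_nonneg hw0 hT)
  have hlc : 0 ≤ (δ / 2) ^ 3 * (1 / 2) ^ (c + 1) := by positivity
  have hκw : κ ≤ w := hy.trans (mul_le_of_le_one_left hw0 (by linarith))
  have hex : δ ≤ excess κ w := by
    rw [excess_of_le hκ hκw]
    have : κ / w ≤ 1 - δ := by rw [div_le_iff₀ hwp]; exact hy
    linarith
  have hwt : δ ^ 4 * trunc ℓ w ^ c ≤ weight (c / 2) κ ℓ w ^ 2 := by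
    have h1 : (trunc ℓ w ^ (c / 2)) ^ 2 = trunc ℓ w ^ c := by
      rw [← Real.rpow_mul_natCast (trunc_nonneg hℓ hw0)]
      congr 1
      push_cast; ring
    rw [weight, mul_pow, h1, ← pow_mul]
    exact mul_le_mul_of_nonneg_right (pow_le_pow_left₀ hδ.le hex 4) hT
  have hV : ‖weightMap (c / 2) κ ℓ (vpow y m)‖ₑ ^ (2 : ℝ) =
      ENNReal.ofReal (weight (c / 2) κ ℓ w ^ 2 * w ^ 2) := by
    rw [← ofReal_norm, norm_weightMap hℓ, norm_vpow y hm,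
      ENNReal.ofReal_rpow_of_nonneg (mul_nonneg (weight_nonneg hℓ hw0) hw0) zero_le_two,
      Real.rpow_two, mul_pow]
  have hN : (0 : ℝ) ≤ 2 / N := by positivity
  rw [hV, ENNReal.ofReal_rpow_of_nonneg (weightPrim_nonneg hℓ (norm_nonneg _)) hN,
    ← ENNReal.ofReal_mul (by unfold levelLoss; positivity), ← ENNReal.ofReal_mul (by positivity)]
  refine ENNReal.ofReal_le_ofReal ?_
  have h3 := Real.rpow_le_rpow (by positivity) hp hN
  rw [Real.mul_rpow hlc hpn] at h3
  have h4 := mul_le_mul_of_nonneg_right hwt (sq_nonneg w)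
  calc _ = (δ ^ 4 * trunc ℓ w ^ c * w ^ 2) * (((δ / 2) ^ 3 * (1 / 2) ^ (c + 1)) ^ (2 / (N : ℝ)) *
        (‖y‖ * (w * trunc ℓ w ^ c)) ^ (2 / (N : ℝ))) := by unfold levelLoss; ring
    _ ≤ _ := mul_le_mul h4 h3 (by positivity) (by positivity)

/-- The constant of the gain of integrability. -/
def gainConst (N : ℕ) (ν c : ℝ) : ℝ≥0∞ :=
  (eLpNormLESNormFDerivOfEqInnerConst (volume : Measure (Vec N)) 2 : ℝ≥0∞) ^ (2 : ℝ) *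
    ENNReal.ofReal (4 * (c / 2 + 3) ^ 2 / ν + 2)

theorem gainConst_ne_top (N : ℕ) (ν c : ℝ) : gainConst N ν c ≠ ⊤ :=
  ENNReal.mul_ne_top (ENNReal.rpow_ne_top_of_nonneg zero_le_two ENNReal.coe_ne_top)
    ENNReal.ofReal_ne_top

theorem IsCutoffSolution.gain (hN : 3 ≤ N) (hS : IsCutoffSolution m ν L x₀ R' a b U G Y F)
    (hν : 0 < ν) (hm : 0 < m) (hm1 : m ≤ 1) (hh : 1 ≤ h) (hc : 0 ≤ c) (hζ : IsCutoff x₀ R D ζ)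
    (hR : R < R') (ha : a < ta) (hab : ta < tb) (hbe : tb < te) (hb : te < b)
    {r h' δ : ℝ} (hζ1 : ∀ x ∈ Metric.closedBall x₀ r, ζ x = 1) (hδ : 0 < δ) (hδ1 : δ < 1)
    (hh' : h ^ m ≤ (1 - δ) * h' ^ m) (h'0 : 0 < h') :
    ENNReal.ofReal (levelLoss N c δ) * ∫⁻ z in Metric.closedBall x₀ r ×ˢ Ioc tb te,
        tailPow (2 * m + m * c + (1 + m + m * c) * (2 / (N : ℝ))) h' (U z) ≤
      gainConst N ν c *
      (ENNReal.ofReal (2 / (tb - ta) + fluxConst ν L c * D ^ 2) *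
        (∫⁻ z in Metric.closedBall x₀ R ×ˢ Icc ta te, tailPow (1 + m + m * c) h (U z)) +
      ENNReal.ofReal (fluxConst ν L c) *
        ∫⁻ z in Metric.closedBall x₀ R ×ˢ Icc ta te,
          ‖F z‖ₑ ^ (2 : ℝ) * tailPow (m * c) h (U z)) ^ (1 + 2 / (N : ℝ)) := by
  set M := (ENNReal.ofReal (2 / (tb - ta) + fluxConst ν L c * D ^ 2) *
        (∫⁻ z in Metric.closedBall x₀ R ×ˢ Icc ta te, tailPow (1 + m + m * c) h (U z)) +
      ENNReal.ofReal (fluxConst ν L c) *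
        ∫⁻ z in Metric.closedBall x₀ R ×ˢ Icc ta te,
          ‖F z‖ₑ ^ (2 : ℝ) * tailPow (m * c) h (U z)) with hM
  have hκ : 0 < h ^ m := by positivity
  have hN' : (0 : ℝ) ≤ 2 / N := by positivity
  set S := Metric.closedBall x₀ r ×ˢ Ioc tb te with hSd
  have hSm : MeasurableSet S := measurableSet_closedBall.prod measurableSet_Ioc
  -- the truncated powers
  let P : ℝ → Vec k → ℝ := fun ℓ y => (‖y‖ ^ m) ^ 2 * trunc ℓ (‖y‖ ^ m) ^ c *
          (‖y‖ * (‖y‖ ^ m * trunc ℓ (‖y‖ ^ m) ^ c)) ^ (2 / (N : ℝ))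
  let f : ℕ → SpaceTime N → ℝ≥0∞ := fun n z => ENNReal.ofReal (levelLoss N c δ) *
    (if h' < ‖U z‖ then ENNReal.ofReal (P ((n : ℝ) + 1) (U z)) else 0)
  have hPm : ∀ ℓ, Measurable (P ℓ) := fun ℓ => by
    have h1 : Measurable fun y : Vec k => ‖y‖ ^ m := measurable_norm.pow_const m
    have h2 : Measurable fun y : Vec k => trunc ℓ (‖y‖ ^ m) ^ c :=
      ((measurable_trunc ℓ).comp h1).pow_const c
    exact ((h1.pow_const 2).mul h2).mul ((measurable_norm.mul (h1.mul h2)).pow_const _)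
  have hfm : ∀ n, AEMeasurable (f n) (volume.restrict S) := fun n => by
    have : Measurable fun y : Vec k => ENNReal.ofReal (levelLoss N c δ) *
        (if h' < ‖y‖ then ENNReal.ofReal (P ((n : ℝ) + 1) y) else 0) :=
      (Measurable.ite (measurableSet_lt measurable_const measurable_norm)
        (hPm _).ennreal_ofReal measurable_const).const_mul _
    exact (this.comp_aemeasurable hS.memLp.1.aemeasurable).restrict
  have hfl : ∀ n, ∫⁻ z in S, f n z ≤ gainConst N ν c * M ^ (1 + 2 / (N : ℝ)) := by
    intro n
    have hℓ : (0 : ℝ) < (n : ℝ) + 1 := by positivity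
    have h1 := hS.parabolic_sobolev hN hν hm hc hκ hℓ hζ hR ha hab hbe hb
    have h2 := hS.energyBound_le (D := D) (R := R) (te := te) hν hm hm1 hh hc hℓ hab
    refine le_trans ?_ (h1.trans (mul_le_mul_right
      (ENNReal.rpow_le_rpow h2 (by positivity)) _))
    refine le_trans (setLIntegral_mono_ae' (g := fun z => ‖ζ z.1 •
      weightMap (c / 2) (h ^ m) ((n : ℝ) + 1) (vpow (U z) m)‖ₑ ^ (2 : ℝ) *
        ENNReal.ofReal (ζ z.1 ^ 2 * weightPrim m c (h ^ m) ((n : ℝ) + 1) ‖U z‖) ^ (2 / (N : ℝ)))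
      hSm (.of_forall fun z hz => ?_))
      (lintegral_mono_set (prod_mono_left (subset_univ _)))
    simp only [f, hζ1 z.1 hz.1, one_smul, one_pow, one_mul]
    split_ifs with hz'
    · refine level_lower_bound hm hm1 hc hκ hℓ hδ hδ1 (hh'.trans ?_)
      have := Real.rpow_le_rpow h'0.le hz'.le hm.le
      exact mul_le_mul_of_nonneg_left this (by linarith)
    · simp
  -- The truncation level `n + 1` tends to infinity. The right-hand side is free of it, so Fatou
  -- yields the higher tail without any prior integrability of that order.
  have hlim : ∀ z, liminf (fun n => f n z) atTop = ENNReal.ofReal (levelLoss N c δ) *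
      tailPow (2 * m + m * c + (1 + m + m * c) * (2 / (N : ℝ))) h' (U z) := by
    intro z
    refine Tendsto.liminf_eq ?_
    refine ENNReal.Tendsto.const_mul ?_ (Or.inr ENNReal.ofReal_ne_top)
    by_cases hz : h' < ‖U z‖
    · have hz0 := h'0.trans hz
      rw [tailPow_of_lt h'0.le hz]
      simp only [if_pos hz]
      refine ENNReal.tendsto_ofReal ?_
      have hT : Tendsto (fun n : ℕ => trunc ((n : ℝ) + 1) (‖U z‖ ^ m) ^ c) atTop
          (𝓝 ((‖U z‖ ^ m) ^ c)) :=
        (tendsto_trunc (Real.rpow_nonneg hz0.le _)).rpow_const (Or.inr hc)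
      have e : ‖U z‖ ^ (2 * m + m * c + (1 + m + m * c) * (2 / (N : ℝ))) =
          (‖U z‖ ^ m) ^ 2 * (‖U z‖ ^ m) ^ c *
            (‖U z‖ * (‖U z‖ ^ m * (‖U z‖ ^ m) ^ c)) ^ (2 / (N : ℝ)) := by
        have e1 : ‖U z‖ * (‖U z‖ ^ m * (‖U z‖ ^ m) ^ c) = ‖U z‖ ^ (1 + m + m * c) := by
          rw [Real.rpow_add hz0, Real.rpow_add hz0, Real.rpow_one, Real.rpow_mul hz0.le]; ring
        rw [e1, ← Real.rpow_mul hz0.le, Real.rpow_add hz0, Real.rpow_add hz0,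
          ← Real.rpow_mul_natCast hz0.le, ← Real.rpow_mul hz0.le]
        push_cast
        rw [mul_comm m 2]
      rw [e]
      exact (tendsto_const_nhds.mul hT).mul ((tendsto_const_nhds.mul
        (tendsto_const_nhds.mul hT)).rpow_const (Or.inr hN'))
    · simp [tailPow, hz]
  have hfatou := lintegral_liminf_le' (u := atTop) hfm
  simp only [hlim] at hfatou
  rw [lintegral_const_mul' _ _ ENNReal.ofReal_ne_top] at hfatou
  refine hfatou.trans ?_
  exact (liminf_le_of_frequently_le' (Frequently.of_forall hfl))

end Gain

end PorousMedium

end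

/-! ### Spatial cutoffs and the estimate between two levels. -/

noncomputable section

namespace PorousMedium

variable {N k : ℕ}

theorem exists_abs_deriv_smoothTransition_le :
    ∃ M : ℝ, 0 < M ∧ ∀ x, |deriv Real.smoothTransition x| ≤ M := by
  have hc : Continuous (deriv Real.smoothTransition) :=
    Real.smoothTransition.contDiff.continuous_deriv (n := 1) le_rfl
  obtain ⟨M, hM⟩ := (isCompact_Icc (a := (0 : ℝ)) (b := 1)).exists_bound_of_continuousOn
    hc.continuousOn
  refine ⟨max M 1, lt_max_of_lt_right one_pos, fun x => ?_⟩
  rcases lt_or_ge x 0 with h | h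
  · have : Real.smoothTransition =ᶠ[𝓝 x] fun _ => 0 := by
      filter_upwards [Iio_mem_nhds h] with y hy
      exact Real.smoothTransition.zero_of_nonpos (le_of_lt hy)
    rw [this.deriv_eq]; simp
  rcases lt_or_ge 1 x with h' | h'
  · have : Real.smoothTransition =ᶠ[𝓝 x] fun _ => 1 := by
      filter_upwards [Ioi_mem_nhds h'] with y hy
      exact Real.smoothTransition.one_of_one_le (le_of_lt hy)
    rw [this.deriv_eq]; simp
  · exact (hM x ⟨h, h'⟩).trans (le_max_left _ _)

/-- A bound for the derivative of `Real.smoothTransition`, times two. -/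
def cutoffConst : ℝ := 2 * exists_abs_deriv_smoothTransition_le.choose

theorem cutoffConst_pos : 0 < cutoffConst :=
  mul_pos two_pos exists_abs_deriv_smoothTransition_le.choose_spec.1

/-- The smooth transition is composed with a quadratic function of `|x - x₀|`, which avoids the
singularity of the norm at the centre. Dividing the slope `2R` by `R² - r² = (R - r)(R + r)` leaves
a multiple of `1/(R - r)`. -/
theorem exists_isCutoff (x₀ : Vec N) {r R : ℝ} (hr : 0 ≤ r) (hR : r < R) :
    ∃ ζ : Vec N → ℝ, IsCutoff x₀ R (cutoffConst / (R - r)) ζ ∧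
      ∀ x ∈ Metric.closedBall x₀ r, ζ x = 1 := by
  have hd : 0 < R ^ 2 - r ^ 2 := by nlinarith
  set M := exists_abs_deriv_smoothTransition_le.choose with hM
  obtain ⟨hM0, hMb⟩ := exists_abs_deriv_smoothTransition_le.choose_spec
  set φ : Vec N → ℝ := fun x => (R ^ 2 - ‖x - x₀‖ ^ 2) / (R ^ 2 - r ^ 2) with hφ
  have hφs : ContDiff ℝ ∞ φ := by
    have h1 : ContDiff ℝ ∞ fun x : Vec N => ‖x - x₀‖ ^ 2 :=
      (contDiff_id.sub contDiff_const).norm_sq ℝ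
    exact (contDiff_const.sub h1).div_const _
  have hs : ContDiff ℝ ∞ fun x => Real.smoothTransition (φ x) :=
    Real.smoothTransition.contDiff.comp hφs
  have hsupp : tsupport (fun x => Real.smoothTransition (φ x)) ⊆ Metric.closedBall x₀ R := by
    refine closure_minimal (fun x hx => ?_) Metric.isClosed_closedBall
    by_contra h
    refine hx (Real.smoothTransition.zero_of_nonpos ?_)
    rw [Metric.mem_closedBall, dist_eq_norm, not_le] at h
    have : R ^ 2 < ‖x - x₀‖ ^ 2 := by nlinarith
    exact div_nonpos_of_nonpos_of_nonneg (by linarith) hd.le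
  refine ⟨fun x => Real.smoothTransition (φ x), ⟨hs, fun x => Real.smoothTransition.nonneg _,
    fun x => Real.smoothTransition.le_one _, hsupp, fun x => ?_⟩, fun x hx => ?_⟩
  · by_cases hx : x ∈ Metric.closedBall x₀ R
    · have hdφ : HasFDerivAt φ ((R ^ 2 - r ^ 2)⁻¹ • (-((2 : ℕ) • (innerSL ℝ (x - x₀)))) : Vec N →L[ℝ] ℝ) x := by
        have h1 : HasFDerivAt (fun x : Vec N => ‖x - x₀‖ ^ 2) ((2 : ℕ) • (innerSL ℝ (x - x₀)) : Vec N →L[ℝ] ℝ) x := by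
          have := ((hasFDerivAt_id x).sub_const x₀).norm_sq
          simpa using this
        have h2 := (h1.const_sub (R ^ 2)).const_mul (R ^ 2 - r ^ 2)⁻¹
        refine h2.congr_of_eventuallyEq (.of_forall fun y => ?_)
        simp only [hφ]; rw [div_eq_inv_mul]
      have hdt : HasDerivAt Real.smoothTransition (deriv Real.smoothTransition (φ x)) (φ x) :=
        ((Real.smoothTransition.contDiff (n := 1)).differentiable (by simp) _).hasDerivAt
      have h3 : HasFDerivAt (fun x => Real.smoothTransition (φ x)) _ x := hdt.comp_hasFDerivAt x hdφ
      rw [h3.fderiv, norm_smul, norm_smul, norm_neg]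
      have h4 : ‖(2 : ℕ) • innerSL ℝ (x - x₀)‖ ≤ 2 * R := by
        rw [Metric.mem_closedBall, dist_eq_norm] at hx
        refine (norm_nsmul_le).trans ?_
        rw [innerSL_apply_norm]
        push_cast
        linarith
      have h5 : ‖(R ^ 2 - r ^ 2)⁻¹‖ = (R ^ 2 - r ^ 2)⁻¹ := Real.norm_of_nonneg (by positivity)
      have hRr : 0 < R - r := by linarith
      calc _ ≤ M * ((R ^ 2 - r ^ 2)⁻¹ * (2 * R)) := by
            rw [h5]
            have := hMb (φ x)
            rw [← Real.norm_eq_abs] at this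
            gcongr
        _ ≤ cutoffConst / (R - r) := by
            have e : R ^ 2 - r ^ 2 = (R - r) * (R + r) := by ring
            have hRp : 0 < R + r := by linarith
            rw [e, cutoffConst, ← hM, le_div_iff₀ hRr]
            have h6 : (R + r)⁻¹ * R ≤ 1 := by
              rw [inv_mul_le_iff₀ hRp]; linarith
            calc M * (((R - r) * (R + r))⁻¹ * (2 * R)) * (R - r) =
                2 * M * ((R + r)⁻¹ * R) := by field_simp
              _ ≤ 2 * M := mul_le_of_le_one_right (by positivity) h6
    · rw [fderiv_of_notMem_tsupport (𝕜 := ℝ) fun h => hx (hsupp h), norm_zero]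
      exact div_nonneg cutoffConst_pos.le (by linarith)
  · refine Real.smoothTransition.one_of_one_le ?_
    rw [Metric.mem_closedBall, dist_eq_norm] at hx
    rw [hφ, le_div_iff₀ hd]
    have : ‖x - x₀‖ ^ 2 ≤ r ^ 2 := pow_le_pow_left₀ (norm_nonneg _) hx 2
    linarith

section Step

variable {m ν L c h : ℝ} {x₀ : Vec N} {R R' a b ta tb te : ℝ} {U : SpaceTime N → Vec k}
  {G Y F : SpaceTime N → GradVec N k}

/-- Above level `h` the power `q` can be raised to `s(1 - 1/p)`, and Hölder with exponent `p` then
isolates the norm of the force. -/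
theorem lintegral_force_le {μ : Measure (SpaceTime N)} (hF : AEMeasurable (fun z => ‖F z‖ₑ) μ)
    (hU : AEMeasurable U μ) {p s q : ℝ} (hp : 1 < p) (hh : 0 < h) (hq : q ≤ s * (1 - 1 / p)) :
    ∫⁻ z, ‖F z‖ₑ ^ (2 : ℝ) * tailPow q h (U z) ∂μ ≤ ENNReal.ofReal (h ^ (q - s * (1 - 1 / p))) *
      ((∫⁻ z, ‖F z‖ₑ ^ (2 * p) ∂μ) ^ (1 / p) * (∫⁻ z, tailPow s h (U z) ∂μ) ^ (1 - 1 / p)) := by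
  have hp0 : 0 < p := by linarith
  have h1 : 0 ≤ 1 - 1 / p := by
    have : 1 / p ≤ 1 := by rw [div_le_one hp0]; exact hp.le
    linarith
  have hU' : AEMeasurable (fun z => tailPow s h (U z)) μ :=
    (measurable_tailPow s h).comp_aemeasurable hU
  refine le_trans ?_ (mul_le_mul_right (ENNReal.lintegral_mul_norm_pow_le (hF.pow_const (2 * p)) hU'
    (by positivity : 0 ≤ 1 / p) h1 (by ring)) _)
  rw [← lintegral_const_mul' _ _ ENNReal.ofReal_ne_top]
  refine lintegral_mono fun z => ?_
  have e : (‖F z‖ₑ ^ (2 * p)) ^ (1 / p) = ‖F z‖ₑ ^ (2 : ℝ) := by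
    rw [← ENNReal.rpow_mul]; congr 1; field_simp
  simp only [e]
  calc _ ≤ ‖F z‖ₑ ^ (2 : ℝ) *
        (ENNReal.ofReal (h ^ (q - s * (1 - 1 / p))) * tailPow s h (U z) ^ (1 - 1 / p)) := by
        gcongr
        exact tailPow_le_mul_rpow hh hq _
    _ = _ := by ring

/-- The gained power `m - 1 + 2s/N ≥ 0` of `|U|` is traded for the same power of the level, which
closes the recursion on tails of order `s`. All level factors are estimated at the base level `h₀`,
using the signs of the two exponents. -/
theorem IsCutoffSolution.level_step (hN : 3 ≤ N) (hS : IsCutoffSolution m ν L x₀ R' a b U G Y F)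
    (hν : 0 < ν) (hm : 0 < m) (hm1 : m ≤ 1) (hc : 0 ≤ c) (hR : R < R') (ha : a < ta)
    (hab : ta < tb) (hbe : tb < te) (hb : te < b) {r h₀ h' δ p : ℝ} (hr : 0 ≤ r) (hrR : r < R)
    (hδ : 0 < δ) (hδ1 : δ < 1) (hh₀ : 1 ≤ h₀) (hh : h₀ ≤ h) (hhh : h < h')
    (hh' : h ^ m ≤ (1 - δ) * h' ^ m) (hp : 1 < p)
    (hq : m * c ≤ (1 + m + m * c) * (1 - 1 / p))
    (he : 1 + m + m * c ≤ 2 * m + m * c + (1 + m + m * c) * (2 / (N : ℝ))) :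
    ENNReal.ofReal (levelLoss N c δ) *
        (ENNReal.ofReal (h₀ ^ (m - 1 + (1 + m + m * c) * (2 / (N : ℝ)))) *
          ∫⁻ z in Metric.closedBall x₀ r ×ˢ Icc tb te, tailPow (1 + m + m * c) h' (U z)) ≤
      gainConst N ν c *
      (ENNReal.ofReal (4 / (tb - ta) + fluxConst ν L c * (cutoffConst / (R - r)) ^ 2) *
        (∫⁻ z in Metric.closedBall x₀ R ×ˢ Icc ta te, tailPow (1 + m + m * c) h (U z)) +
      ENNReal.ofReal (fluxConst ν L c) *
        (ENNReal.ofReal (h₀ ^ (m * c - (1 + m + m * c) * (1 - 1 / p))) *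
          ((∫⁻ z in Metric.closedBall x₀ R ×ˢ Icc ta te, ‖F z‖ₑ ^ (2 * p)) ^ (1 / p) *
          (∫⁻ z in Metric.closedBall x₀ R ×ˢ Icc ta te, tailPow (1 + m + m * c) h (U z))
            ^ (1 - 1 / p)))) ^ (1 + 2 / (N : ℝ)) := by
  obtain ⟨ζ, hζ, hζ1⟩ := exists_isCutoff x₀ hr hrR
  set s := 1 + m + m * c with hs
  -- The gain holds on the half-open interval `(tm, te]`, so an intermediate time is inserted to
  -- cover the closed interval from `tb`. It turns the slope `2/(tb - ta)` into `4/(tb - ta)`.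
  set tm := (ta + tb) / 2 with htm
  have h'1 : 0 < h' := by linarith
  have hg := hS.gain hN hν hm hm1 (by linarith : 1 ≤ h) hc hζ hR ha (by linarith : ta < tm)
    (by linarith : tm < te) hb hζ1 hδ hδ1 hh' h'1
  have e1 : 2 / (tm - ta) = 4 / (tb - ta) := by
    have : tm - ta = (tb - ta) / 2 := by rw [htm]; ring
    rw [this]
    have : tb - ta ≠ 0 := by linarith
    field_simp; norm_num
  rw [e1] at hg
  set K := Metric.closedBall x₀ R ×ˢ Icc ta te
  have hf := lintegral_force_le (F := F) (U := U) (μ := volume.restrict K) (s := s)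
    (h := h) hS.memLp_force.1.enorm.restrict hS.memLp.1.aemeasurable.restrict hp (by linarith) hq
  have hf' : ENNReal.ofReal (h ^ (m * c - s * (1 - 1 / p))) ≤
      ENNReal.ofReal (h₀ ^ (m * c - s * (1 - 1 / p))) :=
    ENNReal.ofReal_le_ofReal (Real.rpow_le_rpow_of_nonpos (by linarith) hh (by linarith))
  refine le_trans ?_ (hg.trans ?_)
  · gcongr
    rw [← lintegral_const_mul' _ _ ENNReal.ofReal_ne_top]
    refine le_trans (lintegral_mono fun z => ?_)
      (lintegral_mono_set (prod_mono_right fun t ht => ⟨by linarith [ht.1], ht.2⟩))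
    have h1 := tailPow_le_mul h'1 he (U z)
    have h2 : ENNReal.ofReal (h₀ ^ (m - 1 + s * (2 / (N : ℝ)))) ≤
        ENNReal.ofReal (h' ^ (m - 1 + s * (2 / (N : ℝ)))) :=
      ENNReal.ofReal_le_ofReal (Real.rpow_le_rpow (by linarith) (by linarith) (by linarith))
    refine (mul_le_mul_left h2 _).trans ?_
    set e' := 2 * m + m * c + s * (2 / (N : ℝ)) with he'
    have e3 : m - 1 + s * (2 / (N : ℝ)) = -(s - e') := by rw [he', hs]; ring
    have h'p : 0 < h' ^ (s - e') := Real.rpow_pos_of_pos h'1 _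
    rw [e3, Real.rpow_neg h'1.le]
    refine (mul_le_mul_right h1 _).trans_eq ?_
    rw [← mul_assoc, ← ENNReal.ofReal_mul (by positivity), inv_mul_cancel₀ h'p.ne',
      ENNReal.ofReal_one, one_mul]
  · gcongr
    refine hf.trans ?_
    gcongr

end Step

end PorousMedium

end

/-! ### Scalar recursion: scaling and fast convergence. -/

noncomputable section

namespace PorousMedium

variable {N k : ℕ}

section Iteration

/-- The weight `σ = ρ^(-(n+2)) h^(-λ/2) Λ`, with `λ = n(m-1) + 2s`, removes radius, level and force
from the recursion. Both summands of the step are bounded by the common factor `S`, times `X` and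
`X^θ`, and `S^(1+2/n)` is exactly `h^(λ/n)/σ`. -/
theorem normalized_step {n m p s ρ h y y' Φ K : ℝ} (hn : 0 < n) (hm : 0 < m) (hm1 : m < 1)
    (hp : (n + 2) / 2 < p) (hρ : 0 < ρ) (hh : 1 ≤ h) (hy : 0 ≤ y) (hΦ : 0 ≤ Φ)
    (hstep : h ^ ((n * (m - 1) + 2 * s) / n) * y' ≤
      K * (ρ ^ (-2 : ℝ) * y + h ^ (s / p - 1 - m) * (Φ * y ^ (1 - 1 / p))) ^ (1 + 2 / n)) (hK : 0 ≤ K)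
    {f Λ : ℝ} (hf : f = ρ ^ (2 - (n + 2) / p) * Φ)
    (hΛ : Λ = 1 + f ^ (p * (n + 2) / (2 * p - (n + 2)))) :
    ρ ^ (-(n + 2)) * h ^ (-((n * (m - 1) + 2 * s) / 2)) * Λ * y' ≤
      K * ((ρ ^ (-(n + 2)) * h ^ (-((n * (m - 1) + 2 * s) / 2)) * Λ * y) +
        (ρ ^ (-(n + 2)) * h ^ (-((n * (m - 1) + 2 * s) / 2)) * Λ * y) ^ (1 - 1 / p)) ^
          (1 + 2 / n) := by
  have hp0 : 0 < p := by linarith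
  have hp1 : 1 < p := by linarith
  have h0 : 0 < h := by linarith
  have hd : 0 < 2 * p - (n + 2) := by linarith
  have hθ0 : 0 ≤ 1 - 1 / p := by
    have : 1 / p ≤ 1 := by rw [div_le_one hp0]; exact hp1.le
    linarith
  set lam := n * (m - 1) + 2 * s with hlam
  set θ := 1 - 1 / p with hθ
  have hf0 : 0 ≤ f := by rw [hf]; positivity
  have hΛ1 : 1 ≤ Λ := by rw [hΛ]; linarith [Real.rpow_nonneg hf0 (p * (n + 2) / (2 * p - (n + 2)))]
  have hΛ0 : 0 < Λ := by linarith
  set σ := ρ ^ (-(n + 2)) * h ^ (-(lam / 2)) * Λ with hσ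
  have hσ0 : 0 < σ := by positivity
  set X := σ * y with hX
  have hX0 : 0 ≤ X := by positivity
  -- the two contributions
  set S := ρ ^ n * h ^ (lam / 2) * Λ ^ (-(n / (n + 2))) with hS
  have hS0 : 0 < S := by positivity
  have hyX : y = ρ ^ (n + 2) * h ^ (lam / 2) * Λ⁻¹ * X := by
    rw [hX, hσ, Real.rpow_neg hρ.le, Real.rpow_neg h0.le]
    have : 0 < ρ ^ (n + 2) := by positivity
    have : 0 < h ^ (lam / 2) := by positivity
    field_simp
  have t1 : ρ ^ (-2 : ℝ) * y ≤ S * X := by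
    have e1 : ρ ^ (-2 : ℝ) * ρ ^ (n + 2) = ρ ^ n := by
      rw [← Real.rpow_add hρ]; congr 1; ring
    have e2 : Λ⁻¹ ≤ Λ ^ (-(n / (n + 2))) := by
      rw [← Real.rpow_neg_one]
      refine Real.rpow_le_rpow_of_exponent_le hΛ1 (neg_le_neg ?_)
      rw [div_le_one (by positivity)]; linarith
    calc ρ ^ (-2 : ℝ) * y = (ρ ^ (-2 : ℝ) * ρ ^ (n + 2)) * h ^ (lam / 2) * Λ⁻¹ * X := by
          rw [hyX]; ring
      _ ≤ S * X := by rw [e1, hS]; gcongr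
  have t2 : h ^ (s / p - 1 - m) * (Φ * y ^ θ) ≤ S * X ^ θ := by
    have eΦ : Φ = ρ ^ (-(2 - (n + 2) / p)) * f := by
      rw [hf, ← mul_assoc, ← Real.rpow_add hρ, neg_add_cancel, Real.rpow_zero, one_mul]
    have ey : y ^ θ = ρ ^ ((n + 2) * θ) * h ^ (lam / 2 * θ) * Λ ^ (-θ) * X ^ θ := by
      rw [hyX, Real.mul_rpow (by positivity) hX0, Real.mul_rpow (by positivity) (by positivity),
        Real.mul_rpow (by positivity) (by positivity), ← Real.rpow_mul hρ.le, ← Real.rpow_mul h0.le,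
        Real.inv_rpow hΛ0.le, Real.rpow_neg hΛ0.le]
    have eρ : ρ ^ (-(2 - (n + 2) / p)) * ρ ^ ((n + 2) * θ) = ρ ^ n := by
      rw [← Real.rpow_add hρ]; congr 1; rw [hθ]; ring
    -- The exponents differ by `n(1-m)/(2p) - 1 - m`, which is negative since `n < 2p`; this is
    -- where `h ≥ 1` is needed.
    have eh : h ^ (s / p - 1 - m) * h ^ (lam / 2 * θ) ≤ h ^ (lam / 2) := by
      rw [← Real.rpow_add h0]
      refine Real.rpow_le_rpow_of_exponent_le hh ?_
      have e3 : s / p - 1 - m + lam / 2 * θ = lam / 2 + (n * (1 - m) / (2 * p) - 1 - m) := by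
        rw [hθ, hlam]; field_simp; ring
      have e4 : n * (1 - m) / (2 * p) ≤ 1 := by
        rw [div_le_one (by positivity)]; nlinarith
      linarith
    -- The power of `f` in `Λ` is the reciprocal of `θ - n/(n+2) = (2p - (n+2))/(p(n+2))`, which
    -- makes this inequality hold.
    have eΛ : f * Λ ^ (-θ) ≤ Λ ^ (-(n / (n + 2))) := by
      have e5 : -(n / (n + 2)) = (2 * p - (n + 2)) / (p * (n + 2)) + -θ := by
        rw [hθ]; field_simp; ring
      rw [e5, Real.rpow_add hΛ0]
      refine mul_le_mul_of_nonneg_right ?_ (by positivity)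
      have e6 : f = (f ^ (p * (n + 2) / (2 * p - (n + 2)))) ^
          ((2 * p - (n + 2)) / (p * (n + 2))) := by
        rw [← Real.rpow_mul hf0]
        have : p * (n + 2) / (2 * p - (n + 2)) * ((2 * p - (n + 2)) / (p * (n + 2))) = 1 := by
          rw [div_mul_div_comm, mul_comm (p * (n + 2)), div_self (by positivity)]
        rw [this, Real.rpow_one]
      refine e6.le.trans (Real.rpow_le_rpow (by positivity) ?_ (by positivity))
      rw [hΛ]; linarith
    calc h ^ (s / p - 1 - m) * (Φ * y ^ θ) = (ρ ^ (-(2 - (n + 2) / p)) * ρ ^ ((n + 2) * θ)) *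
          (h ^ (s / p - 1 - m) * h ^ (lam / 2 * θ)) * (f * Λ ^ (-θ)) * X ^ θ := by
          rw [ey]; nth_rewrite 1 [eΦ]; ring
      _ ≤ S * X ^ θ := by rw [eρ, hS]; gcongr
  have hsum0 : 0 ≤ X + X ^ θ := by positivity
  have t3 : (ρ ^ (-2 : ℝ) * y + h ^ (s / p - 1 - m) * (Φ * y ^ θ)) ^ (1 + 2 / n) ≤
      ρ ^ (n + 2) * (h ^ (lam / 2) * h ^ (lam / n)) * Λ⁻¹ * (X + X ^ θ) ^ (1 + 2 / n) := by
    have e7 : (ρ ^ (-2 : ℝ) * y + h ^ (s / p - 1 - m) * (Φ * y ^ θ)) ≤ S * (X + X ^ θ) := by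
      rw [mul_add]; exact add_le_add t1 t2
    refine (Real.rpow_le_rpow (by positivity) e7 (by positivity)).trans_eq ?_
    have e8 : n * (1 + 2 / n) = n + 2 := by field_simp
    have e9 : lam / 2 * (1 + 2 / n) = lam / 2 + lam / n := by field_simp
    have e10 : -(n / (n + 2)) * (1 + 2 / n) = -1 := by field_simp
    rw [Real.mul_rpow hS0.le hsum0, hS, Real.mul_rpow (by positivity) (by positivity),
      Real.mul_rpow (by positivity) (by positivity), ← Real.rpow_mul hρ.le, ← Real.rpow_mul h0.le,
      ← Real.rpow_mul hΛ0.le, ← Real.rpow_add h0, ← Real.rpow_neg_one Λ, e8, e9, e10]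
  have hhl : 0 < h ^ (lam / n) := by positivity
  have t4 : h ^ (lam / n) * y' ≤ h ^ (lam / n) *
      (K * (ρ ^ (n + 2) * h ^ (lam / 2) * Λ⁻¹ * (X + X ^ θ) ^ (1 + 2 / n))) := by
    refine (hstep.trans (mul_le_mul_of_nonneg_left t3 hK)).trans_eq (by ring)
  have t5 := mul_le_mul_of_nonneg_left (le_of_mul_le_mul_left t4 hhl) hσ0.le
  refine t5.trans_eq ?_
  rw [hσ, Real.rpow_neg hρ.le, Real.rpow_neg h0.le]
  have : 0 < ρ ^ (n + 2) := by positivity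
  have : 0 < h ^ (lam / 2) := by positivity
  field_simp

/-- For `X ≤ 1` the term `X^θ` dominates, so the recursion has the superlinear power `θγ = 1 + δ`.
Geometric decay `X_j ≤ ε d^j` then propagates by induction. -/
theorem exists_smallness {K b θ γ : ℝ} (hK : 0 < K) (hb : 1 < b) (hθ : 0 < θ) (hθ1 : θ ≤ 1)
    (hγ : 0 < γ) (hθγ : 1 < θ * γ) :
    ∃ ε : ℝ, 0 < ε ∧ ∀ X : ℕ → ℝ, (∀ j, 0 ≤ X j) → X 0 ≤ ε →
      (∀ j, X (j + 1) ≤ K * b ^ j * (X j + X j ^ θ) ^ γ) → Tendsto X atTop (𝓝 0) := by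
  set δ := θ * γ - 1 with hδ
  have hδ0 : 0 < δ := by linarith
  have hb0 : 0 < b := by linarith
  -- This rate satisfies `b d^δ = 1`, so the growth `b^j` is cancelled exactly by the surplus power.
  set d := b ^ (-(1 / δ)) with hd
  have hd0 : 0 < d := by positivity
  have hd1 : d < 1 := Real.rpow_lt_one_of_one_lt_of_neg hb (by
    have : 0 < 1 / δ := by positivity
    linarith)
  have hbd : b * d ^ δ = 1 := by
    rw [hd, ← Real.rpow_mul hb0.le]
    have : -(1 / δ) * δ = -1 := by field_simp
    rw [this, Real.rpow_neg_one]
    field_simp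
  set K' := K * 2 ^ γ with hK'
  have hK'0 : 0 < K' := by positivity
  set ε := min 1 ((d / K') ^ (1 / δ)) with hε
  have hε0 : 0 < ε := lt_min one_pos (by positivity)
  have hε1 : ε ≤ 1 := min_le_left _ _
  have hεK : K' * ε ^ δ ≤ d := by
    have h1 : ε ^ δ ≤ ((d / K') ^ (1 / δ)) ^ δ :=
      Real.rpow_le_rpow hε0.le (min_le_right _ _) hδ0.le
    rw [← Real.rpow_mul (by positivity)] at h1
    have : 1 / δ * δ = 1 := by field_simp
    rw [this, Real.rpow_one, le_div_iff₀ hK'0] at h1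
    linarith
  refine ⟨ε, hε0, fun X hX h0 hstep => ?_⟩
  have key : ∀ j, X j ≤ ε * d ^ j := by
    intro j
    induction j with
    | zero => simpa using h0
    | succ j ih =>
      have hdj : d ^ j ≤ 1 := pow_le_one₀ hd0.le hd1.le
      have hXj1 : X j ≤ 1 := ih.trans (mul_le_one₀ hε1 (by positivity) hdj)
      have h1 : X j ≤ X j ^ θ := by
        have := Real.rpow_le_rpow_of_exponent_ge' (hX j) hXj1 hθ.le hθ1
        simpa using this
      have h2 : (X j + X j ^ θ) ^ γ ≤ 2 ^ γ * X j ^ (θ * γ) := by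
        have h3 : X j + X j ^ θ ≤ 2 * X j ^ θ := by linarith
        have hXθ : 0 ≤ X j ^ θ := Real.rpow_nonneg (hX j) _
        refine (Real.rpow_le_rpow (add_nonneg (hX j) hXθ) h3 hγ.le).trans_eq ?_
        rw [Real.mul_rpow zero_le_two hXθ, ← Real.rpow_mul (hX j)]
      have h4 : X j ^ (θ * γ) ≤ (ε * d ^ j) * (ε ^ δ * (d ^ δ) ^ j) := by
        refine (Real.rpow_le_rpow (hX j) ih (by positivity)).trans_eq ?_
        have e1 : θ * γ = 1 + δ := by rw [hδ]; ring
        have hpos : 0 < ε * d ^ j := by positivity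
        rw [e1, Real.rpow_add hpos, Real.rpow_one, Real.mul_rpow hε0.le (by positivity),
          ← Real.rpow_natCast d j, ← Real.rpow_mul hd0.le, ← Real.rpow_natCast (d ^ δ) j,
          ← Real.rpow_mul hd0.le, mul_comm (j : ℝ) δ]
      calc X (j + 1) ≤ K * b ^ j * (2 ^ γ * ((ε * d ^ j) * (ε ^ δ * (d ^ δ) ^ j))) := by
            refine (hstep j).trans ?_
            have := h2.trans (mul_le_mul_of_nonneg_left h4 (by positivity))
            gcongr
        _ = (ε * d ^ j) * (K' * ε ^ δ) * (b * d ^ δ) ^ j := by rw [mul_pow, hK']; ring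
        _ ≤ (ε * d ^ j) * d := by
            rw [hbd, one_pow, mul_one]; gcongr
        _ = ε * d ^ (j + 1) := by ring
  refine squeeze_zero hX key ?_
  have := (tendsto_pow_atTop_nhds_zero_of_lt_one hd0.le hd1).const_mul ε
  simpa using this

/-- The base of the power `2/N ≤ 1` is at most one, so dropping the power only decreases it. -/
theorem levelLoss_ge (hN : 3 ≤ N) {c δ : ℝ} (hc : 0 ≤ c) (hδ : 0 < δ) (hδ1 : δ ≤ 1) :
    δ ^ 7 * ((1 / 2) ^ (c + 1) / 8) ≤ levelLoss N c δ := by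
  have hN' : (3 : ℝ) ≤ N := by exact_mod_cast hN
  have h2 : ((1 : ℝ) / 2) ^ (c + 1) ≤ 1 :=
    Real.rpow_le_one (by norm_num) (by norm_num) (by linarith)
  have h3 : (δ / 2) ^ 3 ≤ 1 := pow_le_one₀ (by linarith) (by linarith)
  have h1 : (δ / 2) ^ 3 * (1 / 2) ^ (c + 1) ≤ ((δ / 2) ^ 3 * (1 / 2) ^ (c + 1)) ^ (2 / (N : ℝ)) := by
    have h4 : (δ / 2) ^ 3 * (1 / 2) ^ (c + 1) ≤ 1 := mul_le_one₀ h3 (by positivity) h2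
    have := Real.rpow_le_rpow_of_exponent_ge (x := (δ / 2) ^ 3 * (1 / 2) ^ (c + 1))
      (y := 1) (z := 2 / (N : ℝ)) (by positivity) h4 (by rw [div_le_one (by linarith)]; linarith)
    simpa using this
  unfold levelLoss
  have := mul_le_mul_of_nonneg_left h1 (by positivity : 0 ≤ δ ^ 4)
  refine le_trans (le_of_eq ?_) this
  ring

/-- With `x = 2^(-j)`, one has `2 - x ≤ (1 - x/4)(2 - x/2)`, and Bernoulli's inequality for the
exponent `m ≤ 1` converts the factor to `1 - mx/4`. -/
theorem level_ratio {m : ℝ} (hm : 0 < m) (hm1 : m ≤ 1) {h : ℝ} (hh : 0 < h) (j : ℕ) :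
    (h * (2 - (1 / 2) ^ j)) ^ m ≤
      (1 - m * (1 / 2) ^ j / 4) * (h * (2 - (1 / 2) ^ (j + 1))) ^ m := by
  set x : ℝ := (1 / 2) ^ j with hx
  have hx0 : 0 < x := by positivity
  have hx1 : x ≤ 1 := pow_le_one₀ (by norm_num) (by norm_num)
  have e : ((1 : ℝ) / 2) ^ (j + 1) = x / 2 := by rw [pow_succ]; ring
  rw [e]
  have h1 : h * (2 - x) ≤ (1 - x / 4) * (h * (2 - x / 2)) := by
    have : (2 - x) ≤ (1 - x / 4) * (2 - x / 2) := by nlinarith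
    have := mul_le_mul_of_nonneg_left this hh.le
    linarith
  have h2 : 0 ≤ h * (2 - x) := mul_nonneg hh.le (by linarith)
  refine (Real.rpow_le_rpow h2 h1 hm.le).trans ?_
  rw [Real.mul_rpow (by linarith) (mul_nonneg hh.le (by linarith))]
  refine mul_le_mul_of_nonneg_right ?_ (Real.rpow_nonneg (mul_nonneg hh.le (by linarith)) _)
  have := rpow_one_add_le_one_add_mul_self (s := -(x / 4)) (by linarith) hm.le hm1
  have e2 : 1 + -(x / 4) = 1 - x / 4 := by ring
  rw [e2] at this
  linarith

end Iteration

end PorousMedium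

end

/-! ### The De Giorgi iteration. -/

noncomputable section

namespace PorousMedium

variable {N k : ℕ}

theorem tailPow_anti {s h h' : ℝ} (hh : h ≤ h') (y : Vec k) : tailPow s h' y ≤ tailPow s h y := by
  unfold tailPow
  split_ifs with h1 h2
  · exact le_rfl
  · exact absurd (hh.trans_lt h1) h2
  · exact zero_le
  · exact le_rfl

/-- The `j`-dependent losses are collected: the cylinder gap costs `4^j`, hence at most `16^j` after
the power `γ ≤ 2`, and the level gap costs `128^j`. Their product is `2048^j`. -/
theorem real_step {LL C₁ C₃ B fc Gr γ A P Y h y' Z : ℝ} {j : ℕ} (hC₁ : 0 < C₁) (hG : 0 ≤ Gr)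
    (hγ0 : 0 ≤ γ) (hγ : γ ≤ 2) (hC₃ : 0 ≤ C₃) (hB : B ≤ C₃ * 4 ^ j * P) (hB0 : 0 ≤ B) (hfc : fc ≤ C₃)
    (hfc0 : 0 ≤ fc) (hLL : C₁ * (1 / 128) ^ j ≤ LL) (hY : 0 ≤ Y) (hZ : 0 ≤ Z) (hP : 0 ≤ P)
    (hh : 0 ≤ h ^ A) (hy' : 0 ≤ y') (hstep : LL * (h ^ A * y') ≤ Gr * (B * Y + fc * Z) ^ γ) :
    h ^ A * y' ≤ (Gr * C₃ ^ γ / C₁ + 1) * 2048 ^ j * (P * Y + Z) ^ γ := by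
  have h4 : (1 : ℝ) ≤ 4 ^ j := one_le_pow₀ (by norm_num)
  have h1 : B * Y + fc * Z ≤ (C₃ * 4 ^ j) * (P * Y + Z) := by
    have e1 := mul_le_mul_of_nonneg_right hB hY
    have e2 : fc ≤ C₃ * 4 ^ j := hfc.trans (le_mul_of_one_le_right hC₃ h4)
    have e3 := mul_le_mul_of_nonneg_right e2 hZ
    linarith
  have hS : 0 ≤ P * Y + Z := by positivity
  have h2 : (B * Y + fc * Z) ^ γ ≤ C₃ ^ γ * 16 ^ j * (P * Y + Z) ^ γ := by
    refine (Real.rpow_le_rpow (by positivity) h1 hγ0).trans ?_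
    rw [Real.mul_rpow (by positivity) hS, Real.mul_rpow hC₃ (by positivity)]
    have h3 : ((4 : ℝ) ^ j) ^ γ ≤ 16 ^ j := by
      have := Real.rpow_le_rpow_of_exponent_le h4 hγ
      rw [Real.rpow_two, ← pow_mul, mul_comm j 2, pow_mul] at this
      norm_num at this
      exact this
    gcongr
  have h3 : C₁ * (1 / 128) ^ j * (h ^ A * y') ≤ Gr * (C₃ ^ γ * 16 ^ j * (P * Y + Z) ^ γ) :=
    (mul_le_mul_of_nonneg_right hLL (mul_nonneg hh hy')).trans
      (hstep.trans (mul_le_mul_of_nonneg_left h2 hG))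
  have e128 : ((1 : ℝ) / 128) ^ j * 128 ^ j = 1 := by rw [← mul_pow]; norm_num
  have e2048 : (16 : ℝ) ^ j * 128 ^ j = 2048 ^ j := by rw [← mul_pow]; norm_num
  have h5 := mul_le_mul_of_nonneg_right h3 (by positivity : 0 ≤ (128 : ℝ) ^ j / C₁)
  have e5 : C₁ * (1 / 128) ^ j * (h ^ A * y') * (128 ^ j / C₁) = h ^ A * y' := by
    calc _ = ((1 / 128) ^ j * 128 ^ j) * (h ^ A * y') * (C₁ / C₁) := by ring
      _ = _ := by rw [e128, div_self hC₁.ne']; ring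
  have e6 : Gr * (C₃ ^ γ * 16 ^ j * (P * Y + Z) ^ γ) * (128 ^ j / C₁) =
      Gr * C₃ ^ γ / C₁ * 2048 ^ j * (P * Y + Z) ^ γ := by
    rw [← e2048]; ring
  rw [e5, e6] at h5
  refine h5.trans ?_
  have : 0 ≤ (2048 : ℝ) ^ j * (P * Y + Z) ^ γ := by positivity
  linarith

/-- The radii differ by `ρx/8`, and so do their squares up to the factor `R + r ≥ ρ`; with `x ≤ 1`,
both cutoff errors are of order `1/(ρx)²`. -/
theorem gap_bound {ρ fc M x r R : ℝ} (hρ : 0 < ρ) (hx : 0 < x) (hx1 : x ≤ 1)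
    (hR : R = ρ * (1 / 2 + x / 4)) (hr : r = ρ * (1 / 2 + x / 8)) :
    4 / (R ^ 2 - r ^ 2) + fc * (M / (R - r)) ^ 2 ≤
      (32 + 64 * fc * M ^ 2) * (1 / x ^ 2) * ρ ^ (-2 : ℝ) := by
  have e0 : R - r = ρ * x / 8 := by rw [hR, hr]; ring
  have e1 : R ^ 2 - r ^ 2 = ρ * x / 8 * (R + r) := by rw [← e0]; ring
  have h1 : ρ ≤ R + r := by rw [hR, hr]; nlinarith [mul_pos hρ hx]
  have e2 : ρ ^ (-2 : ℝ) = 1 / ρ ^ 2 := by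
    rw [Real.rpow_neg hρ.le, Real.rpow_two, one_div]
  have h2 : 4 / (R ^ 2 - r ^ 2) ≤ 32 * (1 / x ^ 2) * (1 / ρ ^ 2) := by
    rw [e1]
    have : ρ ^ 2 * x ^ 2 / 8 ≤ ρ * x / 8 * (R + r) := by
      have h3 : ρ * x / 8 * (ρ * x) ≤ ρ * x / 8 * (R + r) := by
        refine mul_le_mul_of_nonneg_left ?_ (by positivity)
        exact (mul_le_of_le_one_right hρ.le hx1).trans h1
      calc _ = ρ * x / 8 * (ρ * x) := by ring
        _ ≤ _ := h3
    calc 4 / (ρ * x / 8 * (R + r)) ≤ 4 / (ρ ^ 2 * x ^ 2 / 8) := by gcongr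
      _ = _ := by field_simp; norm_num
  have h3 : fc * (M / (R - r)) ^ 2 = 64 * fc * M ^ 2 * (1 / x ^ 2) * (1 / ρ ^ 2) := by
    rw [e0]; field_simp; norm_num
  rw [h3, e2]
  calc _ ≤ 32 * (1 / x ^ 2) * (1 / ρ ^ 2) + 64 * fc * M ^ 2 * (1 / x ^ 2) * (1 / ρ ^ 2) := by gcongr
    _ = _ := by ring

set_option maxHeartbeats 1000000 in
/-- Local boundedness of truncated solutions with small normalized energy. -/
theorem exists_smallness_bound (hN : 3 ≤ N) {m ν L p c : ℝ} (hν : 0 < ν) (hm : 0 < m) (hm1 : m < 1)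
    (hp : ((N : ℝ) + 2) / 2 < p) (hc : 0 ≤ c) (hcp : 1 + m + m * c ≤ (1 + m) * p)
    (hlam : 0 ≤ (N : ℝ) * (m - 1) + 2 * (1 + m + m * c)) :
    ∃ ε : ℝ, 0 < ε ∧ ∀ (k : ℕ) (x₀ : Vec N) (R' a b : ℝ) (U : SpaceTime N → Vec k)
      (G Y F : SpaceTime N → GradVec N k), IsCutoffSolution m ν L x₀ R' a b U G Y F →
      ∀ ρ te h : ℝ, 0 < ρ → 1 ≤ h → 3 / 4 * ρ < R' → a < te - (3 / 4 * ρ) ^ 2 → te < b →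
      ∀ I J : ℝ, 0 ≤ J →
      ∫⁻ z in Metric.closedBall x₀ (3 / 4 * ρ) ×ˢ Icc (te - (3 / 4 * ρ) ^ 2) te,
        tailPow (1 + m + m * c) h (U z) ≤ ENNReal.ofReal I → 0 ≤ I →
      ∫⁻ z in Metric.closedBall x₀ (3 / 4 * ρ) ×ˢ Icc (te - (3 / 4 * ρ) ^ 2) te,
        ‖F z‖ₑ ^ (2 * p) ≤ ENNReal.ofReal J →
      ρ ^ (-((N : ℝ) + 2)) * h ^ (-(((N : ℝ) * (m - 1) + 2 * (1 + m + m * c)) / 2)) *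
        (1 + (ρ ^ (2 - ((N : ℝ) + 2) / p) * J ^ (1 / p)) ^
          (p * ((N : ℝ) + 2) / (2 * p - ((N : ℝ) + 2)))) * I ≤ ε →
      ∀ᵐ z ∂(volume.restrict (Metric.closedBall x₀ (ρ / 2) ×ˢ Icc (te - (ρ / 2) ^ 2) te)),
        ‖U z‖ ≤ 2 * h := by
  have hN' : (3 : ℝ) ≤ N := by exact_mod_cast hN
  have hp0 : 0 < p := by linarith
  have hp1 : 1 < p := by linarith
  set s := 1 + m + m * c with hs
  set θ := 1 - 1 / p with hθ
  set γ := 1 + 2 / (N : ℝ) with hγ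
  have hpinv : 1 / p < 1 := by rw [div_lt_one hp0]; exact hp1
  have hpinv0 : 0 < 1 / p := by positivity
  have hθ0 : 0 < θ := by linarith
  have hθ1 : θ ≤ 1 := by linarith
  have hγ2 : γ ≤ 2 := by
    have : 2 / (N : ℝ) ≤ 1 := by rw [div_le_one (by linarith)]; linarith
    linarith
  have hγ0 : 0 < γ := by positivity
  -- Superlinearity of the recursion is the condition `p > (N+2)/2`.
  have hθγ : 1 < θ * γ := by
    have h1 : ((N : ℝ) + 2) / p < 2 := by rw [div_lt_iff₀ hp0]; linarith
    have e : θ * γ = 1 + (2 - ((N : ℝ) + 2) / p) / N := by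
      rw [hθ, hγ]; field_simp; ring
    rw [e]
    have : 0 < (2 - ((N : ℝ) + 2) / p) / N := div_pos (by linarith) (by linarith)
    linarith
  set fc := fluxConst ν L c with hfc
  have hfc0 : 0 < fc := fluxConst_pos hν
  set Gr := (gainConst N ν c).toReal with hGr
  have hGe : gainConst N ν c = ENNReal.ofReal Gr :=
    (ENNReal.ofReal_toReal (gainConst_ne_top N ν c)).symm
  have hGr0 : 0 ≤ Gr := ENNReal.toReal_nonneg
  set C₁ := (m / 4) ^ 7 * ((1 / 2) ^ (c + 1) / 8) with hC₁
  have hC₁0 : 0 < C₁ := by positivity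
  set C₃ := 32 + 64 * fc * cutoffConst ^ 2 + fc with hC₃
  have hC₃0 : 0 < C₃ := by positivity
  set K := Gr * C₃ ^ γ / C₁ + 1 with hK
  have hK0 : 0 < K := by positivity
  obtain ⟨ε, hε, hiter⟩ := exists_smallness (b := 2048) hK0 (by norm_num) hθ0 hθ1 hγ0 hθγ
  refine ⟨ε, hε, fun k x₀ R' a b U G Y F hS ρ te h hρ hh hR' ha hb I J hJ0 hI hI0 hJ hsmall => ?_⟩
  have hh0 : 0 < h := by linarith
  set x : ℕ → ℝ := fun j => (1 / 2) ^ j with hx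
  have hx0 : ∀ j, 0 < x j := fun j => by positivity
  have hx1 : ∀ j, x j ≤ 1 := fun j => pow_le_one₀ (by norm_num) (by norm_num)
  have hxs : ∀ j, x (j + 1) = x j / 2 := fun j => by simp only [hx, pow_succ]; ring
  -- Radii decrease from `3ρ/4` to `ρ/2`, while the levels below increase from `h` to `2h`.
  set R : ℕ → ℝ := fun j => ρ * (1 / 2 + x j / 4) with hRd
  set H : ℕ → ℝ := fun j => h * (2 - x j) with hH
  have hR0 : R 0 = 3 / 4 * ρ := by simp only [hRd, hx, pow_zero]; ring
  have hH0 : H 0 = h := by simp only [hH, hx, pow_zero]; ring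
  have hRpos : ∀ j, ρ / 2 < R j := fun j => by
    have := mul_pos hρ (hx0 j)
    simp only [hRd]; linarith
  have hRle : ∀ j, R j ≤ R 0 := fun j => by
    have := mul_le_mul_of_nonneg_left (hx1 j) hρ.le
    rw [hR0]; simp only [hRd]; linarith
  have hRs : ∀ j, R (j + 1) = ρ * (1 / 2 + x j / 8) := fun j => by
    simp only [hRd, hxs]; ring
  have hRlt : ∀ j, R (j + 1) < R j := fun j => by
    have := mul_pos hρ (hx0 j)
    rw [hRs]; simp only [hRd]; linarith
  have hHge : ∀ j, h ≤ H j := fun j => by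
    have := mul_le_mul_of_nonneg_left (hx1 j) hh0.le
    simp only [hH]; linarith
  have hHlt : ∀ j, H j < H (j + 1) := fun j => by
    have := mul_pos hh0 (hx0 j)
    simp only [hH, hxs]; linarith
  have hHle : ∀ j, H j ≤ 2 * h := fun j => by
    have := mul_pos hh0 (hx0 j)
    simp only [hH]; linarith
  set Qj : ℕ → Set (SpaceTime N) := fun j =>
    Metric.closedBall x₀ (R j) ×ˢ Icc (te - R j ^ 2) te with hQ
  have hQ0 : ∀ j, Qj j ⊆ Qj 0 := fun j => by
    refine prod_mono (Metric.closedBall_subset_closedBall (hRle j)) (Icc_subset_Icc_left ?_)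
    have := pow_le_pow_left₀ (by linarith [hRpos j]) (hRle j) 2
    linarith
  set Yj : ℕ → ℝ≥0∞ := fun j => ∫⁻ z in Qj j, tailPow s (H j) (U z) with hYj
  have hY0 : Yj 0 ≤ ENNReal.ofReal I := by
    simp only [hYj, hQ, hR0, hH0]; exact hI
  have hYle : ∀ j, Yj j ≤ Yj 0 := fun j => by
    refine (lintegral_mono_set (hQ0 j)).trans (lintegral_mono fun z => tailPow_anti ?_ _)
    rw [hH0]; exact hHge j
  -- Finiteness of the first tail is inherited by all later ones, so the recursion may be run in
  -- real numbers.
  have hYtop : ∀ j, Yj j ≠ ⊤ := fun j =>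
    ((hYle j).trans hY0).trans_lt ENNReal.ofReal_lt_top |>.ne
  set y : ℕ → ℝ := fun j => (Yj j).toReal with hy
  have hYe : ∀ j, Yj j = ENNReal.ofReal (y j) := fun j => (ENNReal.ofReal_toReal (hYtop j)).symm
  have hy0 : ∀ j, 0 ≤ y j := fun j => ENNReal.toReal_nonneg
  set Φ := J ^ (1 / p) with hΦ
  have hΦ0 : 0 ≤ Φ := Real.rpow_nonneg hJ0 _
  have hJj : ∀ j, (∫⁻ z in Qj j, ‖F z‖ₑ ^ (2 * p)) ^ (1 / p) ≤ ENNReal.ofReal Φ := fun j => by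
    rw [hΦ, ← ENNReal.ofReal_rpow_of_nonneg hJ0 hpinv0.le]
    refine ENNReal.rpow_le_rpow ((lintegral_mono_set (hQ0 j)).trans ?_) hpinv0.le
    simp only [hQ, hR0]; exact hJ
  -- one step of the iteration
  have hexp1 : m - 1 + s * (2 / (N : ℝ)) = ((N : ℝ) * (m - 1) + 2 * s) / N := by field_simp
  have hexp2 : m * c - s * (1 - 1 / p) = s / p - 1 - m := by rw [hs]; field_simp; ring
  have hstep : ∀ j, h ^ (((N : ℝ) * (m - 1) + 2 * s) / N) * y (j + 1) ≤
      K * 2048 ^ j * (ρ ^ (-2 : ℝ) * y j + h ^ (s / p - 1 - m) * (Φ * y j ^ θ)) ^ γ := by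
    intro j
    set δ := m * x j / 4 with hδ
    have hδ0 : 0 < δ := by have := hx0 j; positivity
    have hδ1 : δ < 1 := by
      have := mul_le_mul hm1.le (hx1 j) (hx0 j).le zero_le_one
      rw [hδ]; linarith
    have hsq : R (j + 1) ^ 2 < R j ^ 2 :=
      pow_lt_pow_left₀ (hRlt j) (by linarith [hRpos (j + 1)]) two_ne_zero
    have hR0sq : R j ^ 2 ≤ R 0 ^ 2 := pow_le_pow_left₀ (by linarith [hRpos j]) (hRle j) 2
    have key := hS.level_step (p := p) (h₀ := h) (h := H j) (h' := H (j + 1)) (r := R (j + 1))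
      (R := R j) (ta := te - R j ^ 2) (tb := te - R (j + 1) ^ 2) (te := te) (δ := δ) (c := c)
      hN hν hm hm1.le hc (by linarith [hRle j]) (by rw [hR0] at hR0sq; linarith) (by linarith)
      (by
        have : 0 < R (j + 1) ^ 2 := pow_pos (by linarith [hRpos (j + 1)]) 2
        linarith) hb (by linarith [hRpos (j + 1)]) (hRlt j) hδ0 hδ1 hh (hHge j) (hHlt j)
      (level_ratio hm hm1.le hh0 j) hp1
      (by
        have : s / p ≤ 1 + m := by rw [div_le_iff₀ hp0]; exact hcp
        rw [← hs]; linarith)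
      (by
        have h1 : 0 ≤ ((N : ℝ) * (m - 1) + 2 * s) / N := by positivity
        rw [← hexp1] at h1
        rw [← hs]; linarith)
    have ett : te - R (j + 1) ^ 2 - (te - R j ^ 2) = R j ^ 2 - R (j + 1) ^ 2 := by ring
    rw [ett, ← hs, hexp1, hexp2, hGe] at key
    set B := 4 / (R j ^ 2 - R (j + 1) ^ 2) + fluxConst ν L c *
      (cutoffConst / (R j - R (j + 1))) ^ 2 with hB
    have hB0 : 0 ≤ B := by
      have : 0 < R j ^ 2 - R (j + 1) ^ 2 := by linarith
      positivity
    have hBle : B ≤ C₃ * 4 ^ j * ρ ^ (-2 : ℝ) := by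
      have h1 := gap_bound (fc := fc) (M := cutoffConst) hρ (hx0 j) (hx1 j) rfl (hRs j)
      have e4 : 1 / x j ^ 2 = (4 : ℝ) ^ j := by
        simp only [hx, ← pow_mul, mul_comm j 2]
        rw [pow_mul, one_div, ← inv_pow]; norm_num
      rw [e4] at h1
      refine h1.trans ?_
      have h2 : 0 ≤ (4 : ℝ) ^ j * ρ ^ (-2 : ℝ) := by positivity
      rw [hC₃]
      nlinarith [mul_nonneg hfc0.le h2]
    have hZ0 : 0 ≤ h ^ (s / p - 1 - m) * (Φ * y j ^ θ) := by
      have := hy0 j; positivity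
    have key2 : levelLoss N c δ * (h ^ (((N : ℝ) * (m - 1) + 2 * s) / N) * y (j + 1)) ≤
        Gr * (B * y j + fc * (h ^ (s / p - 1 - m) * (Φ * y j ^ θ))) ^ γ := by
      have hL0 : 0 ≤ levelLoss N c δ := by unfold levelLoss; positivity
      have hyj := hy0 j
      have hyj1 := hy0 (j + 1)
      rw [← ENNReal.ofReal_le_ofReal_iff (by positivity), ENNReal.ofReal_mul hL0,
        ENNReal.ofReal_mul (by positivity), ENNReal.ofReal_mul hGr0,
        ← ENNReal.ofReal_rpow_of_nonneg (by positivity) hγ0.le,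
        ENNReal.ofReal_add (by positivity) (by positivity), ENNReal.ofReal_mul hB0,
        ENNReal.ofReal_mul hfc0.le, ENNReal.ofReal_mul (by positivity), ENNReal.ofReal_mul hΦ0,
        ← ENNReal.ofReal_rpow_of_nonneg hyj hθ0.le, ← hYe, ← hYe]
      refine key.trans ?_
      have := hJj j
      gcongr
    refine real_step hC₁0 hGr0 hγ0.le hγ2 hC₃0.le hBle hB0 ?_ hfc0.le ?_ (hy0 j) hZ0
      (by positivity) (by positivity) (hy0 (j + 1)) key2
    · rw [hC₃]
      have : 0 ≤ 32 + 64 * fc * cutoffConst ^ 2 := by positivity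
      linarith
    · refine le_trans (le_of_eq ?_) (levelLoss_ge hN hc hδ0 hδ1.le)
      have : δ ^ 7 = (m / 4) ^ 7 * (1 / 128) ^ j := by
        simp only [hδ, hx]
        have e7 : ((1 : ℝ) / 128) ^ j = ((1 / 2) ^ j) ^ 7 := by
          rw [← pow_mul, mul_comm, pow_mul]; norm_num
        rw [e7]; ring
      rw [this, hC₁]; ring
  -- normalization
  set f := ρ ^ (2 - ((N : ℝ) + 2) / p) * Φ with hf
  set Λ := 1 + f ^ (p * ((N : ℝ) + 2) / (2 * p - ((N : ℝ) + 2))) with hΛ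
  have hf0 : 0 ≤ f := by positivity
  have hΛ0 : 0 < Λ := by positivity
  set σ := ρ ^ (-((N : ℝ) + 2)) * h ^ (-(((N : ℝ) * (m - 1) + 2 * s) / 2)) * Λ with hσ
  have hσ0 : 0 < σ := by positivity
  have hX := hiter (fun j => σ * y j) (fun j => mul_nonneg hσ0.le (hy0 j))
    (by
      have : y 0 ≤ I := ENNReal.toReal_le_of_le_ofReal hI0 hY0
      exact (mul_le_mul_of_nonneg_left this hσ0.le).trans hsmall)
    (fun j => normalized_step (by linarith) hm hm1 hp hρ hh (hy0 j) hΦ0 (hstep j) (by positivity)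
      hf hΛ)
  have hylim : Tendsto y atTop (𝓝 0) := by
    have := hX.const_mul σ⁻¹
    rw [mul_zero] at this
    refine this.congr fun j => ?_
    field_simp
  have hYlim : Tendsto Yj atTop (𝓝 0) := by
    have := ENNReal.tendsto_ofReal hylim
    rw [ENNReal.ofReal_zero] at this
    exact this.congr fun j => (hYe j).symm
  -- The limit cylinder lies in every `Qj` and the limit level `2h` is above every `H j`, so its
  -- tail is below all members of a null sequence.
  have hzero : ∫⁻ z in Metric.closedBall x₀ (ρ / 2) ×ˢ Icc (te - (ρ / 2) ^ 2) te,
      tailPow s (2 * h) (U z) = 0 := by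
    refine le_antisymm (ge_of_tendsto' hYlim fun j => ?_) zero_le
    refine (lintegral_mono_set ?_).trans (lintegral_mono fun z => tailPow_anti (hHle j) _)
    refine prod_mono (Metric.closedBall_subset_closedBall (hRpos j).le) (Icc_subset_Icc_left ?_)
    have := pow_le_pow_left₀ (by positivity) (hRpos j).le 2
    linarith
  have hmeas : AEMeasurable (fun z => tailPow s (2 * h) (U z))
      (volume.restrict (Metric.closedBall x₀ (ρ / 2) ×ˢ Icc (te - (ρ / 2) ^ 2) te)) :=
    ((measurable_tailPow s _).comp_aemeasurable hS.memLp.1.aemeasurable).restrict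
  rw [lintegral_eq_zero_iff' hmeas] at hzero
  filter_upwards [hzero] with z hz
  by_contra hcon
  rw [not_le] at hcon
  have h2 := tailPow_of_lt (s := s) (by linarith : 0 ≤ 2 * h) hcon
  simp only [Pi.zero_apply] at hz
  rw [hz] at h2
  have h3 : 0 < ‖U z‖ ^ s := Real.rpow_pos_of_pos (by linarith) _
  exact absurd h2.symm (ENNReal.ofReal_pos.2 h3).ne'

end PorousMedium

end

/-! ### From local weak solutions to globally extended data. -/

noncomputable section

namespace PorousMedium

variable {N k : ℕ}

/-- For a simple function in place of `w` the composition is a finite sum of indicators of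
measurable maps. Continuity in the second variable passes to the limit. -/
theorem aestronglyMeasurable_caratheodory {α X E : Type*} [MeasurableSpace α] {μ : Measure α}
    [TopologicalSpace X] [TopologicalSpace.PseudoMetrizableSpace X] [MeasurableSpace X]
    [BorelSpace X]
    [NormedAddCommGroup E] {A : α → X → E} (hA : ∀ y, AEStronglyMeasurable (fun z => A z y) μ)
    (hc : ∀ᵐ z ∂μ, Continuous (A z)) {w : α → X} (hw : AEStronglyMeasurable w μ) :
    AEStronglyMeasurable (fun z => A z (w z)) μ := by
  have hs := hw.stronglyMeasurable_mk
  have h1 : ∀ n, AEStronglyMeasurable (fun z => A z (hs.approx n z)) μ := by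
    intro n
    have e : (fun z => A z (hs.approx n z)) = ∑ y ∈ (hs.approx n).range,
        ((hs.approx n) ⁻¹' {y}).indicator fun z => A z y := by
      ext z
      rw [Finset.sum_apply, Finset.sum_eq_single (hs.approx n z)]
      · rw [indicator_of_mem (by simp)]
      · intro y _ hy
        exact indicator_of_notMem (by simpa using hy.symm) _
      · intro h
        exact absurd (SimpleFunc.mem_range_self _ _) h
    rw [e]
    exact Finset.aestronglyMeasurable_sum _ fun y _ =>
      (hA y).indicator (SimpleFunc.measurableSet_fiber _ _)
  refine aestronglyMeasurable_of_tendsto_ae atTop h1 ?_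
  filter_upwards [hc, hw.ae_eq_mk] with z hz hzw
  rw [hzw]
  exact (hz.tendsto _).comp (hs.tendsto_approx z)

theorem HasWeakGradient.mono_congr {Ω Ω' : Set (Vec N)} {f f' : Vec N → Vec k}
    {g g' : Vec N → GradVec N k} (h : HasWeakGradient Ω f g) (hΩ : MeasurableSet Ω)
    (hΩ' : IsOpen Ω')
    (hsub : Ω' ⊆ Ω) (hf : ∀ x ∈ Ω', f' x = f x) (hg : ∀ x ∈ Ω', g' x = g x) :
    HasWeakGradient Ω' f' g' := by
  have aux : ∀ {E : Type _} [NormedAddCommGroup E] {u u' : Vec N → E}, LocallyIntegrableOn u Ω →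
      (∀ x ∈ Ω', u' x = u x) → LocallyIntegrableOn u' Ω' := by
    intro E _ u u' hu huu x hx
    obtain ⟨t, ht, hti⟩ := (hu.mono_set hsub) x hx
    refine ⟨t ∩ Ω', inter_mem ht self_mem_nhdsWithin, ?_⟩
    have h1 : IntegrableOn u (t ∩ Ω') := hti.mono_set inter_subset_left
    have h2 : IntegrableOn u Ω' (volume.restrict t) := by
      rw [IntegrableOn, Measure.restrict_restrict hΩ'.measurableSet, inter_comm]
      exact h1
    have h3 := h2.congr_fun (fun x hx => (huu x hx).symm) hΩ'.measurableSet
    rw [IntegrableOn, Measure.restrict_restrict hΩ'.measurableSet, inter_comm] at h3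
    exact h3
  refine ⟨aux h.1 hf, aux h.2 hg, fun φ hφ hc hs α => ?_⟩
  have h1 := h.3 φ hφ hc (hs.trans hsub) α
  have h0 : ∀ x, x ∉ Ω' → φ x = 0 ∧ fderiv ℝ φ x = 0 := fun x hx =>
    ⟨image_eq_zero_of_notMem_tsupport fun h' => hx (hs h'),
      fderiv_of_notMem_tsupport (𝕜 := ℝ) fun h' => hx (hs h')⟩
  have e1 : ∫ x in Ω', (fderiv ℝ φ x (EuclideanSpace.single α 1)) • f' x =
      ∫ x in Ω, (fderiv ℝ φ x (EuclideanSpace.single α 1)) • f x := by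
    rw [setIntegral_eq_of_subset_of_forall_sdiff_eq_zero hΩ hsub
      (fun x hx => by rw [(h0 x hx.2).2]; simp)]
    exact setIntegral_congr_fun hΩ'.measurableSet fun x hx => by simp only [hf x hx]
  have e2 : ∫ x in Ω', φ x • g' x α = ∫ x in Ω, φ x • g x α := by
    rw [setIntegral_eq_of_subset_of_forall_sdiff_eq_zero hΩ hsub
      (fun x hx => by rw [(h0 x hx.2).1]; simp)]
    exact setIntegral_congr_fun hΩ'.measurableSet fun x hx => by simp only [hg x hx]
  rw [e1, e2, h1]

theorem vpow_zero (m : ℝ) : vpow (0 : Vec k) m = 0 := by simp [vpow]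

theorem vpow_indicator {S : Set (SpaceTime N)} {u : SpaceTime N → Vec k} (m : ℝ) :
    (fun z => vpow (S.indicator u z) m) = S.indicator fun z => vpow (u z) m := by
  ext1 z
  by_cases hz : z ∈ S
  · simp only [indicator_of_mem hz]
  · simp only [indicator_of_notMem hz, vpow_zero]

theorem integrable_inner_of_integrable_of_continuous {H : Type*} [NormedAddCommGroup H]
    [InnerProductSpace ℝ H] {S : Set (SpaceTime N)} (hS : IsCompact S) {X ψ : SpaceTime N → H}
    (hX : Integrable X) (hψ : Continuous ψ) (h0 : ∀ z, z ∉ S → ψ z = 0) :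
    Integrable (fun z => (inner ℝ (X z) (ψ z) : ℝ)) := by
  obtain ⟨C, hC⟩ := hS.exists_bound_of_continuousOn hψ.continuousOn
  refine (hX.norm.mul_const (max C 0)).mono' (hX.1.inner hψ.aestronglyMeasurable)
    (.of_forall fun z => ?_)
  refine (norm_inner_le_norm _ _).trans ?_
  gcongr
  by_cases hz : z ∈ S
  · exact (hC z hz).trans (le_max_left _ _)
  · rw [h0 z hz, norm_zero]; exact le_max_right _ _

/-- Everything is extended by zero outside a compact box, with flux `A(z, u, Du^m)` inside. The
structure conditions are trivial where all data vanish. Test maps are supported in the box, so the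
extension does not change the weak equation. The bound `r ≥ 1 + m` gives `u` the required
integrability. -/
theorem IsLocalWeakSolution.exists_isCutoffSolution {Ω : Set (Vec N)} {T m ν L p r : ℝ}
    {A : SpaceTime N → Vec k → GradVec N k → GradVec N k} {F : SpaceTime N → GradVec N k}
    {u : SpaceTime N → Vec k} (hm : 0 < m) (hΩ : IsOpen Ω) (hA : IsAdmissible Ω T m ν L A)
    (hF : MemLpLoc F (ENNReal.ofReal (2 * p)) (cyl Ω T)) (hu : IsLocalWeakSolution Ω T m A F u)
    (hur : MemLpLoc u (ENNReal.ofReal r) (cyl Ω T)) (hp : 1 ≤ p) (hr : 1 + m ≤ r)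
    {x₀ : Vec N} {R a b : ℝ} (hS : Metric.closedBall x₀ R ×ˢ Icc a b ⊆ openCyl Ω T) :
    ∃ G Y, IsCutoffSolution m ν L x₀ R a b ((Metric.closedBall x₀ R ×ˢ Icc a b).indicator u) G Y
      ((Metric.closedBall x₀ R ×ˢ Icc a b).indicator F) := by
  obtain ⟨-, G, hG, hweak⟩ := hu
  set S := Metric.closedBall x₀ R ×ˢ Icc a b with hSd
  have hSc : IsCompact S := (isCompact_closedBall x₀ R).prod isCompact_Icc
  have hSm : MeasurableSet S := measurableSet_closedBall.prod measurableSet_Icc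
  have hoc : openCyl Ω T ⊆ cyl Ω T := prod_mono_right Ioo_subset_Ioc_self
  have hScyl : S ⊆ cyl Ω T := hS.trans hoc
  have hfin : IsFiniteMeasure (volume.restrict S) := ⟨by simpa using hSc.measure_lt_top⟩
  have hcylm : MeasurableSet (cyl Ω T) := hΩ.measurableSet.prod measurableSet_Ioc
  have aer : ∀ {P : SpaceTime N → Prop}, (∀ᵐ z ∂(volume.restrict (cyl Ω T)), P z) →
      ∀ᵐ z, z ∈ S → P z := fun h => by
    rw [ae_restrict_iff' hcylm] at h
    filter_upwards [h] with z hz hzS using hz (hScyl hzS)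
  have hu1 : MemLp u (ENNReal.ofReal (1 + m)) (volume.restrict S) :=
    (hur S hSc hScyl).mono_exponent (ENNReal.ofReal_le_ofReal hr)
  have hF2 : MemLp F 2 (volume.restrict S) :=
    (hF S hSc hScyl).mono_exponent (by
      rw [show (2 : ℝ≥0∞) = ENNReal.ofReal 2 by simp]
      exact ENNReal.ofReal_le_ofReal (by linarith))
  have hG2 : MemLp G 2 (volume.restrict S) := hG.memLpLoc_grad S hSc hS
  have hYm : AEStronglyMeasurable (fun z => A z (u z) (G z)) (volume.restrict S) := by
    have hsub : volume.restrict S ≤ volume.restrict (cyl Ω T) := Measure.restrict_mono hScyl le_rfl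
    exact aestronglyMeasurable_caratheodory (A := fun z (y : Vec k × GradVec N k) => A z y.1 y.2)
      (fun y => (hA.measurable y.1 y.2).mono_measure hsub)
      (ae_mono hsub hA.continuous) (hu1.1.prodMk hG2.1)
  have hY2 : MemLp (fun z => A z (u z) (G z)) 2 (volume.restrict S) := by
    refine MemLp.of_le_mul (c := L) hG2 hYm ?_
    rw [ae_restrict_iff' hSm]
    filter_upwards [aer hA.growth] with z hz hzS using hz hzS _ _
  have hUm : MemLp (S.indicator u) (ENNReal.ofReal (1 + m)) volume :=
    (memLp_indicator_iff_restrict hSm).2 hu1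
  have hYI : MemLp (S.indicator fun z => A z (u z) (G z)) 2 volume :=
    (memLp_indicator_iff_restrict hSm).2 hY2
  have hFI : MemLp (S.indicator F) 2 volume := (memLp_indicator_iff_restrict hSm).2 hF2
  refine ⟨S.indicator G, S.indicator fun z => A z (u z) (G z), ⟨hUm, ?_,
    (memLp_indicator_iff_restrict hSm).2 hG2, hYI, hFI, ?_, ?_, ?_, ?_, ?_⟩⟩
  · rw [vpow_indicator, memLp_indicator_iff_restrict hSm]
    exact hG.memLpLoc S hSc hS
  · filter_upwards [aer hA.ellipticity] with z hz
    by_cases hzS : z ∈ S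
    · simp only [indicator_of_mem hzS]; exact hz hzS _ _
    · simp only [indicator_of_notMem hzS]; simp
  · filter_upwards [aer hA.growth] with z hz
    by_cases hzS : z ∈ S
    · simp only [indicator_of_mem hzS]; exact hz hzS _ _
    · simp only [indicator_of_notMem hzS]; simp
  · filter_upwards [aer hA.diagonal] with z hz
    by_cases hzS : z ∈ S
    · simp only [indicator_of_mem hzS]; exact hz hzS _ _
    · simp only [indicator_of_notMem hzS]; simp
  · have h1 := hG.slice
    rw [ae_restrict_iff' measurableSet_Ioo] at h1
    filter_upwards [h1] with t ht htI
    -- For an empty ball the inclusion of the box says nothing about `t`, but then the claim is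
    -- void.
    rcases (Metric.ball x₀ R).eq_empty_or_nonempty with he | ⟨x₁, hx₁⟩
    · rw [he]
      exact ⟨by simp [LocallyIntegrableOn], by simp [LocallyIntegrableOn], by simp⟩
    have htT : t ∈ Ioo 0 T := (hS (⟨Metric.ball_subset_closedBall hx₁, htI⟩ : (x₁, t) ∈ S)).2
    have hmem : ∀ x ∈ Metric.ball x₀ R, (x, t) ∈ S := fun x hx =>
      ⟨Metric.ball_subset_closedBall hx, htI⟩
    refine (ht htT).mono_congr hΩ.measurableSet Metric.isOpen_ball
      (fun x hx => (hS (hmem x hx)).1) (fun x hx => ?_) fun x hx => ?_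
    · rw [indicator_of_mem (hmem x hx)]
    · rw [indicator_of_mem (hmem x hx)]
  · intro φ hφ hφc hφS
    have h0 : ∀ z, z ∉ S → fderiv ℝ φ z = 0 := fun z hz =>
      fderiv_of_notMem_tsupport (𝕜 := ℝ) fun h' => hz (hφS h')
    have ht0 : ∀ z, z ∉ S → timeDeriv φ z = 0 := fun z hz => by
      rw [timeDeriv, h0 z hz]; rfl
    have hs0 : ∀ z, z ∉ S → spaceGrad φ z = 0 := fun z hz => by
      rw [spaceGrad, h0 z hz]; ext1 α; rfl
    have hfc : Continuous (fderiv ℝ φ) := hφ.continuous_fderiv (by simp)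
    have htc : Continuous (timeDeriv φ) := hfc.clm_apply continuous_const
    have hsc : Continuous (spaceGrad φ) :=
      (PiLp.continuous_toLp 2 _).comp (continuous_pi fun α => hfc.clm_apply continuous_const)
    have hK := hSc.measure_ne_top (μ := volume)
    have hz : ∀ {E : Type _} [NormedAddCommGroup E] (f : SpaceTime N → E) z, z ∉ S →
        S.indicator f z = 0 := fun f z hz => indicator_of_notMem hz f
    have iU := integrable_inner_of_integrable_of_continuous hSc
      (integrable_of_memLp_of_eq_zero (by simp [hm.le]) hUm hK (hz _)) htc ht0
    have iY := integrable_inner_of_integrable_of_continuous hSc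
      (integrable_of_memLp_of_eq_zero (by norm_num) hYI hK (hz _)) hsc hs0
    have iF := integrable_inner_of_integrable_of_continuous hSc
      (integrable_of_memLp_of_eq_zero (by norm_num) hFI hK (hz _)) hsc hs0
    have h1 := hweak φ hφ hφc (hφS.trans hS)
    rw [setIntegral_eq_integral_of_forall_compl_eq_zero fun z hz => by
        rw [ht0 z fun h => hz (hScyl h), hs0 z fun h => hz (hScyl h)]; simp,
      setIntegral_eq_integral_of_forall_compl_eq_zero fun z hz => by
        rw [hs0 z fun h => hz (hScyl h)]; simp] at h1
    have e1 : (fun z => (inner ℝ (u z) (timeDeriv φ z) : ℝ) -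
        inner ℝ (A z (u z) (G z)) (spaceGrad φ z)) = fun z =>
        inner ℝ (S.indicator u z) (timeDeriv φ z) -
        inner ℝ (S.indicator (fun z => A z (u z) (G z)) z) (spaceGrad φ z) := by
      ext1 z
      by_cases hz : z ∈ S
      · simp only [indicator_of_mem hz]
      · rw [ht0 z hz, hs0 z hz]; simp
    have e2 : (fun z => (inner ℝ (F z) (spaceGrad φ z) : ℝ)) = fun z =>
        inner ℝ (S.indicator F z) (spaceGrad φ z) := by
      ext1 z
      by_cases hz : z ∈ S
      · simp only [indicator_of_mem hz]
      · rw [hs0 z hz]; simp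
    rw [e1, e2, integral_sub iU iY] at h1
    simp only [inner_add_left]
    rw [integral_add iY iF]
    linarith

end PorousMedium

end

/-! ### The quantitative bound on one cylinder. -/

noncomputable section

namespace PorousMedium

variable {N k : ℕ}

/-- The volume of the unit ball. -/
def unitVol (N : ℕ) : ℝ := (volume (Metric.ball (0 : Vec N) 1)).toReal

theorem unitVol_pos (N : ℕ) : 0 < unitVol N :=
  ENNReal.toReal_pos (Metric.measure_ball_pos _ _ one_pos).ne' measure_ball_lt_top.ne

theorem volume_Q (z₀ : SpaceTime N) {ρ : ℝ} (hρ : 0 < ρ) :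
    volume (Q z₀ ρ) = ENNReal.ofReal (unitVol N * ρ ^ ((N : ℝ) + 2)) := by
  rw [Q, Measure.volume_eq_prod, Measure.prod_prod, Measure.addHaar_ball_of_pos _ _ hρ, Real.volume_Ioc,
    finrank_euclideanSpace, Fintype.card_fin, unitVol, ENNReal.ofReal_mul ENNReal.toReal_nonneg,
    ENNReal.ofReal_toReal measure_ball_lt_top.ne, Real.rpow_add hρ,
    ENNReal.ofReal_mul (by positivity), Real.rpow_natCast, Real.rpow_two]
  ring_nf

theorem measurableSet_Q (z₀ : SpaceTime N) (ρ : ℝ) : MeasurableSet (Q z₀ ρ) :=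
  measurableSet_ball.prod measurableSet_Ioc

/-- All powers of `ρ` cancel, and `h^(-λ_s/2) h^(s-r) = h^(-λ_r/2)`. The level is chosen so that
`h^(λ_r/2)` is `C₁` times the bracket of the final estimate, which leaves a constant made small by
`C₁`. Here `β` is the volume of the unit ball. -/
theorem normalized_energy_le {n m p r s ρ β V A C₁ ε h : ℝ} (hn : 0 < n) (hp : (n + 2) / 2 < p)
    (hρ : 0 < ρ) (hβ : 0 < β) (hV : 0 ≤ V) (hA : 1 ≤ A) (hε : 0 < ε) (hC₁ : 1 ≤ C₁)
    (hlam : 0 < n * (m - 1) + 2 * r)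
    (hC : β * (1 + β ^ ((n + 2) / (2 * p - (n + 2)))) ≤ ε * C₁)
    (hh : h = (C₁ * ((1 + V ^ (2 * p * (n + 2) / (2 * p - (n + 2)))) * A)) ^
      (2 / (n * (m - 1) + 2 * r))) :
    ρ ^ (-(n + 2)) * h ^ (-((n * (m - 1) + 2 * s) / 2)) *
      (1 + (ρ ^ (2 - (n + 2) / p) * (V ^ (2 * p) * (β * ρ ^ (n + 2)) / ρ ^ (2 * p)) ^ (1 / p)) ^
          (p * (n + 2) / (2 * p - (n + 2)))) * (h ^ (s - r) * (A * (β * ρ ^ (n + 2)))) ≤ ε := by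
  have hp0 : 0 < p := by linarith
  have hd : 0 < 2 * p - (n + 2) := by linarith
  set e := 2 * p * (n + 2) / (2 * p - (n + 2)) with he
  set W := 1 + V ^ e with hW
  have hW1 : 1 ≤ W := by rw [hW]; linarith [Real.rpow_nonneg hV e]
  have hB : 0 < C₁ * (W * A) := by positivity
  have hh0 : 0 < h := by rw [hh]; positivity
  have hhl : h ^ ((n * (m - 1) + 2 * r) / 2) = C₁ * (W * A) := by
    rw [hh, ← Real.rpow_mul hB.le]
    have : 2 / (n * (m - 1) + 2 * r) * ((n * (m - 1) + 2 * r) / 2) = 1 := by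
      rw [div_mul_div_comm, mul_comm, div_self (by positivity)]
    rw [this, Real.rpow_one]
  have hf : ρ ^ (2 - (n + 2) / p) * (V ^ (2 * p) * (β * ρ ^ (n + 2)) / ρ ^ (2 * p)) ^ (1 / p) =
      V ^ (2 : ℝ) * β ^ (1 / p) := by
    rw [Real.div_rpow (by positivity) (by positivity), Real.mul_rpow (by positivity) (by positivity),
      Real.mul_rpow hβ.le (by positivity), ← Real.rpow_mul hV, ← Real.rpow_mul hρ.le,
      ← Real.rpow_mul hρ.le, Real.rpow_sub hρ]
    have e1 : 2 * p * (1 / p) = 2 := by field_simp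
    have e2 : (n + 2) * (1 / p) = (n + 2) / p := by ring
    rw [e1, e2]
    have h1 : 0 < ρ ^ ((n + 2) / p) := by positivity
    have h2 : 0 < ρ ^ (2 : ℝ) := by positivity
    field_simp
  have hf2 : (V ^ (2 : ℝ) * β ^ (1 / p)) ^ (p * (n + 2) / (2 * p - (n + 2))) =
      V ^ e * β ^ ((n + 2) / (2 * p - (n + 2))) := by
    rw [Real.mul_rpow (by positivity) (by positivity), ← Real.rpow_mul hV, ← Real.rpow_mul hβ.le]
    have e1 : 2 * (p * (n + 2) / (2 * p - (n + 2))) = e := by rw [he]; ring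
    have e2 : 1 / p * (p * (n + 2) / (2 * p - (n + 2))) = (n + 2) / (2 * p - (n + 2)) := by
      rw [div_mul_div_comm, one_mul, mul_div_mul_left _ _ hp0.ne']
    rw [e1, e2]
  rw [hf, hf2]
  set w := β ^ ((n + 2) / (2 * p - (n + 2))) with hw
  have hw0 : 0 ≤ w := by positivity
  have hΛ : 1 + V ^ e * w ≤ (1 + w) * W := by
    rw [hW]; nlinarith [Real.rpow_nonneg hV e]
  have hpow : h ^ (-((n * (m - 1) + 2 * s) / 2)) * h ^ (s - r) = (C₁ * (W * A))⁻¹ := by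
    rw [← Real.rpow_add hh0, ← hhl, ← Real.rpow_neg hh0.le]
    congr 1; ring
  have hρ1 : ρ ^ (-(n + 2)) * ρ ^ (n + 2) = 1 := by
    rw [← Real.rpow_add hρ, neg_add_cancel, Real.rpow_zero]
  calc _ = (ρ ^ (-(n + 2)) * ρ ^ (n + 2)) * (h ^ (-((n * (m - 1) + 2 * s) / 2)) * h ^ (s - r)) *
        (β * (1 + V ^ e * w) * A) := by ring
    _ = (C₁ * (W * A))⁻¹ * (β * (1 + V ^ e * w) * A) := by rw [hρ1, hpow, one_mul]
    _ ≤ (C₁ * (W * A))⁻¹ * (β * ((1 + w) * W) * A) := by gcongr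
    _ = (C₁ * (W * A))⁻¹ * (β * (1 + w) * (W * A)) := by ring
    _ ≤ (C₁ * (W * A))⁻¹ * (ε * C₁ * (W * A)) := by gcongr
    _ = ε := by field_simp

/-- The added constant in the average is what later guarantees a starting level `h ≥ 1`. -/
theorem one_le_setLAverage_add_one (z₀ : SpaceTime N) {ρ : ℝ} (hρ : 0 < ρ)
    (f : SpaceTime N → ℝ≥0∞) : 1 ≤ ⨍⁻ z in Q z₀ ρ, (f z + 1) ∂volume := by
  have h0 : volume (Q z₀ ρ) ≠ 0 := by
    rw [volume_Q _ hρ]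
    have := unitVol_pos N
    exact (ENNReal.ofReal_pos.2 (by positivity)).ne'
  have h1 : volume (Q z₀ ρ) ≠ ⊤ := by rw [volume_Q _ hρ]; exact ENNReal.ofReal_ne_top
  rw [setLAverage_eq, ENNReal.le_div_iff_mul_le (Or.inl h0) (Or.inl h1), one_mul]
  calc volume (Q z₀ ρ) = ∫⁻ _ in Q z₀ ρ, 1 := by simp
    _ ≤ _ := lintegral_mono fun z => le_add_self

theorem setLIntegral_eq_average_mul (z₀ : SpaceTime N) {ρ : ℝ} (hρ : 0 < ρ)
    (f : SpaceTime N → ℝ≥0∞) : ∫⁻ z in Q z₀ ρ, f z =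
      (⨍⁻ z in Q z₀ ρ, f z ∂volume) * ENNReal.ofReal (unitVol N * ρ ^ ((N : ℝ) + 2)) := by
  have hω := unitVol_pos N
  rw [setLAverage_eq, volume_Q _ hρ, ENNReal.div_mul_cancel
    (ENNReal.ofReal_pos.2 (by positivity)).ne' ENNReal.ofReal_ne_top]

theorem scaledNorm_rpow {F : SpaceTime N → GradVec N k} {p : ℝ} (hp : 0 < p) (z₀ : SpaceTime N)
    {ρ : ℝ} : scaledNorm F p z₀ ρ ^ (2 * p) =
      ENNReal.ofReal ρ ^ (2 * p) * ⨍⁻ z in Q z₀ ρ, ‖F z‖ₑ ^ (2 * p) ∂volume := by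
  rw [scaledNorm, ← ENNReal.rpow_mul, one_div_mul_cancel (by positivity), ENNReal.rpow_one]

/-- The interior bound on a cylinder, in terms of finite data. -/
theorem exists_cylinder_bound (hN : 3 ≤ N) {m ν L p r : ℝ} (hν : 0 < ν) (hm : 0 < m) (hm1 : m < 1)
    (hp : ((N : ℝ) + 2) / 2 < p) (hr : 1 + m ≤ r) (hlam : 0 < (N : ℝ) * (m - 1) + 2 * r) :
    ∃ C₁ : ℝ, 1 ≤ C₁ ∧ ∀ (k : ℕ) (Ω : Set (Vec N)) (T : ℝ)
      (A : SpaceTime N → Vec k → GradVec N k → GradVec N k) (F : SpaceTime N → GradVec N k)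
      (u : SpaceTime N → Vec k), IsOpen Ω → IsAdmissible Ω T m ν L A →
      MemLpLoc F (ENNReal.ofReal (2 * p)) (cyl Ω T) → IsLocalWeakSolution Ω T m A F u →
      MemLpLoc u (ENNReal.ofReal r) (cyl Ω T) → ∀ (z₀ : SpaceTime N) (ρ : ℝ), 0 < ρ →
      Q z₀ ρ ⊆ cyl Ω T → ∀ V a : ℝ, 0 ≤ V → 1 ≤ a → scaledNorm F p z₀ ρ = ENNReal.ofReal V →
      ⨍⁻ z in Q z₀ ρ, (‖u z‖ₑ ^ r + 1) ∂volume = ENNReal.ofReal a →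
      ∀ᵐ z ∂(volume.restrict (Q z₀ (ρ / 2))), ‖u z‖ ≤ 2 *
        (C₁ * ((1 + V ^ (2 * p * ((N : ℝ) + 2) / (2 * p - ((N : ℝ) + 2)))) * a)) ^
          (2 / ((N : ℝ) * (m - 1) + 2 * r)) := by
  have hN' : (3 : ℝ) ≤ N := by exact_mod_cast hN
  have hp0 : 0 < p := by linarith
  -- The order `s` must satisfy `s ≤ (1+m)p`, so that Hölder absorbs the force, and `λ_s ≥ 0`, so
  -- that the gain is not a loss. If `s = r` the latter is assumed; if `s = p` it follows from `2p >
  -- N + 2`.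
  set s := min r p with hs
  have hsr : s ≤ r := min_le_left _ _
  have hsp : s ≤ p := min_le_right _ _
  have hs1 : 1 + m ≤ s := le_min hr (by linarith)
  set c := (s - 1 - m) / m with hc
  have hc0 : 0 ≤ c := div_nonneg (by linarith) hm.le
  have hsc : 1 + m + m * c = s := by rw [hc]; field_simp; ring
  have hlams : 0 ≤ (N : ℝ) * (m - 1) + 2 * s := by
    have hNm : 0 ≤ (N : ℝ) * m := by positivity
    rcases min_choice r p with h | h
    · rw [hs, h]; exact hlam.le
    · rw [hs, h]; linarith
  have hω := unitVol_pos N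
  obtain ⟨ε, hε, hbound⟩ := exists_smallness_bound (L := L) hN hν hm hm1 hp hc0
    (by rw [hsc]; nlinarith) (by rw [hsc]; exact hlams)
  simp only [hsc] at hbound
  set C₁ := max 1 (unitVol N * (1 + unitVol N ^ (((N : ℝ) + 2) / (2 * p - ((N : ℝ) + 2)))) / ε)
    with hC₁
  refine ⟨C₁, le_max_left _ _, fun k Ω T A F u hΩ hA hF hu hur z₀ ρ hρ hQ V a hV ha hVe hae => ?_⟩
  have hC : unitVol N * (1 + unitVol N ^ (((N : ℝ) + 2) / (2 * p - ((N : ℝ) + 2)))) ≤ ε * C₁ := by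
    have h1 := le_max_right 1
      (unitVol N * (1 + unitVol N ^ (((N : ℝ) + 2) / (2 * p - ((N : ℝ) + 2)))) / ε)
    rw [← hC₁, div_le_iff₀ hε] at h1
    linarith
  set h := (C₁ * ((1 + V ^ (2 * p * ((N : ℝ) + 2) / (2 * p - ((N : ℝ) + 2)))) * a)) ^
          (2 / ((N : ℝ) * (m - 1) + 2 * r)) with hh
  have hC₁1 : 1 ≤ C₁ := le_max_left _ _
  have hh1 : 1 ≤ h := by
    refine Real.one_le_rpow ?_ (by positivity)
    have h1 : 1 ≤ 1 + V ^ (2 * p * ((N : ℝ) + 2) / (2 * p - ((N : ℝ) + 2))) := by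
      linarith [Real.rpow_nonneg hV (2 * p * ((N : ℝ) + 2) / (2 * p - ((N : ℝ) + 2)))]
    exact one_le_mul_of_one_le_of_one_le hC₁1 (one_le_mul_of_one_le_of_one_le h1 ha)
  have hsmall := normalized_energy_le (s := s) (n := (N : ℝ)) (by linarith) hp hρ hω hV ha hε hC₁1
    hlam hC hh
  set q := unitVol N * ρ ^ ((N : ℝ) + 2) with hq
  have hq0 : 0 < q := by positivity
  -- the integrals over the cylinder
  have hIu : ∫⁻ z in Q z₀ ρ, ‖u z‖ₑ ^ r ≤ ENNReal.ofReal (a * q) := by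
    rw [ENNReal.ofReal_mul (by linarith), ← hae, ← setLIntegral_eq_average_mul z₀ hρ]
    exact lintegral_mono fun z => le_self_add
  have hJF : ∫⁻ z in Q z₀ ρ, ‖F z‖ₑ ^ (2 * p) ≤ ENNReal.ofReal (V ^ (2 * p) * q / ρ ^ (2 * p)) := by
    have hρp : 0 < ρ ^ (2 * p) := by positivity
    have h1 := scaledNorm_rpow (F := F) hp0 z₀ (ρ := ρ)
    rw [hVe, ENNReal.ofReal_rpow_of_nonneg hV (by positivity), ENNReal.ofReal_rpow_of_pos hρ] at h1
    rw [setLIntegral_eq_average_mul z₀ hρ, mul_div_right_comm,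
      ENNReal.ofReal_mul (p := V ^ (2 * p) / ρ ^ (2 * p)) (by positivity)]
    gcongr
    rw [ENNReal.ofReal_div_of_pos hρp, h1, ENNReal.le_div_iff_mul_le
      (Or.inl (ENNReal.ofReal_pos.2 hρp).ne') (Or.inl ENNReal.ofReal_ne_top), mul_comm]
  have hρ2 : 0 < ρ ^ 2 := by positivity
  have hcentre : z₀ ∈ Q z₀ ρ := ⟨Metric.mem_ball_self hρ, by linarith, le_rfl⟩
  have hT := (hQ hcentre).2.2
  -- the bound below the top time
  have hmain : ∀ te : ℝ, z₀.2 - 7 / 16 * ρ ^ 2 < te → te < z₀.2 →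
      ∀ᵐ z, z ∈ Metric.closedBall z₀.1 (ρ / 2) ×ˢ Icc (te - (ρ / 2) ^ 2) te → ‖u z‖ ≤ 2 * h := by
    intro te hte1 hte2
    -- The bound `te > t₀ - 7ρ²/16` says exactly that `te - (3ρ/4)²` is above the bottom `t₀ - ρ²`.
    -- Midpoints on both sides leave room for the time cutoffs, strictly below the top, where the
    -- equation cannot be tested.
    set a' := (z₀.2 - ρ ^ 2 + (te - (3 / 4 * ρ) ^ 2)) / 2 with ha'
    set b' := (te + z₀.2) / 2 with hb'
    have e34 : (3 / 4 * ρ) ^ 2 = 9 / 16 * ρ ^ 2 := by ring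
    have e12 : (ρ / 2) ^ 2 = 1 / 4 * ρ ^ 2 := by ring
    have hSQ : Metric.closedBall z₀.1 (7 / 8 * ρ) ×ˢ Icc a' b' ⊆ Q z₀ ρ := by
      refine prod_mono (Metric.closedBall_subset_ball (by linarith)) fun t ht => ⟨?_, ?_⟩
      · linarith [ht.1]
      · linarith [ht.2]
    have hSo : Metric.closedBall z₀.1 (7 / 8 * ρ) ×ˢ Icc a' b' ⊆ openCyl Ω T := fun z hz =>
      ⟨(hQ (hSQ hz)).1, (hQ (hSQ hz)).2.1, by linarith [hz.2.2]⟩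
    obtain ⟨G, Y, hS⟩ := hu.exists_isCutoffSolution hm hΩ hA hF hur (by linarith) hr hSo
    set S := Metric.closedBall z₀.1 (7 / 8 * ρ) ×ˢ Icc a' b' with hSd
    set Q0 := Metric.closedBall z₀.1 (3 / 4 * ρ) ×ˢ Icc (te - (3 / 4 * ρ) ^ 2) te with hQ0
    have hQ0Q : Q0 ⊆ Q z₀ ρ := by
      refine prod_mono (Metric.closedBall_subset_ball (by linarith)) fun t ht => ⟨?_, ?_⟩
      · linarith [ht.1]
      · linarith [ht.2]
    have hle : ∀ {E : Type} [NormedAddCommGroup E] (f : SpaceTime N → E) z,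
        ‖S.indicator f z‖ₑ ≤ ‖f z‖ₑ := fun f z => by
      by_cases hz : z ∈ S
      · rw [indicator_of_mem hz]
      · rw [indicator_of_notMem hz, enorm_zero]; exact zero_le
    have hI : ∫⁻ z in Q0, tailPow s h (S.indicator u z) ≤
        ENNReal.ofReal (h ^ (s - r) * (a * q)) := by
      have hh0 : 0 < h := by linarith
      rw [ENNReal.ofReal_mul (by positivity)]
      refine le_trans ?_ (mul_le_mul_right ((lintegral_mono_set hQ0Q).trans hIu) _)
      rw [← lintegral_const_mul' _ _ ENNReal.ofReal_ne_top]
      refine lintegral_mono fun z => (tailPow_le_mul hh0 hsr _).trans ?_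
      refine mul_le_mul_right ((tailPow_le_enorm _ _ _).trans ?_) _
      exact ENNReal.rpow_le_rpow (hle u z) (by linarith)
    have hJ : ∫⁻ z in Q0, ‖S.indicator F z‖ₑ ^ (2 * p) ≤
        ENNReal.ofReal (V ^ (2 * p) * q / ρ ^ (2 * p)) := by
      refine le_trans (lintegral_mono fun z => ?_) ((lintegral_mono_set hQ0Q).trans hJF)
      exact ENNReal.rpow_le_rpow (hle F z) (by positivity)
    have hb := hbound k z₀.1 (7 / 8 * ρ) a' b' (S.indicator u) G Y (S.indicator F) hS ρ te h hρ hh1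
      (by linarith) (by linarith) (by linarith) _ _ (by positivity) hI (by positivity) hJ hsmall
    rw [ae_restrict_iff' (measurableSet_closedBall.prod measurableSet_Icc)] at hb
    filter_upwards [hb] with z hz hzm
    have hzS : z ∈ S := by
      refine ⟨Metric.closedBall_subset_closedBall (by linarith) hzm.1, ?_, ?_⟩
      · linarith [hzm.2.1]
      · linarith [hzm.2.2]
    have := hz hzm
    rwa [indicator_of_mem hzS] at this
  have hnull : ∀ᵐ z : SpaceTime N, z.2 ≠ z₀.2 := by
    have : {z : SpaceTime N | ¬ z.2 ≠ z₀.2} = univ ×ˢ {z₀.2} := by ext z; simp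
    rw [ae_iff, this, Measure.volume_eq_prod, Measure.prod_prod, Real.volume_singleton, mul_zero]
  -- Countably many top times increase to `t₀`; the summand `2` keeps the first one above `t₀ -
  -- 7ρ²/16`. Their cylinders cover the half cylinder up to the null set at the top time.
  have hall : ∀ᵐ z, ∀ n : ℕ, z ∈ Metric.closedBall z₀.1 (ρ / 2) ×ˢ
      Icc (z₀.2 - 7 / 16 * ρ ^ 2 / ((n : ℝ) + 2) - (ρ / 2) ^ 2)
        (z₀.2 - 7 / 16 * ρ ^ 2 / ((n : ℝ) + 2)) → ‖u z‖ ≤ 2 * h := by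
    rw [ae_all_iff]
    intro n
    have hn : (1 : ℝ) < (n : ℝ) + 2 := by
      have : (0 : ℝ) ≤ n := by positivity
      linarith
    have h1 : 0 < 7 / 16 * ρ ^ 2 / ((n : ℝ) + 2) := by positivity
    have h2 : 7 / 16 * ρ ^ 2 / ((n : ℝ) + 2) < 7 / 16 * ρ ^ 2 := div_lt_self (by positivity) hn
    exact hmain _ (by linarith) (by linarith)
  rw [ae_restrict_iff' (measurableSet_Q _ _)]
  filter_upwards [hnull, hall] with z hz1 hz2 hzQ
  have hlt : z.2 < z₀.2 := lt_of_le_of_ne hzQ.2.2 hz1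
  obtain ⟨n, hn⟩ := exists_nat_gt (7 / 16 * ρ ^ 2 / (z₀.2 - z.2))
  have hd : 0 < z₀.2 - z.2 := by linarith
  have hn2 : (0 : ℝ) < (n : ℝ) + 2 := by positivity
  have h1 : 7 / 16 * ρ ^ 2 / ((n : ℝ) + 2) ≤ z₀.2 - z.2 := by
    rw [div_lt_iff₀ hd] at hn
    rw [div_le_iff₀ hn2]
    nlinarith
  have h2 : 0 < 7 / 16 * ρ ^ 2 / ((n : ℝ) + 2) := by positivity
  exact hz2 n ⟨Metric.ball_subset_closedBall hzQ.1, by linarith [hzQ.2.1], by linarith⟩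

end PorousMedium

end

/-! ### Assembly of the estimate and local boundedness. -/

theorem proposition4p1 (N : ℕ) (m ν L p r : ℝ)
    (hm : 0 < m) (hmc : m ≤ ((N : ℝ) - 2) / ((N : ℝ) + 2))
    (hν : 0 < ν) (hp : ((N : ℝ) + 2) / 2 < p) (hr : 1 ≤ r)
    (hlam : 0 < (N : ℝ) * (m - 1) + 2 * r) :
    ∃ C : ℝ, 0 < C ∧
      ∀ (k : ℕ) (Ω : Set (PorousMedium.Vec N)) (T : ℝ),
        IsOpen Ω → Bornology.IsBounded Ω → 0 < T →
      ∀ (A : PorousMedium.SpaceTime N → PorousMedium.Vec k → PorousMedium.GradVec N k →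
          PorousMedium.GradVec N k)
        (F : PorousMedium.SpaceTime N → PorousMedium.GradVec N k)
        (u : PorousMedium.SpaceTime N → PorousMedium.Vec k),
        PorousMedium.IsAdmissible Ω T m ν L A →
        PorousMedium.MemLpLoc F (ENNReal.ofReal (2 * p)) (PorousMedium.cyl Ω T) →
        PorousMedium.IsLocalWeakSolution Ω T m A F u →
        PorousMedium.MemLpLoc u (ENNReal.ofReal r) (PorousMedium.cyl Ω T) →
        PorousMedium.MemLpLoc u ⊤ (PorousMedium.cyl Ω T) ∧
        ∀ (z₀ : PorousMedium.SpaceTime N) (ρ : ℝ), 0 < ρ →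
          PorousMedium.Q z₀ ρ ⊆ PorousMedium.cyl Ω T →
          essSup (fun z => ‖u z‖ₑ) (volume.restrict (PorousMedium.Q z₀ (ρ / 2))) ≤
            ENNReal.ofReal C *
              ((1 + PorousMedium.scaledNorm F p z₀ ρ ^
                    (2 * p * ((N : ℝ) + 2) / (2 * p - ((N : ℝ) + 2)))) *
                ⨍⁻ z in PorousMedium.Q z₀ ρ, (‖u z‖ₑ ^ r + 1) ∂volume) ^
              (2 / ((N : ℝ) * (m - 1) + 2 * r)) := by
  have hN2 : (0 : ℝ) < (N : ℝ) + 2 := by positivity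
  rw [le_div_iff₀ hN2] at hmc
  have hNgt : (2 : ℝ) < N := by nlinarith
  have hN : 3 ≤ N := by
    have : 2 < N := by exact_mod_cast hNgt
    omega
  have hm1 : m < 1 := by nlinarith
  -- The condition `m ≤ m_c` is equivalent to `N(1-m) ≥ 2(1+m)`, and `λ_r > 0` means `2r > N(1-m)`.
  have hr1 : 1 + m ≤ r := by nlinarith
  have hp0 : 0 < p := by linarith
  have hd : 0 < 2 * p - ((N : ℝ) + 2) := by linarith
  obtain ⟨C₁, hC₁, hbound⟩ := PorousMedium.exists_cylinder_bound (L := L) hN hν hm hm1 hp hr1 hlam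
  set lam := (N : ℝ) * (m - 1) + 2 * r with hlamd
  set e := 2 * p * ((N : ℝ) + 2) / (2 * p - ((N : ℝ) + 2)) with he
  have he0 : 0 < e := by positivity
  have hC : 0 < 2 * C₁ ^ (2 / lam) := by positivity
  refine ⟨2 * C₁ ^ (2 / lam), hC, fun k Ω T hΩ _ _ A F u hA hF hu hur => ?_⟩
  have hest : ∀ (z₀ : PorousMedium.SpaceTime N) (ρ : ℝ), 0 < ρ →
      PorousMedium.Q z₀ ρ ⊆ PorousMedium.cyl Ω T →
      essSup (fun z => ‖u z‖ₑ) (volume.restrict (PorousMedium.Q z₀ (ρ / 2))) ≤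
        ENNReal.ofReal (2 * C₁ ^ (2 / lam)) * ((1 + PorousMedium.scaledNorm F p z₀ ρ ^ e) *
          ⨍⁻ z in PorousMedium.Q z₀ ρ, (‖u z‖ₑ ^ r + 1) ∂volume) ^ (2 / lam) := by
    intro z₀ ρ hρ hQ
    set a := ⨍⁻ z in PorousMedium.Q z₀ ρ, (‖u z‖ₑ ^ r + 1) ∂volume with ha
    set V := PorousMedium.scaledNorm F p z₀ ρ with hV
    have ha1 : 1 ≤ a := PorousMedium.one_le_setLAverage_add_one z₀ hρ _
    -- An infinite bracket makes the estimate trivial. Otherwise both factors are at least one,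
    -- hence both are finite and the real-valued bound applies.
    by_cases htop : (1 + V ^ e) * a = ⊤
    · rw [htop, ENNReal.top_rpow_of_pos (by positivity),
        ENNReal.mul_top (ENNReal.ofReal_pos.2 hC).ne']
      exact le_top
    have hat : a ≠ ⊤ := fun h => htop (by rw [h, ENNReal.mul_top]; simp)
    have hVt : V ≠ ⊤ := fun h => htop (by
      rw [h, ENNReal.top_rpow_of_pos he0, add_top, ENNReal.top_mul]
      exact (zero_lt_one.trans_le ha1).ne')
    have hVe : V = ENNReal.ofReal V.toReal := (ENNReal.ofReal_toReal hVt).symm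
    have hae : a = ENNReal.ofReal a.toReal := (ENNReal.ofReal_toReal hat).symm
    have ha1' : 1 ≤ a.toReal := by
      rw [← ENNReal.toReal_one]; exact ENNReal.toReal_mono hat ha1
    have hV0 : 0 ≤ V.toReal := ENNReal.toReal_nonneg
    have hb := hbound k Ω T A F u hΩ hA hF hu hur z₀ ρ hρ hQ V.toReal a.toReal hV0 ha1' hVe hae
    refine essSup_le_of_ae_le _ (hb.mono fun z hz => ?_)
    have h1 : 0 ≤ (1 + V.toReal ^ e) * a.toReal := by positivity
    rw [Real.mul_rpow (by linarith) h1] at hz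
    have h2 : ENNReal.ofReal ((1 + V.toReal ^ e) * a.toReal) = (1 + V ^ e) * a := by
      rw [ENNReal.ofReal_mul (by positivity), ENNReal.ofReal_add zero_le_one (by positivity),
        ENNReal.ofReal_one, ← ENNReal.ofReal_rpow_of_nonneg hV0 he0.le, ← hVe, ← hae]
    simp only
    rw [← ofReal_norm]
    refine (ENNReal.ofReal_le_ofReal hz).trans_eq ?_
    rw [← mul_assoc, ENNReal.ofReal_mul hC.le, ← ENNReal.ofReal_rpow_of_nonneg h1 (by positivity),
      h2]
  refine ⟨fun K hK hKc => ?_, hest⟩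
  have hloc : ∃ M : ℝ≥0∞, M ≠ ⊤ ∧ ∀ᵐ z ∂(volume.restrict K), ‖u z‖ₑ ≤ M := by
    refine hK.induction_on (p := fun S => ∃ M : ℝ≥0∞, M ≠ ⊤ ∧
      ∀ᵐ z ∂(volume.restrict S), ‖u z‖ₑ ≤ M) ⟨0, by simp, by simp⟩ ?_ ?_ ?_
    · rintro S S' hSS' ⟨M, hM, h⟩
      exact ⟨M, hM, ae_restrict_of_ae_restrict_of_subset hSS' h⟩
    · rintro S S' ⟨M, hM, h⟩ ⟨M', hM', h'⟩
      refine ⟨max M M', by simp [hM, hM'], ?_⟩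
      rw [ae_restrict_union_iff]
      exact ⟨h.mono fun z hz => hz.trans (le_max_left _ _),
        h'.mono fun z hz => hz.trans (le_max_right _ _)⟩
    · rintro ⟨x, t⟩ hxt
      obtain ⟨hx, ht0, htT⟩ := hKc hxt
      simp only at hx ht0 htT
      obtain ⟨ρ₁, hρ₁, hball⟩ := Metric.nhds_basis_closedBall.mem_iff.1 (hΩ.mem_nhds hx)
      -- With `ρ ≤ 1` and `ρ ≤ t/2` one gets `ρ² < t`, so the closed cylinder stays at positive
      -- times.
      set ρ := min ρ₁ (min 1 (t / 2)) with hρd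
      have hρ : 0 < ρ := lt_min hρ₁ (lt_min one_pos (by linarith))
      have hρ1 : ρ ≤ 1 := (min_le_right _ _).trans (min_le_left _ _)
      have hρt : ρ ≤ t / 2 := (min_le_right _ _).trans (min_le_right _ _)
      have hρ2 : ρ ^ 2 < t := by nlinarith
      have hρ2' : 0 < ρ ^ 2 := by positivity
      -- The top is raised slightly above `t`, but not beyond `T`. As `ρ²/8 < (ρ/2)²`, the half
      -- cylinder is then a neighbourhood of the point relative to `K`, even when `t = T`.
      set τ := min (t + ρ ^ 2 / 8) T with hτ
      have hτT : τ ≤ T := min_le_right _ _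
      have hτt : t ≤ τ := le_min (by linarith) htT
      have hτt' : τ ≤ t + ρ ^ 2 / 8 := min_le_left _ _
      set S := Metric.closedBall x ρ ×ˢ Icc (τ - ρ ^ 2) τ with hS
      have hSc : IsCompact S := (isCompact_closedBall x ρ).prod isCompact_Icc
      have hScyl : S ⊆ PorousMedium.cyl Ω T := by
        refine prod_mono ((Metric.closedBall_subset_closedBall (min_le_left _ _)).trans hball)
          fun σ hσ => ⟨?_, ?_⟩
        · linarith [hσ.1]
        · linarith [hσ.2]
      have hQS : PorousMedium.Q (x, τ) ρ ⊆ S :=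
        prod_mono Metric.ball_subset_closedBall Ioc_subset_Icc_self
      have hfin : ∀ {E : Type} [NormedAddCommGroup E] {f : PorousMedium.SpaceTime N → E} {q : ℝ},
          0 < q → MemLp f (ENNReal.ofReal q) (volume.restrict S) →
          ∫⁻ z in PorousMedium.Q (x, τ) ρ, ‖f z‖ₑ ^ q ≠ ⊤ := fun {E _ f q} hq hf => by
        have h1 := lintegral_rpow_enorm_lt_top_of_eLpNorm_lt_top
          (by simpa using hq) ENNReal.ofReal_ne_top hf.2
        rw [ENNReal.toReal_ofReal hq.le] at h1
        exact ((lintegral_mono_set hQS).trans_lt h1).ne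
      have hvol : volume (PorousMedium.Q (x, τ) ρ) ≠ 0 := by
        rw [PorousMedium.volume_Q _ hρ]
        have := PorousMedium.unitVol_pos N
        exact (ENNReal.ofReal_pos.2 (by positivity)).ne'
      have hvolt : volume (PorousMedium.Q (x, τ) ρ) ≠ ⊤ := by
        rw [PorousMedium.volume_Q _ hρ]; exact ENNReal.ofReal_ne_top
      refine ⟨PorousMedium.Q (x, τ) (ρ / 2), ?_, _, ?_,
        (ae_le_essSup (f := fun z => ‖u z‖ₑ)).mono fun z hz => hz.trans
          (hest (x, τ) ρ hρ (hQS.trans hScyl))⟩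
      · have hO : Metric.ball x (ρ / 2) ×ˢ Ioo (τ - (ρ / 2) ^ 2) (t + ρ ^ 2 / 8) ∈ 𝓝 (x, t) :=
          prod_mem_nhds (Metric.ball_mem_nhds x (by positivity))
            (Ioo_mem_nhds (by
              have : (ρ / 2) ^ 2 = ρ ^ 2 / 4 := by ring
              linarith) (by linarith))
        refine mem_of_superset (inter_mem (mem_nhdsWithin_of_mem_nhds hO) self_mem_nhdsWithin) ?_
        rintro z ⟨hz, hzK⟩
        exact ⟨hz.1, hz.2.1, le_min hz.2.2.le (hKc hzK).2.2⟩
      · refine ENNReal.mul_ne_top ENNReal.ofReal_ne_top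
          (ENNReal.rpow_ne_top_of_nonneg (by positivity) (ENNReal.mul_ne_top ?_ ?_))
        · refine ENNReal.add_ne_top.2 ⟨ENNReal.one_ne_top,
            ENNReal.rpow_ne_top_of_nonneg he0.le ?_⟩
          refine ENNReal.rpow_ne_top_of_nonneg (by positivity) (ENNReal.mul_ne_top
            (ENNReal.rpow_ne_top_of_nonneg (by positivity) ENNReal.ofReal_ne_top) ?_)
          rw [setLAverage_eq]
          exact ENNReal.div_ne_top (hfin (by positivity) (hF S hSc hScyl)) hvol
        · rw [setLAverage_eq]
          refine ENNReal.div_ne_top ?_ hvol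
          rw [lintegral_add_right _ measurable_const]
          refine ENNReal.add_ne_top.2 ⟨hfin (by linarith) (hur S hSc hScyl), ?_⟩
          simpa using hvolt
  obtain ⟨M, hM, hMb⟩ := hloc
  refine ⟨(hur K hK hKc).1, ?_⟩
  rw [eLpNorm_exponent_top]
  exact (essSup_le_of_ae_le M hMb).trans_lt hM.lt_top
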